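/- Let $\mathbb S=\mathbb R/\mathbb Z$. For $\gamma\in W^{1,1}=W^{1,1}(\mathbb S,\mathbb R^2)$ (norm $\|\gamma\|_{L^1}+\|\gamma'\|_{L^1}$) let $\mathcal L(\gamma)=\int_0^1|\gamma'(u)|\,du$, and for $\lambda>0$, $a\in\mathbb R$, $\mathcal L(\gamma)\neq0$ put $$\xi_\gamma(u)=\frac1{\mathcal L(\gamma)}\int_0^u|\gamma'(\tau)|\,d\tau\quad(0\le u<1),\qquad \mathcal G^\lambda(x)=-\frac{\cosh\big((|x|-\tfrac12)/\lambda\big)}{2\lambda\sinh\big(1/(2\lambda)\big)},$$ $$F_{\lambda,a}(\gamma)(u)=-\frac{\mathcal L(\gamma)^{a-2}}{\lambda^2}\Big(\gamma(u)+\int_0^1\gamma(v)\,\mathcal G^\lambda\big(\xi_\gamma(v)-\xi_\gamma(u)\big)\frac{|\gamma'(v)|}{\mathcal L(\gamma)}\,dv\Big),$$ and $F_{\lambda,a}(\gamma)=0$ if $\mathcal L(\gamma)=0$. For an interval $I\ni0$, a solution of (GFa) on $I$ is a map $X\in C^1(I;W^{1,1})$ with $\partial_tX=F_{\lambda,a}(X)$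 on $I$ (one-sided derivatives at end points of $I$); (GF2) is (GFa) with $a=2$. **Theorem 1.1.** Let $\lambda>0$, $a\in\mathbb R$ and $X_0\in W^{1,1}$ with $\mathcal L(X_0)>0$. (i) *(Local well-posedness)* There is $T_0>0$ such that (GFa) has a unique solution $X\in C^1([-T_0,T_0];W^{1,1})$ with $X(0)=X_0$. (ii) *(Global existence via $a=2$)* Let $X$ be a solution of (GFa) on an interval $J\ni0$ with $X(0)=X_0$ and $\mathcal L(X(t))>0$ for $t\in J$. Then there are an interval $I\ni0$ and a strictly increasing bijection $\theta:I\to J$ with $\theta(0)=0$ and $\theta'(\tau)=\mathcal L(X(\theta(\tau)))^{2-a}$ such that $X\circ\theta$ extends to a solution of (GF2) on $I\cup[0,\infty)$. Conversely, if $Y$ is a solution of (GF2) on an interval $I\ni0$ with $Y(0)=X_0$, then there are an interval $J\ni0$ and a strictly increasing bijection $\varphi:J\to I$ with $\varphi(0)=0$ and $\varphi'(t)=\mathcal L(Y(\varphi(t)))^{a-2}$ such that $Y\circ\varphi$ is a solution of (GFa) on $J$. Moreover (GF2) has exactly one solution on $[0,\infty)$ with initial value $X_0$. (iii) *(Exponential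 decay of length)* If $X$ is a solution of (GF2) on an interval $I\ni 0$ with $X(0)=X_0$, then $\mathcal L(X(t))\le\mathcal L(X_0)\,e^{-4t/(1+8\lambda^2)}$ for all $t\in I$ with $t\ge0$. (iv) *(Convergence)* If $X$ is the solution of (GF2) on $[0,\infty)$ with $X(0)=X_0$, then as $t\to\infty$ $X(t)$ converges uniformly and in $W^{1,1}$ to a constant map. Solutions of (GFa) collapse to a point in finite time if $a<2$ and in infinite time if $a\ge2$. Precisely: - If $a<2$, there are $0<T<\infty$, a point $c\in\mathbb R^2$ and a solution $X$ of (GFa) on $[0,T)$ with $X(0)=X_0$ and $\mathcal L(X(t))>0$ for $0\le t<T$, such that $X(t)\to c$ uniformly and in $W^{1,1}$ as $t\uparrow T$; every solution of (GFa) with initial value $X_0$ on an interval $J\ni0$ coincides with $X$ on $J\cap[0,T)$ and equals the constant map $c$ on $J\cap[T,\infty)$. - If $a\ge2$, there are a point $c\in\mathbb R^2$ and a solution $X$ of (GFa) on $[0,\infty)$ with $X(0)=X_0$ and $\mathcal L(X(t))>0$ for all $t\ge0$, such that $X(t)\to c$ uniformly and in $W^{1,1}$ as $t\to\infty$; every solution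 of (GFa) with initial value $X_0$ on an interval $J\ni0$ coincides with $X$ on $J\cap[0,\infty)$. -/

import Mathlib

open MeasureTheory Set Filter Topology
open scoped ContDiff

noncomputable section

/-- The Euclidean plane. -/
abbrev Plane : Type := EuclideanSpace ℝ (Fin 2)

/-- `L¹(𝕊, ℝ²)`, where `𝕊 = ℝ/ℤ` carries the Lebesgue measure of total mass `1`. -/
abbrev CircleL1 : Type := Lp Plane 1 (volume : Measure UnitAddCircle)

/-- `g` is the weak derivative of `f` on the circle: integration by parts holds against every smooth
`1`-periodic test function. -/
def IsWeakDeriv (f g : UnitAddCircle → Plane) : Prop :=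
  ∀ φ : ℝ → ℝ, ContDiff ℝ ∞ φ → Function.Periodic φ 1 →
    ∫ u in (0 : ℝ)..1, deriv φ u • f (u : UnitAddCircle) =
      -∫ u in (0 : ℝ)..1, φ u • g (u : UnitAddCircle)

theorem CircleL1.intervalIntegrable_smul (f : CircleL1) {φ : ℝ → ℝ} (hφ : Continuous φ) :
    IntervalIntegrable (fun u : ℝ => φ u • f (u : UnitAddCircle)) volume 0 1 := by
  have h1 : Integrable (fun u : ℝ => f (u : UnitAddCircle)) (volume.restrict (Ioc (0 : ℝ) (0 + 1))) :=
    (UnitAddCircle.measurePreserving_mk 0).integrable_comp_of_integrable (L1.integrable_coeFn f)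
  have h2 : IntervalIntegrable (fun u : ℝ => f (u : UnitAddCircle)) volume 0 1 := by
    rw [intervalIntegrable_iff_integrableOn_Ioc_of_le zero_le_one]
    simpa [IntegrableOn] using h1
  exact h2.continuousOn_smul hφ.continuousOn

theorem circle_intervalIntegral_congr {f g : UnitAddCircle → Plane} (h : f =ᵐ[volume] g)
    (φ : ℝ → ℝ) :
    ∫ u in (0 : ℝ)..1, φ u • f (u : UnitAddCircle) =
      ∫ u in (0 : ℝ)..1, φ u • g (u : UnitAddCircle) := by
  have h1 := (UnitAddCircle.measurePreserving_mk 0).quasiMeasurePreserving.ae_eq_comp h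
  rw [zero_add] at h1
  rw [intervalIntegral.integral_of_le zero_le_one, intervalIntegral.integral_of_le zero_le_one]
  refine integral_congr_ae ?_
  filter_upwards [h1] with u hu
  simp only [Function.comp_apply] at hu
  rw [hu]

/-- The Sobolev space `W^{1,1}(𝕊, ℝ²)` as a subspace of `L¹ × L¹`: pairs `(f, f')` of `L¹` functions such that `f'` is the weak
derivative of `f`, with the norm `‖f‖_{L¹} + ‖f'‖_{L¹}`. -/
def W11Submodule : Submodule ℝ (WithLp 1 (CircleL1 × CircleL1)) where
  carrier := {p | IsWeakDeriv p.fst p.snd}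
  zero_mem' := by
    intro φ _ _
    have h0 : ((0 : CircleL1) : UnitAddCircle → Plane) =ᵐ[volume] 0 := Lp.coeFn_zero _ _ _
    simp only [WithLp.zero_fst, WithLp.zero_snd]
    rw [circle_intervalIntegral_congr h0, circle_intervalIntegral_congr h0]
    simp
  add_mem' := by
    intro p q hp hq φ hφ hper
    simp only [WithLp.add_fst, WithLp.add_snd]
    rw [circle_intervalIntegral_congr (Lp.coeFn_add p.fst q.fst),
      circle_intervalIntegral_congr (Lp.coeFn_add p.snd q.snd)]
    simp only [Pi.add_apply, smul_add]
    have hd : Continuous (deriv φ) := hφ.continuous_deriv (by simp)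
    rw [intervalIntegral.integral_add (CircleL1.intervalIntegrable_smul _ hd)
        (CircleL1.intervalIntegrable_smul _ hd),
      intervalIntegral.integral_add (CircleL1.intervalIntegrable_smul _ hφ.continuous)
        (CircleL1.intervalIntegrable_smul _ hφ.continuous), hp φ hφ hper, hq φ hφ hper, neg_add]
  smul_mem' := by
    intro c p hp φ hφ hper
    simp only [WithLp.smul_fst, WithLp.smul_snd]
    rw [circle_intervalIntegral_congr (Lp.coeFn_smul c p.fst),
      circle_intervalIntegral_congr (Lp.coeFn_smul c p.snd)]
    simp only [Pi.smul_apply, smul_comm _ c, intervalIntegral.integral_smul]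
    rw [hp φ hφ hper, smul_neg]

/-- The normed space `W^{1,1}(𝕊, ℝ²)`. -/
abbrev W11 : Type := W11Submodule

namespace W11

/-- The underlying (a.e. defined) map `γ : 𝕊 → ℝ²`. -/
def fn (γ : W11) : UnitAddCircle → Plane := γ.1.fst

/-- The weak derivative `γ'`. -/
def wderiv (γ : W11) : UnitAddCircle → Plane := γ.1.snd

/-- The length `𝓛(γ) = ∫ |γ'|`. -/
def length (γ : W11) : ℝ := ∫ u : UnitAddCircle, ‖γ.wderiv u‖

/-- `ξ_γ(u) = 𝓛(γ)⁻¹ ∫₀ᵘ |γ'|`, where `u ∈ 𝕊` is represented by a number in `[0,1)`. -/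
def arc (γ : W11) (u : UnitAddCircle) : ℝ :=
  (1 / γ.length) * ∫ τ in (0 : ℝ)..(AddCircle.equivIco 1 0 u : ℝ), ‖γ.wderiv (τ : UnitAddCircle)‖

/-- The constant map `u ↦ c`. -/
def const (c : Plane) : W11 :=
  ⟨WithLp.toLp 1 (Lp.const 1 volume c, 0), by
    intro φ hφ hper
    have h0 : ((0 : CircleL1) : UnitAddCircle → Plane) =ᵐ[volume] 0 := Lp.coeFn_zero _ _ _
    simp only [WithLp.toLp_fst, WithLp.toLp_snd]
    rw [circle_intervalIntegral_congr (Lp.coeFn_const (p := 1) (μ := volume) (c := c)),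
      circle_intervalIntegral_congr h0]
    have hd : Continuous (deriv φ) := hφ.continuous_deriv (by simp)
    have h1 : ∫ u in (0 : ℝ)..1, deriv φ u = 0 := by
      rw [intervalIntegral.integral_deriv_eq_sub
        (fun x _ => (hφ.differentiable (by simp)).differentiableAt) (hd.intervalIntegrable _ _)]
      have := hper 0
      rw [zero_add] at this
      rw [this, sub_self]
    simp [intervalIntegral.integral_smul_const, h1]⟩

end W11

/-- The periodic Green's function, on `[-1,1]`:
`𝒢^λ(x) = - cosh((|x| - 1/2)/λ) / (2 λ sinh(1/(2λ)))`. -/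
def greenKernel (lam x : ℝ) : ℝ :=
  -(Real.cosh ((|x| - 1 / 2) / lam) / (2 * lam * Real.sinh (1 / (2 * lam))))

/-- The convolution along `γ`,
`(γ ∗_γ 𝒢^λ)(u) = ∫ γ(v) 𝒢^λ(ξ_γ(v) - ξ_γ(u)) (|γ'(v)| / 𝓛(γ)) dv`. -/
def curveConv (lam : ℝ) (γ : W11) (u : UnitAddCircle) : Plane :=
  ∫ v : UnitAddCircle,
    (greenKernel lam (γ.arc v - γ.arc u) * (‖γ.wderiv v‖ / γ.length)) • γ.fn v

/-- The gradient `∇𝓛_{λ,a}(γ) = (𝓛(γ)^{a-2} / λ²) (γ + γ ∗_γ 𝒢^λ)`. -/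
def lengthGradient (lam a : ℝ) (γ : W11) (u : UnitAddCircle) : Plane :=
  (γ.length ^ (a - 2) / lam ^ 2) • (γ.fn u + curveConv lam γ u)

open Classical in
/-- The vector field `F_{λ,a}`: minus the gradient, and zero on curves of zero length. -/
def flowField (lam a : ℝ) (γ : W11) (u : UnitAddCircle) : Plane :=
  if γ.length ≠ 0 then -lengthGradient lam a γ u else 0

/-- `X ∈ C¹(I; W^{1,1})` solves `∂ₜ X = F_{λ,a}(X)` on the interval `I`. The function `V` is the time
derivative of `X`, which is one-sided at end points of `I`; only the values of `X` on `I` matter. -/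
def IsGradientFlow (lam a : ℝ) (I : Set ℝ) (X : ℝ → W11) : Prop :=
  ∃ V : ℝ → W11, ContinuousOn V I ∧
    ∀ t ∈ I, HasDerivWithinAt X (V t) I t ∧ (V t).fn =ᵐ[volume] flowField lam a (X t)

/-- `X(t)` converges to the constant map with value `c` along the filter `l`, both in the norm of
`W^{1,1}` and uniformly on `𝕊` (for the continuous representatives `x t` of `X t`). -/
def ConvergesToPoint (X : ℝ → W11) (l : Filter ℝ) (c : Plane) : Prop :=
  Tendsto X l (𝓝 (W11.const c)) ∧
    ∃ x : ℝ → C(UnitAddCircle, Plane), (∀ t, (x t : UnitAddCircle → Plane) =ᵐ[volume] (X t).fn) ∧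
      TendstoUniformly (fun t u => x t u) (fun _ => c) l

end

/-!
The vector field with exponent `2` turns out to be globally Lipschitz on `W11`, even across the
curves of length zero, and the flows with all other exponents are time changes of that one flow.

Write `K` for the periodic Green's function of `1 - λ² ∂²` (`perKernel`), a probability density on
the circle, so that `𝒢^λ = -K` on `[-1, 1]`. In the arc length parameter `ξ_γ`, the field is
`F_{λ,2}(γ) = -λ⁻² (γ - m)`, where `m` is the mean of `γ` for the density `K (ξ_γ(v) - ξ_γ(u))`.
Integration by parts (`curveMean_sub_eq`) shows that its weak derivative is
`-λ⁻² (γ' - (|γ'| / 𝓛) T)` with `T = ∫ K (ξ_γ(u) - ξ_γ(v)) γ'(v) dv`. All terms have size at most a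
multiple of `𝓛(γ)`, and `ξ_γ` depends on `γ` with a Lipschitz constant of size `1 / 𝓛(γ)`; the two
effects cancel, which gives `W11.norm_field_sub_le`. A global Picard iteration then solves the flow
with exponent `2` on all of `ℝ`, and by uniqueness its length never vanishes, because constant
curves are equilibria (`exists_isGradientFlow_univ`).

Decay of the length rests on a spectral gap. Pairing a backward Euler step `γ' - h F'` with the unit
tangent bounds its `L¹` norm below by `𝓛 + (h / λ²) (𝓛 - Q / 𝓛)`, where `Q = ∫ ⟪T, γ'⟫` is the
energy of the vector measure `γ' dv` for the kernel `K`. As `K` is a reproducing kernel,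
`Q = ∫ |w|² + λ² |w'|²` for the potential `w` of this measure; `w` has mean zero on a circle of
length one, so `|w| ≤ ½ ∫ |w'|`, and duality with arc length gives `(1 + 4 λ²) Q ≤ 𝓛²`
(`energy_perKernel_le`). Hence the length decays at rate `4 / (1 + 4 λ²)`, and in particular at rate
`4 / (1 + 8 λ²)` (`W11.length_dissipation`). Since the speed of the flow is bounded by a multiple of
its length, the flow is integrable in time and converges to a constant curve.

For general `a`, the inverse of the clock `τ ↦ ∫₀^τ 𝓛(Y)^(2-a)` turns the global flow `Y` with
exponent `2` into the maximal flow of positive length with exponent `a`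
(`exists_maximal_time_change`), and every flow with exponent `a` arises in this way as long as its
length is positive (`IsGradientFlow.eqOn_comp`). By the decay of the length the clock converges to
a finite time for `a < 2` and diverges for `a ≥ 2`, which separates the two kinds of collapse.
After a finite collapse time the length, being nonincreasing, remains zero, so the flow rests.
-/

noncomputable section

/-! ### The periodic Green's function -/

/-- The `1`-periodic extension of `-greenKernel lam` from `[-1, 1]` to `ℝ`: the periodic Green's
function of `1 - lam ^ 2 ∂²`, a probability density on the circle. -/
def perKernel (lam x : ℝ) : ℝ :=
  Real.cosh ((Int.fract x - 1 / 2) / lam) / (2 * lam * Real.sinh (1 / (2 * lam)))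

/-- The derivative of `perKernel` off the integers, where it jumps. -/
def perKernelDeriv (lam x : ℝ) : ℝ :=
  Real.sinh ((Int.fract x - 1 / 2) / lam) / (lam * (2 * lam * Real.sinh (1 / (2 * lam))))

/-- An upper bound for `perKernel lam`. -/
def kernelBound (lam : ℝ) : ℝ :=
  Real.cosh (1 / (2 * lam)) / (2 * lam * Real.sinh (1 / (2 * lam)))

section Kernel

variable {lam : ℝ}

theorem sinh_inv_pos (hlam : 0 < lam) : 0 < Real.sinh (1 / (2 * lam)) :=
  Real.sinh_pos_iff.2 (by positivity)

theorem perKernel_periodic (lam : ℝ) : Function.Periodic (perKernel lam) 1 := by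
  intro x; simp [perKernel]

theorem perKernelDeriv_periodic (lam : ℝ) : Function.Periodic (perKernelDeriv lam) 1 := by
  intro x; simp [perKernelDeriv]

theorem perKernel_fract (lam x y : ℝ) :
    perKernel lam (y - Int.fract x) = perKernel lam (y - x) := by
  have : y - Int.fract x = y - x + (⌊x⌋ : ℤ) := by rw [Int.fract]; ring
  rw [this, perKernel, perKernel, Int.fract_add_intCast]

theorem perKernelDeriv_fract (lam x y : ℝ) :
    perKernelDeriv lam (y - Int.fract x) = perKernelDeriv lam (y - x) := by
  have : y - Int.fract x = y - x + (⌊x⌋ : ℤ) := by rw [Int.fract]; ring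
  rw [this, perKernelDeriv, perKernelDeriv, Int.fract_add_intCast]

theorem perKernel_eq_of_mem {x : ℝ} (h0 : 0 ≤ x) (h1 : x ≤ 1) :
    perKernel lam x =
      Real.cosh ((x - 1 / 2) / lam) / (2 * lam * Real.sinh (1 / (2 * lam))) := by
  rcases h1.lt_or_eq with h | rfl
  · rw [perKernel, Int.fract_eq_self.2 ⟨h0, h⟩]
  · rw [perKernel, Int.fract_one, ← Real.cosh_neg]
    congr 2; ring

theorem perKernel_neg (lam x : ℝ) : perKernel lam (-x) = perKernel lam x := by
  by_cases h : Int.fract x = 0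
  · have h' : Int.fract (-x) = 0 := Int.fract_neg_eq_zero.2 h
    rw [perKernel, perKernel, h, h']
  · rw [perKernel, perKernel, Int.fract_neg h, ← Real.cosh_neg]
    congr 2; ring

theorem greenKernel_eq {x : ℝ} (hx : |x| ≤ 1) : greenKernel lam x = -perKernel lam x := by
  have : perKernel lam x = perKernel lam |x| := by
    rcases abs_cases x with ⟨h, -⟩ | ⟨h, -⟩ <;> rw [h]
    rw [perKernel_neg]
  rw [this, perKernel_eq_of_mem (abs_nonneg x) hx, greenKernel]

theorem perKernel_continuous (lam : ℝ) : Continuous (perKernel lam) := by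
  have h : ContinuousOn (fun y : ℝ => Real.cosh ((y - 1 / 2) / lam) /
      (2 * lam * Real.sinh (1 / (2 * lam)))) (Icc 0 1) := by
    apply Continuous.continuousOn
    fun_prop
  refine h.comp_fract'' ?_
  rw [← Real.cosh_neg]
  congr 2; ring

theorem perKernelDeriv_measurable (lam : ℝ) : Measurable (perKernelDeriv lam) := by
  unfold perKernelDeriv
  fun_prop

theorem perKernel_nonneg (hlam : 0 < lam) (x : ℝ) : 0 ≤ perKernel lam x := by
  have := sinh_inv_pos hlam
  have := Real.cosh_pos ((Int.fract x - 1 / 2) / lam)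
  unfold perKernel
  positivity

theorem abs_fract_sub_half_div_le (hlam : 0 < lam) (x : ℝ) :
    |(Int.fract x - 1 / 2) / lam| ≤ 1 / (2 * lam) := by
  have h0 := Int.fract_nonneg x
  have h1 := (Int.fract_lt_one x).le
  rw [abs_div, abs_of_pos hlam, ← div_div]
  gcongr
  rw [abs_le]; constructor <;> linarith

theorem perKernel_le (hlam : 0 < lam) (x : ℝ) : perKernel lam x ≤ kernelBound lam := by
  have := sinh_inv_pos hlam
  unfold perKernel kernelBound
  gcongr ?_ / _
  rw [Real.cosh_le_cosh]
  exact (abs_fract_sub_half_div_le hlam x).trans (le_abs_self _)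

theorem kernelBound_nonneg (hlam : 0 < lam) : 0 ≤ kernelBound lam :=
  (perKernel_nonneg hlam 0).trans (perKernel_le hlam 0)

theorem norm_perKernel_le (hlam : 0 < lam) (x : ℝ) : ‖perKernel lam x‖ ≤ kernelBound lam := by
  rw [Real.norm_of_nonneg (perKernel_nonneg hlam x)]
  exact perKernel_le hlam x

theorem norm_perKernelDeriv_le (hlam : 0 < lam) (x : ℝ) :
    ‖perKernelDeriv lam x‖ ≤ 1 / (2 * lam ^ 2) := by
  have hs := sinh_inv_pos hlam
  have h := abs_le.1 (abs_fract_sub_half_div_le hlam x)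
  have h1 : |Real.sinh ((Int.fract x - 1 / 2) / lam)| ≤ Real.sinh (1 / (2 * lam)) := by
    rw [abs_le, ← Real.sinh_neg]
    exact ⟨Real.sinh_le_sinh.2 h.1, Real.sinh_le_sinh.2 h.2⟩
  rw [perKernelDeriv, Real.norm_eq_abs, abs_div,
    abs_of_pos (show 0 < lam * (2 * lam * Real.sinh (1 / (2 * lam))) by positivity)]
  calc _ ≤ Real.sinh (1 / (2 * lam)) / (lam * (2 * lam * Real.sinh (1 / (2 * lam)))) := by gcongr
    _ = _ := by field_simp

theorem hasDerivAt_cosh_affine (c N x : ℝ) :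
    HasDerivAt (fun y => Real.cosh ((y - c) / lam) / N)
      (Real.sinh ((x - c) / lam) / (lam * N)) x := by
  have h := ((((hasDerivAt_id' x).sub_const c).div_const lam).cosh).div_const N
  refine h.congr_deriv ?_
  rw [← div_div]
  ring

theorem hasDerivAt_perKernel {x : ℝ} (hx : x ∉ range ((↑) : ℤ → ℝ)) :
    HasDerivAt (perKernel lam) (perKernelDeriv lam x) x := by
  have hfl : (⌊x⌋ : ℝ) < x := lt_of_le_of_ne (Int.floor_le x) fun h => hx ⟨_, h⟩
  have hev : perKernel lam =ᶠ[𝓝 x] fun y => Real.cosh ((y - (⌊x⌋ + 1 / 2)) / lam) /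
      (2 * lam * Real.sinh (1 / (2 * lam))) := by
    filter_upwards [Ioo_mem_nhds hfl (Int.lt_floor_add_one x)] with y hy
    have : ⌊y⌋ = ⌊x⌋ := Int.floor_eq_iff.2 ⟨hy.1.le, hy.2⟩
    rw [perKernel, Int.fract, this, sub_sub]
  have h := hasDerivAt_cosh_affine (lam := lam) (⌊x⌋ + 1 / 2)
    (2 * lam * Real.sinh (1 / (2 * lam))) x
  rw [perKernelDeriv, Int.fract, sub_sub]
  exact h.congr_of_eventuallyEq hev

theorem perKernelDeriv_intervalIntegrable (hlam : 0 < lam) (c a b : ℝ) :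
    IntervalIntegrable (fun z => perKernelDeriv lam (z - c)) volume a b := by
  rw [intervalIntegrable_iff]
  refine Measure.integrableOn_of_bounded (M := 1 / (2 * lam ^ 2)) (by simp)
    ((perKernelDeriv_measurable lam).comp (measurable_id.sub_const c)).aestronglyMeasurable ?_
  exact ae_of_all _ fun x => norm_perKernelDeriv_le hlam _

/-- The fundamental theorem of calculus for `perKernel`, across its kinks at the integers. -/
theorem integral_perKernelDeriv (hlam : 0 < lam) (a b : ℝ) :
    ∫ z in a..b, perKernelDeriv lam z = perKernel lam b - perKernel lam a := by
  refine integral_eq_of_hasDerivAt_off_countable _ _ (countable_range ((↑) : ℤ → ℝ))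
    (perKernel_continuous lam).continuousOn (fun x hx => hasDerivAt_perKernel hx.2) ?_
  simpa using perKernelDeriv_intervalIntegrable hlam 0 a b

theorem abs_perKernel_sub_le (hlam : 0 < lam) (a b : ℝ) :
    |perKernel lam a - perKernel lam b| ≤ 1 / (2 * lam ^ 2) * |a - b| := by
  rw [← integral_perKernelDeriv hlam]
  exact intervalIntegral.norm_integral_le_of_norm_le_const
    fun x _ => norm_perKernelDeriv_le hlam x

theorem integral_perKernel (hlam : 0 < lam) : ∫ z in (0 : ℝ)..1, perKernel lam z = 1 := by
  have hs := sinh_inv_pos hlam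
  have h : ∀ x ∈ uIcc (0 : ℝ) 1, HasDerivAt (fun y => Real.sinh ((y - 1 / 2) / lam) /
      (2 * Real.sinh (1 / (2 * lam))))
      (Real.cosh ((x - 1 / 2) / lam) / (2 * lam * Real.sinh (1 / (2 * lam)))) x := by
    intro x _
    have h := ((((hasDerivAt_id' x).sub_const (1 / 2)).div_const lam).sinh).div_const
      (2 * Real.sinh (1 / (2 * lam)))
    refine h.congr_deriv ?_
    field_simp
  have h2 : ∫ z in (0 : ℝ)..1, perKernel lam z = ∫ z in (0 : ℝ)..1,
      Real.cosh ((z - 1 / 2) / lam) / (2 * lam * Real.sinh (1 / (2 * lam))) := by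
    refine intervalIntegral.integral_congr fun z hz => ?_
    rw [uIcc_of_le zero_le_one] at hz
    exact perKernel_eq_of_mem hz.1 hz.2
  rw [h2, intervalIntegral.integral_eq_sub_of_hasDerivAt h
    (Continuous.intervalIntegrable (by fun_prop) _ _)]
  have e1 : (1 - 1 / 2) / lam = 1 / (2 * lam) := by field_simp; norm_num
  have e2 : (0 - 1 / 2) / lam = -(1 / (2 * lam)) := by field_simp; norm_num
  rw [e1, e2, Real.sinh_neg]
  field_simp
  norm_num

theorem integral_perKernel_sub (hlam : 0 < lam) (x : ℝ) :
    ∫ z in (0 : ℝ)..1, perKernel lam (z - x) = 1 := by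
  rw [intervalIntegral.integral_comp_sub_right (fun z => perKernel lam z)]
  have := (perKernel_periodic lam).intervalIntegral_add_eq (0 - x) 0
  rw [zero_add] at this
  rw [show 1 - x = 0 - x + 1 by ring, this, integral_perKernel hlam]

theorem integral_perKernelDeriv_sub (hlam : 0 < lam) (x : ℝ) :
    ∫ z in (0 : ℝ)..1, perKernelDeriv lam (z - x) = 0 := by
  rw [intervalIntegral.integral_comp_sub_right (fun z => perKernelDeriv lam z),
    integral_perKernelDeriv hlam, show 1 - x = 0 - x + 1 by ring, perKernel_periodic lam, sub_self]

theorem kernel_product_intervalIntegrable (hlam : 0 < lam) (x y a b : ℝ) :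
    IntervalIntegrable (fun z => perKernel lam (z - x) * perKernel lam (z - y) +
      lam ^ 2 * (perKernelDeriv lam (z - x) * perKernelDeriv lam (z - y))) volume a b := by
  refine IntervalIntegrable.add ?_ (IntervalIntegrable.const_mul ?_ _)
  · have := perKernel_continuous lam
    exact Continuous.intervalIntegrable (by fun_prop) _ _
  · rw [intervalIntegrable_iff]
    refine Measure.integrableOn_of_bounded (M := 1 / (2 * lam ^ 2) * (1 / (2 * lam ^ 2))) (by simp)
      (((perKernelDeriv_measurable lam).comp (measurable_id.sub_const x)).mul
        ((perKernelDeriv_measurable lam).comp (measurable_id.sub_const y))).aestronglyMeasurable ?_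
    refine ae_of_all _ fun z => ?_
    rw [norm_mul]
    exact mul_le_mul (norm_perKernelDeriv_le hlam _) (norm_perKernelDeriv_le hlam _)
      (norm_nonneg _) (by positivity)

theorem integral_kernel_product_piece (hlam : 0 < lam) {d a b s : ℝ} (hab : a ≤ b) (ha : 0 ≤ a)
    (hb : b ≤ 1) (hs : ∀ z ∈ Ioo a b, Int.fract (z - d) = z - s) :
    ∫ z in a..b, (perKernel lam (z - d) * perKernel lam (z - 0) +
      lam ^ 2 * (perKernelDeriv lam (z - d) * perKernelDeriv lam (z - 0))) =
    (Real.sinh ((2 * b - s - 1) / lam) - Real.sinh ((2 * a - s - 1) / lam)) *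
      (lam / 2) / (2 * lam * Real.sinh (1 / (2 * lam))) ^ 2 := by
  have hs0 := sinh_inv_pos hlam
  have h := integral_eq_of_hasDerivAt_off_countable_of_le
    (fun z => Real.sinh ((2 * z - s - 1) / lam) *
      (lam / 2) / (2 * lam * Real.sinh (1 / (2 * lam))) ^ 2)
    (fun z => perKernel lam (z - d) * perKernel lam (z - 0) +
      lam ^ 2 * (perKernelDeriv lam (z - d) * perKernelDeriv lam (z - 0))) hab countable_empty
    (Continuous.continuousOn (by fun_prop)) ?_ (kernel_product_intervalIntegrable hlam d 0 a b)
  · rw [h]; ring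
  · intro z hz
    have h0 : Int.fract (z - 0) = z := by
      rw [sub_zero]; exact Int.fract_eq_self.2 ⟨by linarith [hz.1.1], by linarith [hz.1.2]⟩
    have hd := (((((((hasDerivAt_id' z).const_mul 2).sub_const s).sub_const 1).div_const
      lam).sinh).mul_const (lam / 2)).div_const ((2 * lam * Real.sinh (1 / (2 * lam))) ^ 2)
    refine (hd.congr_deriv ?_)
    rw [perKernel, perKernel, perKernelDeriv, perKernelDeriv, h0, hs z hz.1]
    rw [show (2 * z - s - 1) / lam = (z - s - 1 / 2) / lam + (z - 1 / 2) / lam by ring,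
      Real.cosh_add]
    field_simp

/-- `perKernel` is its own reproducing kernel for the inner product `∫ f g + lam ^ 2 f' g'`. -/
theorem integral_kernel_product (hlam : 0 < lam) (x y : ℝ) :
    ∫ z in (0 : ℝ)..1, (perKernel lam (z - x) * perKernel lam (z - y) +
      lam ^ 2 * (perKernelDeriv lam (z - x) * perKernelDeriv lam (z - y))) =
    perKernel lam (x - y) := by
  have hs0 := sinh_inv_pos hlam
  set d := Int.fract (x - y) with hd
  have hd0 : 0 ≤ d := Int.fract_nonneg _
  have hd1 : d < 1 := Int.fract_lt_one _
  -- translate by `y` and reduce the offset `x - y` modulo `1`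
  have hshift : ∫ z in (0 : ℝ)..1, (perKernel lam (z - x) * perKernel lam (z - y) +
      lam ^ 2 * (perKernelDeriv lam (z - x) * perKernelDeriv lam (z - y))) =
      ∫ z in (0 : ℝ)..1, (perKernel lam (z - d) * perKernel lam (z - 0) +
      lam ^ 2 * (perKernelDeriv lam (z - d) * perKernelDeriv lam (z - 0))) := by
    set G : ℝ → ℝ := fun z => perKernel lam (z - d) * perKernel lam (z - 0) +
      lam ^ 2 * (perKernelDeriv lam (z - d) * perKernelDeriv lam (z - 0)) with hG
    have hper : Function.Periodic G 1 := by
      intro z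
      simp only [hG, add_sub_right_comm z 1, perKernel_periodic lam _,
        perKernelDeriv_periodic lam _]
    have h1 : ∀ z, perKernel lam (z - x) * perKernel lam (z - y) +
      lam ^ 2 * (perKernelDeriv lam (z - x) * perKernelDeriv lam (z - y)) = G (z - y) := by
      intro z
      simp only [hG, hd, perKernel_fract, perKernelDeriv_fract, sub_zero]
      rw [show z - y - (x - y) = z - x by ring]
    simp_rw [h1]
    rw [intervalIntegral.integral_comp_sub_right (fun z => G z)]
    have := hper.intervalIntegral_add_eq (0 - y) 0
    rw [zero_add] at this
    rw [show 1 - y = 0 - y + 1 by ring, this]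
  rw [hshift, ← intervalIntegral.integral_add_adjacent_intervals
    (kernel_product_intervalIntegrable hlam d 0 0 d)
    (kernel_product_intervalIntegrable hlam d 0 d 1),
    integral_kernel_product_piece hlam (s := d - 1) hd0 le_rfl hd1.le,
    integral_kernel_product_piece hlam (s := d) hd1.le hd0 le_rfl]
  · have e : perKernel lam (x - y) =
        Real.cosh ((d - 1 / 2) / lam) / (2 * lam * Real.sinh (1 / (2 * lam))) := rfl
    have e1 : (2 * d - (d - 1) - 1) / lam = (d - 1 / 2) / lam + 1 / (2 * lam) := by
      field_simp; ring
    have e2 : (2 * 0 - (d - 1) - 1) / lam = -((d - 1 / 2) / lam + 1 / (2 * lam)) := by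
      field_simp; ring
    have e3 : (2 * 1 - d - 1) / lam = 1 / (2 * lam) - (d - 1 / 2) / lam := by
      field_simp; ring
    have e4 : (2 * d - d - 1) / lam = -(1 / (2 * lam) - (d - 1 / 2) / lam) := by
      field_simp; ring
    rw [e, e1, e2, e3, e4, Real.sinh_neg, Real.sinh_neg, Real.sinh_add, Real.sinh_sub]
    field_simp
    ring
  · intro z hz
    rw [Int.fract_eq_self.2 ⟨by linarith [hz.1], by linarith [hz.2]⟩]
  · intro z hz
    rw [← Int.fract_add_one, Int.fract_eq_self.2 ⟨by linarith [hz.1], by linarith [hz.2]⟩]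
    ring

end Kernel

/-! ### Products and substitutions with indefinite integrals -/

section IntegralTools

variable {E : Type*} [NormedAddCommGroup E] [NormedSpace ℝ E]

theorem integrable_bdd_smul {X : Type*} [MeasurableSpace X] {μ : Measure X} {b : X → ℝ}
    (hb : Measurable b) {M : ℝ} (hM : ∀ x, ‖b x‖ ≤ M) {p : X → E} (hp : Integrable p μ) :
    Integrable (fun x => b x • p x) μ :=
  hp.bdd_smul M hb.aestronglyMeasurable (ae_of_all _ hM)

theorem integrable_smul_bdd {X : Type*} [MeasurableSpace X] {μ : Measure X} {b : X → ℝ}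
    (hb : Integrable b μ) {f : X → E} (hf : AEStronglyMeasurable f μ) {M : ℝ}
    (hM : ∀ x, ‖f x‖ ≤ M) : Integrable (fun x => b x • f x) μ :=
  hb.smul_bdd M hf (ae_of_all _ hM)

theorem integrable_const_smul_sub {X : Type*} [MeasurableSpace X] {μ : Measure X} (c : ℝ)
    {p q : X → E} (hp : Integrable p μ) (hq : Integrable q μ) :
    Integrable (fun x => c • (p x - q x)) μ :=
  (hp.sub hq).smul c

variable [CompleteSpace E] in
/-- Fubini for a bounded kernel against an integrable density. -/
theorem integral_integral_kernel_smul_swap {X Y : Type*} [MeasurableSpace X] [MeasurableSpace Y]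
    {μ : Measure X} {ν : Measure Y} [IsFiniteMeasure μ] [IsFiniteMeasure ν]
    {b : Y → X → ℝ} (hb : Measurable (Function.uncurry b)) {M : ℝ} (hM : ∀ y x, ‖b y x‖ ≤ M)
    {p : X → E} (hp : Integrable p μ) :
    ∫ y, ∫ x, b y x • p x ∂μ ∂ν = ∫ x, (∫ y, b y x ∂ν) • p x ∂μ := by
  rw [integral_integral_swap]
  · exact integral_congr_ae (ae_of_all _ fun x => integral_smul_const _ _)
  · have h1 : Integrable (fun z : Y × X => p z.2) (ν.prod μ) := hp.comp_snd ν
    exact h1.bdd_smul M hb.aestronglyMeasurable (ae_of_all _ fun z => hM z.1 z.2)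

variable [CompleteSpace E] in
/-- Integration by parts for two indefinite integrals of integrable functions. -/
theorem integral_smul_primitive_add {f : ℝ → ℝ} {g : ℝ → E} {a b : ℝ} (hab : a ≤ b)
    (hf : IntervalIntegrable f volume a b) (hg : IntervalIntegrable g volume a b) :
    (∫ v in a..b, f v • ∫ r in a..v, g r) + ∫ v in a..b, (∫ r in a..v, f r) • g v =
      (∫ v in a..b, f v) • ∫ v in a..b, g v := by
  rw [intervalIntegrable_iff_integrableOn_Ioc_of_le hab] at hf hg
  simp only [intervalIntegral.integral_of_le hab]
  set μ := volume.restrict (Ioc a b) with hμ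
  have hh : Integrable (fun z : ℝ × ℝ => f z.1 • g z.2) (μ.prod μ) := Integrable.smul_prod hf hg
  set S : Set (ℝ × ℝ) := {z | z.2 ≤ z.1} with hS
  have hSm : MeasurableSet S := measurableSet_le measurable_snd measurable_fst
  have h1 : ∫ v, (f v • ∫ r in a..v, g r) ∂μ = ∫ z in S, f z.1 • g z.2 ∂(μ.prod μ) := by
    rw [← integral_indicator hSm, integral_prod _ (hh.indicator hSm)]
    refine integral_congr_ae ?_
    filter_upwards [ae_restrict_mem measurableSet_Ioc] with v hv
    have : ∀ r, S.indicator (fun z : ℝ × ℝ => f z.1 • g z.2) (v, r) =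
        f v • (Iic v).indicator g r := by
      intro r
      by_cases h : r ≤ v <;> simp [indicator, hS, h]
    simp_rw [this]
    rw [integral_smul, integral_indicator measurableSet_Iic, hμ,
      Measure.restrict_restrict measurableSet_Iic, intervalIntegral.integral_of_le hv.1.le]
    congr 3
    ext r; simp only [mem_inter_iff, mem_Iic, mem_Ioc]
    constructor
    · intro h; exact ⟨h.2, h.1, h.2.trans hv.2⟩
    · intro h; exact ⟨h.2.1, h.1⟩
  have h2 : ∫ v, ((∫ r in a..v, f r) • g v) ∂μ = ∫ z in Sᶜ, f z.1 • g z.2 ∂(μ.prod μ) := by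
    rw [← integral_indicator hSm.compl, integral_prod_symm _ (hh.indicator hSm.compl)]
    refine integral_congr_ae ?_
    filter_upwards [ae_restrict_mem measurableSet_Ioc] with v hv
    have : ∀ r, Sᶜ.indicator (fun z : ℝ × ℝ => f z.1 • g z.2) (r, v) =
        (Iio v).indicator f r • g v := by
      intro r
      by_cases h : r < v
      · simp [indicator, hS, h]
      · simp [indicator, hS, h, not_lt.1 h]
    simp_rw [this]
    rw [integral_smul_const, integral_indicator measurableSet_Iio, hμ,
      Measure.restrict_restrict measurableSet_Iio, intervalIntegral.integral_of_le hv.1.le,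
      integral_Ioc_eq_integral_Ioo]
    congr 3
    ext r; simp only [mem_inter_iff, mem_Iio, mem_Ioc, mem_Ioo]
    constructor
    · intro h; exact ⟨h.2, h.1, h.2.le.trans hv.2⟩
    · intro h; exact ⟨h.2.1, h.1⟩
  rw [h1, h2, integral_add_compl hSm hh, integral_prod_smul]

/-- Change of variables along the indefinite integral `ξ` of a nonnegative integrable density. -/
theorem integral_comp_primitive {ρ ξ : ℝ → ℝ} {s t : ℝ} (hst : s ≤ t) (hρ0 : ∀ u, 0 ≤ ρ u)
    (hρm : AEStronglyMeasurable ρ (volume.restrict (Ioc s t)))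
    (hξm : Measurable ξ) (hρ : ∀ u ∈ Icc s t, IntervalIntegrable ρ volume s u)
    (hξ : ∀ u ∈ Icc s t, ξ u = ξ s + ∫ r in s..u, ρ r) (hξc : ContinuousOn ξ (Icc s t))
    {h : ℝ → E} (hh : Continuous h) :
    ∫ u in s..t, ρ u • h (ξ u) = ∫ x in (ξ s)..(ξ t), h x := by
  have hmono : MonotoneOn ξ (Icc s t) := by
    intro u hu v hv huv
    rw [hξ u hu, hξ v hv]
    gcongr
    exact intervalIntegral.integral_mono_interval le_rfl hu.1 huv
      (ae_of_all _ hρ0) (hρ v hv)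
  have hsmem : s ∈ Icc s t := left_mem_Icc.2 hst
  have htmem : t ∈ Icc s t := right_mem_Icc.2 hst
  set m := (volume.restrict (Ioc s t)).withDensity (fun u => ENNReal.ofReal (ρ u)) with hm
  have hmass : ∀ u ∈ Icc s t, m (Ioc s u) = ENNReal.ofReal (ξ u - ξ s) := by
    intro u hu
    rw [hm, withDensity_apply _ measurableSet_Ioc, Measure.restrict_restrict measurableSet_Ioc,
      Ioc_inter_Ioc, max_self, min_eq_left hu.2, hξ u hu, add_sub_cancel_left,
      intervalIntegral.integral_of_le hu.1, ofReal_integral_eq_lintegral_ofReal]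
    · exact (intervalIntegrable_iff_integrableOn_Ioc_of_le hu.1).1 (hρ u hu)
    · exact ae_of_all _ hρ0
  have hm0 : m (Ioc s t)ᶜ = 0 := by
    rw [hm, withDensity_apply _ measurableSet_Ioc.compl,
      Measure.restrict_restrict measurableSet_Ioc.compl]
    simp
  have hfin : IsFiniteMeasure m := by
    refine ⟨?_⟩
    rw [← union_compl_self (Ioc s t)]
    refine (measure_union_le _ _).trans_lt ?_
    rw [hm0, hmass t htmem, add_zero]
    exact ENNReal.ofReal_lt_top
  have hmap : m.map ξ = volume.restrict (Ioc (ξ s) (ξ t)) := by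
    have : IsFiniteMeasure (m.map ξ) := Measure.isFiniteMeasure_map m ξ
    refine Measure.ext_of_Iic _ _ fun x => ?_
    rw [Measure.map_apply hξm measurableSet_Iic, Measure.restrict_apply measurableSet_Iic,
      inter_comm, Ioc_inter_Iic]
    have hpre : m (ξ ⁻¹' Iic x) = m (Ioc s t ∩ ξ ⁻¹' Iic x) := by
      refine measure_congr ?_
      have : ∀ᵐ u ∂m, u ∈ Ioc s t := hm0
      filter_upwards [this] with u hu
      exact propext ⟨fun h => ⟨hu, h⟩, fun h => h.2⟩
    rw [hpre]
    rcases lt_or_ge x (ξ s) with hx | hx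
    · have : Ioc s t ∩ ξ ⁻¹' Iic x = ∅ := by
        ext u
        simp only [mem_inter_iff, mem_preimage, mem_Iic, mem_empty_iff_false, iff_false, not_and]
        intro hu h
        exact absurd (hmono hsmem (Ioc_subset_Icc_self hu) hu.1.le) (by linarith)
      rw [this, measure_empty, Ioc_eq_empty, measure_empty]
      simp [hx.le]
    · -- the largest parameter with `ξ ≤ x`
      have hcl : IsCompact (Icc s t ∩ ξ ⁻¹' Iic x) :=
        isCompact_Icc.of_isClosed_subset (hξc.preimage_isClosed_of_isClosed isClosed_Icc isClosed_Iic)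
          inter_subset_left
      obtain ⟨u, ⟨hu, hux⟩, hmax⟩ := hcl.exists_isGreatest ⟨s, hsmem, hx⟩
      have hset : Ioc s t ∩ ξ ⁻¹' Iic x = Ioc s u := by
        ext v
        constructor
        · intro hv; exact ⟨hv.1.1, hmax ⟨Ioc_subset_Icc_self hv.1, hv.2⟩⟩
        · intro hv
          exact ⟨⟨hv.1, hv.2.trans hu.2⟩,
            (hmono ⟨hv.1.le, hv.2.trans hu.2⟩ hu hv.2).trans hux⟩
      have hval : ξ u = min (ξ t) x := by
        rcases le_total (ξ t) x with h | h
        · have : u = t := le_antisymm hu.2 (hmax ⟨htmem, h⟩)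
          rw [this, min_eq_left h]
        · rw [min_eq_right h]
          obtain ⟨v, hv, hvx⟩ := intermediate_value_Icc hu.2
            (hξc.mono (Icc_subset_Icc_left hu.1)) ⟨hux, h⟩
          have : v = u := le_antisymm (hmax ⟨⟨hu.1.trans hv.1, hv.2⟩, hvx.le⟩) hv.1
          rw [← this, hvx]
      rw [hset, hmass u hu, hval, Real.volume_Ioc]
  rw [intervalIntegral.integral_of_le hst, intervalIntegral.integral_of_le (hmono hsmem htmem hst),
    ← hmap, integral_map hξm.aemeasurable hh.aestronglyMeasurable, hm,
    integral_withDensity_eq_integral_toReal_smul₀ hρm.aemeasurable.ennreal_ofReal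
      (ae_of_all _ fun _ => ENNReal.ofReal_lt_top)]
  simp_rw [ENNReal.toReal_ofReal (hρ0 _)]

end IntegralTools

/-! ### Potentials of vector measures and the spectral gap -/

section SpectralGap

open scoped RealInnerProductSpace

variable {E : Type*} [NormedAddCommGroup E] [InnerProductSpace ℝ E]
  {X : Type*} [MeasurableSpace X] {μ : Measure X} {lam : ℝ} {p : X → E} {ξ : X → ℝ}

/-- The potential `x ↦ ∫ k (x - ξ v) p v` of the vector measure `ξ_* (p μ)` for the kernel `k`. -/
def potential (k : ℝ → ℝ) (μ : Measure X) (ξ : X → ℝ) (p : X → E) (x : ℝ) : E :=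
  ∫ v, k (x - ξ v) • p v ∂μ

theorem potential_kernel_integrable {k : ℝ → ℝ} (hk : Measurable k) {M : ℝ}
    (hM : ∀ x, ‖k x‖ ≤ M) (hp : Integrable p μ) (hξ : Measurable ξ) (x : ℝ) :
    Integrable (fun v => k (x - ξ v) • p v) μ :=
  hp.bdd_smul M (hk.comp (hξ.const_sub x)).aestronglyMeasurable (ae_of_all _ fun _ => hM _)

theorem norm_potential_le {k : ℝ → ℝ} {M : ℝ} (hM : ∀ x, ‖k x‖ ≤ M)
    (hp : Integrable p μ) (x : ℝ) :
    ‖potential k μ ξ p x‖ ≤ M * ∫ v, ‖p v‖ ∂μ := by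
  rw [← integral_const_mul]
  refine norm_integral_le_of_norm_le (hp.norm.const_mul M) (ae_of_all _ fun v => ?_)
  rw [norm_smul]
  exact mul_le_mul_of_nonneg_right (hM _) (norm_nonneg _)

variable [IsFiniteMeasure μ]

theorem potential_stronglyMeasurable {k : ℝ → ℝ} (hk : Measurable k) (hp : Integrable p μ)
    (hξ : Measurable ξ) : StronglyMeasurable (potential k μ ξ p) := by
  obtain ⟨q, hq, hpq⟩ := hp.1
  have : potential k μ ξ p = fun x => ∫ v, k (x - ξ v) • q v ∂μ := by
    ext x
    refine integral_congr_ae ?_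
    filter_upwards [hpq] with v hv
    rw [hv]
  rw [this]
  refine StronglyMeasurable.integral_prod_right' (f := fun z : ℝ × X => k (z.1 - ξ z.2) • q z.2) ?_
  refine StronglyMeasurable.smul ?_ (hq.comp_measurable measurable_snd)
  exact (hk.comp (measurable_fst.sub (hξ.comp measurable_snd))).stronglyMeasurable

theorem measurable_kernel_uncurry {k : ℝ → ℝ} (hk : Measurable k) (hξ : Measurable ξ) :
    Measurable (Function.uncurry fun (z : ℝ) (v : X) => k (z - ξ v)) :=
  hk.comp (measurable_fst.sub (hξ.comp measurable_snd))

theorem potential_integrable {k : ℝ → ℝ} (hk : Measurable k) {M : ℝ}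
    (hM : ∀ x, ‖k x‖ ≤ M) (hp : Integrable p μ) (hξ : Measurable ξ) (ν : Measure ℝ)
    [IsFiniteMeasure ν] : Integrable (potential k μ ξ p) ν :=
  Integrable.of_bound (potential_stronglyMeasurable hk hp hξ).aestronglyMeasurable _
    (ae_of_all _ (norm_potential_le hM hp))

theorem kernel_smul_potential_integrable {k : ℝ → ℝ} (hk : Measurable k) {M : ℝ}
    (hM : ∀ x, ‖k x‖ ≤ M) (hp : Integrable p μ) (hξ : Measurable ξ) (x : ℝ) :
    Integrable (fun z => k (z - x) • potential k μ ξ p z) (volume.restrict (Ioc (0 : ℝ) 1)) :=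
  (potential_integrable hk hM hp hξ _).bdd_smul M
    (hk.comp (measurable_id.sub_const _)).aestronglyMeasurable (ae_of_all _ fun _ => hM _)

variable [CompleteSpace E] in
/-- The `L²` norm of a potential as an energy. -/
theorem integral_inner_potential {k : ℝ → ℝ} (hk : Measurable k) {M : ℝ}
    (hM : ∀ x, ‖k x‖ ≤ M) (hp : Integrable p μ) (hξ : Measurable ξ) :
    Integrable (fun v => ⟪∫ z in Ioc (0 : ℝ) 1, k (z - ξ v) • potential k μ ξ p z, p v⟫) μ ∧
    ∫ z in Ioc (0 : ℝ) 1, ‖potential k μ ξ p z‖ ^ 2 =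
      ∫ v, ⟪∫ z in Ioc (0 : ℝ) 1, k (z - ξ v) • potential k μ ξ p z, p v⟫ ∂μ := by
  set w := potential k μ ξ p with hw
  have hwm := potential_stronglyMeasurable hk hp hξ
  have hM0 : 0 ≤ M := (norm_nonneg _).trans (hM 0)
  have hwb : ∀ z, ‖w z‖ ≤ M * ∫ v, ‖p v‖ ∂μ := norm_potential_le hM hp
  have h1 : ∀ z, ‖w z‖ ^ 2 = ∫ v, k (z - ξ v) * ⟪w z, p v⟫ ∂μ := by
    intro z
    rw [← real_inner_self_eq_norm_sq]
    conv_lhs => rw [hw]; arg 3; rw [potential]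
    rw [← integral_inner (potential_kernel_integrable hk hM hp hξ z)]
    simp_rw [real_inner_smul_right, ← hw]
  have h2 : ∀ v, ∫ z in Ioc (0 : ℝ) 1, k (z - ξ v) * ⟪w z, p v⟫ =
      ⟪∫ z in Ioc (0 : ℝ) 1, k (z - ξ v) • w z, p v⟫ := by
    intro v
    rw [real_inner_comm, ← integral_inner (kernel_smul_potential_integrable hk hM hp hξ _)]
    refine integral_congr_ae (ae_of_all _ fun z => ?_)
    simp only [real_inner_smul_right]
    rw [real_inner_comm]
  have h3 : Integrable (Function.uncurry fun (z : ℝ) (v : X) => k (z - ξ v) * ⟪w z, p v⟫)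
      ((volume.restrict (Ioc (0 : ℝ) 1)).prod μ) := by
    have hbase : Integrable (fun z : ℝ × X => (M * (M * ∫ v, ‖p v‖ ∂μ)) * ‖p z.2‖)
        ((volume.restrict (Ioc (0 : ℝ) 1)).prod μ) :=
      (hp.norm.comp_snd (volume.restrict (Ioc (0 : ℝ) 1))).const_mul _
    refine hbase.mono' ?_ (ae_of_all _ fun z => ?_)
    · refine AEStronglyMeasurable.mul (measurable_kernel_uncurry hk hξ).aestronglyMeasurable ?_
      exact AEStronglyMeasurable.inner (hwm.comp_measurable measurable_fst).aestronglyMeasurable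
        hp.1.comp_snd
    · simp only [Function.uncurry, norm_mul, mul_assoc]
      refine mul_le_mul (hM _) ?_ (norm_nonneg _) hM0
      rw [← mul_assoc]
      exact (norm_inner_le_norm _ _).trans (mul_le_mul_of_nonneg_right (hwb _) (norm_nonneg _))
  refine ⟨h3.integral_prod_right.congr (ae_of_all _ h2), ?_⟩
  simp_rw [h1]
  rw [integral_integral_swap h3]
  exact integral_congr_ae (ae_of_all _ h2)

variable [CompleteSpace E] in
theorem integral_potential {k : ℝ → ℝ} (hk : Measurable k) {M : ℝ} (hM : ∀ x, ‖k x‖ ≤ M)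
    (hp : Integrable p μ) (hξ : Measurable ξ) {a b : ℝ} (hab : a ≤ b) :
    ∫ z in a..b, potential k μ ξ p z = ∫ v, (∫ z in a..b, k (z - ξ v)) • p v ∂μ := by
  simp only [intervalIntegral.integral_of_le hab]
  exact integral_integral_kernel_smul_swap (measurable_kernel_uncurry hk hξ) (fun _ _ => hM _) hp

variable [CompleteSpace E] in
theorem potential_perKernel_sub (hlam : 0 < lam) (hp : Integrable p μ) (hξ : Measurable ξ)
    {a b : ℝ} (hab : a ≤ b) :
    potential (perKernel lam) μ ξ p b - potential (perKernel lam) μ ξ p a =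
      ∫ z in a..b, potential (perKernelDeriv lam) μ ξ p z := by
  have hk := (perKernel_continuous lam).measurable
  have hM := norm_perKernel_le hlam
  rw [integral_potential (perKernelDeriv_measurable lam) (norm_perKernelDeriv_le hlam) hp hξ hab,
    potential, potential, ← integral_sub (potential_kernel_integrable hk hM hp hξ b)
      (potential_kernel_integrable hk hM hp hξ a)]
  refine integral_congr_ae (ae_of_all _ fun v => ?_)
  simp only
  rw [intervalIntegral.integral_comp_sub_right (fun z => perKernelDeriv lam z),
    integral_perKernelDeriv hlam, sub_smul]

theorem potential_intervalIntegrable {k : ℝ → ℝ} (hk : Measurable k) {M : ℝ}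
    (hM : ∀ x, ‖k x‖ ≤ M) (hp : Integrable p μ) (hξ : Measurable ξ) (a b : ℝ) :
    IntervalIntegrable (potential k μ ξ p) volume a b := by
  rw [intervalIntegrable_iff]
  exact Measure.integrableOn_of_bounded (by simp)
    (potential_stronglyMeasurable hk hp hξ).aestronglyMeasurable
    (ae_of_all _ (norm_potential_le hM hp))

variable [CompleteSpace E] in
/-- A Poincaré inequality on the circle of length one, for the mean-zero potential `w` of a
measure of total mass zero: two points are joined by two arcs, and along one of them `w'` has at
most half of its total variation. -/
theorem norm_potential_perKernel_le (hlam : 0 < lam) (hp : Integrable p μ) (hξ : Measurable ξ)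
    (hp0 : ∫ v, p v ∂μ = 0) {z : ℝ} (hz : z ∈ Icc (0 : ℝ) 1) :
    ‖potential (perKernel lam) μ ξ p z‖ ≤
      1 / 2 * ∫ y in (0 : ℝ)..1, ‖potential (perKernelDeriv lam) μ ξ p y‖ := by
  set w := potential (perKernel lam) μ ξ p with hw
  set w' := potential (perKernelDeriv lam) μ ξ p with hw'
  have hint : ∀ a b, IntervalIntegrable w' volume a b :=
    potential_intervalIntegrable (perKernelDeriv_measurable lam) (norm_perKernelDeriv_le hlam) hp hξ
  have hwint : ∀ a b, IntervalIntegrable w volume a b := potential_intervalIntegrable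
    (perKernel_continuous lam).measurable (norm_perKernel_le hlam) hp hξ
  have hw0 : ∫ y in (0 : ℝ)..1, w y = 0 := by
    rw [hw, integral_potential (perKernel_continuous lam).measurable (norm_perKernel_le hlam) hp hξ
      zero_le_one]
    simp_rw [integral_perKernel_sub hlam, one_smul, hp0]
  have hw'0 : ∫ y in (0 : ℝ)..1, w' y = 0 := by
    rw [hw', integral_potential (perKernelDeriv_measurable lam) (norm_perKernelDeriv_le hlam) hp hξ
      zero_le_one]
    simp_rw [integral_perKernelDeriv_sub hlam, zero_smul, integral_zero]
  have key : ∀ a b, 0 ≤ a → a ≤ b → b ≤ 1 →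
      ‖w b - w a‖ ≤ 1 / 2 * ∫ y in (0 : ℝ)..1, ‖w' y‖ := by
    intro a b ha hab hb
    have h1 : w b - w a = ∫ y in a..b, w' y := potential_perKernel_sub hlam hp hξ hab
    have h2 := intervalIntegral.norm_integral_le_integral_norm (f := w') (μ := volume) hab
    have h3 := intervalIntegral.norm_integral_le_integral_norm (f := w') (μ := volume) ha
    have h4 := intervalIntegral.norm_integral_le_integral_norm (f := w') (μ := volume) hb
    have h5 := intervalIntegral.integral_add_adjacent_intervals (hint 0 a) (hint a b)
    have h6 := intervalIntegral.integral_add_adjacent_intervals (hint 0 b) (hint b 1)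
    have h7 := intervalIntegral.integral_add_adjacent_intervals (hint 0 a).norm (hint a b).norm
    have h8 := intervalIntegral.integral_add_adjacent_intervals (hint 0 b).norm (hint b 1).norm
    rw [hw'0, ← h5, ← h1] at h6
    have h9 : w b - w a = -((∫ y in (0 : ℝ)..a, w' y) + ∫ y in b..1, w' y) := by
      rw [eq_neg_iff_add_eq_zero, ← h6]; abel
    have h10 : ‖w b - w a‖ ≤ ‖∫ y in (0 : ℝ)..a, w' y‖ + ‖∫ y in b..1, w' y‖ := by
      rw [h9, norm_neg]; exact norm_add_le _ _
    rw [← h1] at h2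
    linarith
  have hmean : w z = ∫ y in (0 : ℝ)..1, (w z - w y) := by
    rw [intervalIntegral.integral_sub intervalIntegrable_const (hwint 0 1), hw0]
    simp
  rw [hmean]
  have := intervalIntegral.norm_integral_le_of_norm_le_const (a := 0) (b := 1)
    (f := fun y => w z - w y) (C := 1 / 2 * ∫ y in (0 : ℝ)..1, ‖w' y‖) ?_
  · simpa using this
  · intro y hy
    rw [uIoc_of_le zero_le_one] at hy
    rcases le_total y z with h | h
    · exact key y z hy.1.le h hz.2
    · rw [norm_sub_rev]; exact key z y hz.1 h hy.2

theorem sq_integral_norm_le {F : Type*} [NormedAddCommGroup F] {f : ℝ → F}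
    (hf : AEStronglyMeasurable f (volume.restrict (Ioc 0 1))) {M : ℝ} (hM : ∀ x, ‖f x‖ ≤ M) :
    (∫ y in Ioc (0 : ℝ) 1, ‖f y‖) ^ 2 ≤ ∫ y in Ioc (0 : ℝ) 1, ‖f y‖ ^ 2 := by
  set A := ∫ y in Ioc (0 : ℝ) 1, ‖f y‖ with hA
  have h1 : Integrable (fun y => ‖f y‖) (volume.restrict (Ioc (0 : ℝ) 1)) :=
    Integrable.of_bound hf.norm M (ae_of_all _ fun x => by simpa using hM x)
  have h2 : Integrable (fun y => ‖f y‖ ^ 2) (volume.restrict (Ioc (0 : ℝ) 1)) :=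
    Integrable.of_bound (hf.norm.pow 2) (M ^ 2) (ae_of_all _ fun x => by
      rw [norm_pow, norm_norm]; gcongr; exact hM x)
  have h3 : 0 ≤ ∫ y in Ioc (0 : ℝ) 1, (‖f y‖ - A) ^ 2 :=
    integral_nonneg fun _ => sq_nonneg _
  have h4 : ∫ y in Ioc (0 : ℝ) 1, (‖f y‖ - A) ^ 2 =
      (∫ y in Ioc (0 : ℝ) 1, ‖f y‖ ^ 2) - 2 * A * A + A ^ 2 := by
    have : ∀ y, (‖f y‖ - A) ^ 2 = (‖f y‖ ^ 2 - 2 * A * ‖f y‖) + A ^ 2 := fun y => by ring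
    simp_rw [this]
    have h5 : Integrable (fun y => ‖f y‖ ^ 2 - 2 * A * ‖f y‖) (volume.restrict (Ioc (0 : ℝ) 1)) :=
      h2.sub (h1.const_mul _)
    rw [integral_add h5 (integrable_const _), integral_sub h2 (h1.const_mul _),
      integral_const_mul, ← hA]
    simp
  nlinarith

variable [CompleteSpace E] in
/-- The spectral gap that drives the decay of the length. If `ξ` pushes `‖p‖ μ` forward to `L` times
Lebesgue measure on `[0, 1]` and `p μ` has total mass zero, then the energy `Q` of `ξ_* (p μ)`
for the kernel `perKernel lam` is at most `L² / (1 + 4 lam²)`. With the potential `w`, the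
reproducing property gives `Q = ∫ ‖w‖² + lam² ‖w'‖²`, the Poincaré inequality bounds this below by
`(1 + 4 lam²) (∫ ‖w‖)²`, and the push-forward gives `Q ≤ L ∫ ‖w‖`. -/
theorem energy_perKernel_le (hlam : 0 < lam) (hp : Integrable p μ) (hξ : Measurable ξ)
    (hp0 : ∫ v, p v ∂μ = 0) {L : ℝ}
    (hcov : ∀ h : ℝ → ℝ, Continuous h → ∫ v, ‖p v‖ * h (ξ v) ∂μ = L * ∫ x in (0 : ℝ)..1, h x) :
    (1 + 4 * lam ^ 2) * ∫ v, ⟪potential (perKernel lam) μ ξ p (ξ v), p v⟫ ∂μ ≤ L ^ 2 := by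
  set w := potential (perKernel lam) μ ξ p with hw
  set w' := potential (perKernelDeriv lam) μ ξ p with hw'
  set Q := ∫ v, ⟪w (ξ v), p v⟫ ∂μ with hQ
  have hKm := (perKernel_continuous lam).measurable
  have hKb := norm_perKernel_le hlam
  have hK'm := perKernelDeriv_measurable lam
  have hK'b := norm_perKernelDeriv_le hlam
  have hwm : StronglyMeasurable w := potential_stronglyMeasurable hKm hp hξ
  have hw'm : StronglyMeasurable w' := potential_stronglyMeasurable hK'm hp hξ
  have hwb : ∀ z, ‖w z‖ ≤ kernelBound lam * ∫ v, ‖p v‖ ∂μ := norm_potential_le hKb hp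
  have hw'b : ∀ z, ‖w' z‖ ≤ 1 / (2 * lam ^ 2) * ∫ v, ‖p v‖ ∂μ := norm_potential_le hK'b hp
  have hwc : Continuous w := by
    refine continuous_of_dominated (bound := fun v => kernelBound lam * ‖p v‖)
      (fun x => (potential_kernel_integrable hKm hKb hp hξ x).1) (fun x => ae_of_all _ fun v => ?_)
      (hp.norm.const_mul _) (ae_of_all _ fun v => ?_)
    · rw [norm_smul]
      exact mul_le_mul_of_nonneg_right (hKb _) (norm_nonneg _)
    · have := perKernel_continuous lam
      fun_prop
  -- `Q` as a sum of squares
  have hsum : Q = (∫ z in Ioc (0 : ℝ) 1, ‖w z‖ ^ 2) +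
      lam ^ 2 * ∫ z in Ioc (0 : ℝ) 1, ‖w' z‖ ^ 2 := by
    obtain ⟨hi1, he1⟩ := integral_inner_potential hKm hKb hp hξ
    obtain ⟨hi2, he2⟩ := integral_inner_potential hK'm hK'b hp hξ
    rw [he1, he2, ← integral_const_mul, ← integral_add hi1 (hi2.const_mul _)]
    refine integral_congr_ae (ae_of_all _ fun v => ?_)
    simp only
    have hj1 := kernel_smul_potential_integrable hKm hKb hp hξ (ξ v)
    have hj2 : Integrable (fun z => lam ^ 2 • perKernelDeriv lam (z - ξ v) • w' z)
        (volume.restrict (Ioc (0 : ℝ) 1)) :=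
      (kernel_smul_potential_integrable hK'm hK'b hp hξ (ξ v)).smul _
    rw [← real_inner_smul_left, ← inner_add_left, ← integral_smul, ← integral_add hj1 hj2]
    congr 1
    have hb : ∀ z, perKernel lam (z - ξ v) • w z + lam ^ 2 • perKernelDeriv lam (z - ξ v) • w' z =
        ∫ u, (perKernel lam (z - ξ v) * perKernel lam (z - ξ u) +
          lam ^ 2 * (perKernelDeriv lam (z - ξ v) * perKernelDeriv lam (z - ξ u))) • p u ∂μ := by
      intro z
      rw [hw, hw', potential, potential, ← integral_smul, ← integral_smul, ← integral_smul,
        ← integral_add]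
      · refine integral_congr_ae (ae_of_all _ fun u => ?_)
        simp only [smul_smul, ← add_smul]
      · exact (potential_kernel_integrable hKm hKb hp hξ z).smul _
      · exact ((potential_kernel_integrable hK'm hK'b hp hξ z).smul _).smul _
    have hbm : Measurable (Function.uncurry fun (z : ℝ) (u : X) =>
        perKernel lam (z - ξ v) * perKernel lam (z - ξ u) +
          lam ^ 2 * (perKernelDeriv lam (z - ξ v) * perKernelDeriv lam (z - ξ u))) := by
      refine Measurable.add (Measurable.mul ?_ (measurable_kernel_uncurry hKm hξ))
        (Measurable.const_mul (Measurable.mul ?_ (measurable_kernel_uncurry hK'm hξ)) _)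
      · exact (hKm.comp (measurable_id.sub_const _)).comp measurable_fst
      · exact (hK'm.comp (measurable_id.sub_const _)).comp measurable_fst
    rw [integral_congr_ae (ae_of_all _ hb), integral_integral_kernel_smul_swap hbm
      (M := kernelBound lam * kernelBound lam + lam ^ 2 * (1 / (2 * lam ^ 2) * (1 / (2 * lam ^ 2))))
      _ hp]
    · rw [hw, potential]
      refine integral_congr_ae (ae_of_all _ fun u => ?_)
      simp only
      rw [← integral_kernel_product hlam (ξ v) (ξ u), intervalIntegral.integral_of_le zero_le_one]
    · intro z u
      refine (norm_add_le _ _).trans (add_le_add ?_ ?_)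
      · rw [norm_mul]
        exact mul_le_mul (hKb _) (hKb _) (norm_nonneg _) (kernelBound_nonneg hlam)
      · rw [norm_mul, norm_mul, Real.norm_of_nonneg (sq_nonneg lam)]
        exact mul_le_mul_of_nonneg_left (mul_le_mul (hK'b _) (hK'b _) (norm_nonneg _)
          (by positivity)) (sq_nonneg lam)
  -- the push-forward bound
  have hup : Q ≤ L * ∫ z in Ioc (0 : ℝ) 1, ‖w z‖ := by
    have := hcov (fun x => ‖w x‖) hwc.norm
    rw [← intervalIntegral.integral_of_le zero_le_one, ← this, hQ]
    have hi : Integrable (fun v => ‖p v‖ * ‖w (ξ v)‖) μ := by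
      refine hp.norm.mul_bdd (c := kernelBound lam * ∫ v, ‖p v‖ ∂μ) ?_ (ae_of_all _ fun v => ?_)
      · exact (hwm.comp_measurable hξ).norm.aestronglyMeasurable
      · simpa using hwb (ξ v)
    have hle : ∀ v, ‖⟪w (ξ v), p v⟫‖ ≤ ‖p v‖ * ‖w (ξ v)‖ := fun v => by
      rw [mul_comm]; exact norm_inner_le_norm _ _
    refine integral_mono (hi.mono' ?_ (ae_of_all _ hle)) hi fun v =>
      (le_abs_self _).trans (hle v)
    exact AEStronglyMeasurable.inner (hwm.comp_measurable hξ).aestronglyMeasurable hp.1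
  have hlow : (1 + 4 * lam ^ 2) * (∫ z in Ioc (0 : ℝ) 1, ‖w z‖) ^ 2 ≤ Q := by
    have h1 := sq_integral_norm_le hwm.aestronglyMeasurable hwb
    have h2 := sq_integral_norm_le hw'm.aestronglyMeasurable hw'b
    have h3 : ∫ z in Ioc (0 : ℝ) 1, ‖w z‖ ≤ 1 / 2 * ∫ z in Ioc (0 : ℝ) 1, ‖w' z‖ := by
      have h := intervalIntegral.norm_integral_le_of_norm_le_const (a := 0) (b := 1)
        (f := fun z => ‖w z‖) (C := 1 / 2 * ∫ y in Ioc (0 : ℝ) 1, ‖w' y‖) ?_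
      · rw [intervalIntegral.integral_of_le zero_le_one] at h
        simpa using (le_abs_self _).trans h
      · intro z hz
        rw [uIoc_of_le zero_le_one] at hz
        rw [norm_norm, ← intervalIntegral.integral_of_le zero_le_one]
        exact norm_potential_perKernel_le hlam hp hξ hp0 (Ioc_subset_Icc_self hz)
    have h4 : 0 ≤ ∫ z in Ioc (0 : ℝ) 1, ‖w z‖ := integral_nonneg fun _ => norm_nonneg _
    rw [hsum]
    have h5 : 4 * (∫ z in Ioc (0 : ℝ) 1, ‖w z‖) ^ 2 ≤ (∫ z in Ioc (0 : ℝ) 1, ‖w' z‖) ^ 2 := by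
      nlinarith
    have h6 := mul_le_mul_of_nonneg_left (h5.trans h2) (sq_nonneg lam)
    linarith
  set W := ∫ z in Ioc (0 : ℝ) 1, ‖w z‖ with hW
  have hD : 0 < 1 + 4 * lam ^ 2 := by positivity
  -- complete the square in `(1 + 4 lam²) W ≤ L`
  nlinarith [sq_nonneg ((1 + 4 * lam ^ 2) * W - L)]

end SpectralGap

/-! ### Functions on the circle as functions on the unit interval -/

section Circle

variable {E : Type*} [NormedAddCommGroup E]

theorem circle_integral_eq [NormedSpace ℝ E] (f : UnitAddCircle → E) :
    ∫ u in (0 : ℝ)..1, f u = ∫ x, f x := by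
  simpa using UnitAddCircle.intervalIntegral_preimage 0 f

theorem measurePreserving_unitMk :
    MeasurePreserving ((↑) : ℝ → UnitAddCircle) (volume.restrict (Ioc (0 : ℝ) 1)) := by
  simpa using UnitAddCircle.measurePreserving_mk 0

theorem periodic_comp_coe {α : Type*} (f : UnitAddCircle → α) :
    Function.Periodic (fun u : ℝ => f u) 1 := fun u => by
  simp

theorem circle_lift_intervalIntegrable {f : UnitAddCircle → E} (hf : Integrable f) (a b : ℝ) :
    IntervalIntegrable (fun u : ℝ => f u) volume a b := by
  refine (periodic_comp_coe f).intervalIntegrable₀ one_ne_zero ?_ a b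
  rw [intervalIntegrable_iff_integrableOn_Ioc_of_le zero_le_one]
  exact measurePreserving_unitMk.integrable_comp_of_integrable hf

theorem circle_ae_eq_of_lift {f g : UnitAddCircle → E} (hf : AEStronglyMeasurable f)
    (hg : AEStronglyMeasurable g)
    (h : ∀ᵐ u : ℝ ∂(volume.restrict (Ioc (0 : ℝ) 1)),
      f (u : UnitAddCircle) = g (u : UnitAddCircle)) :
    f =ᵐ[volume] g := by
  have hnull : NullMeasurableSet {x | f x ≠ g x} := (hf.nullMeasurableSet_eq_fun hg).compl
  have := measurePreserving_unitMk.measure_preimage hnull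
  rw [EventuallyEq, ae_iff, ← this]
  exact h

theorem ae_lift_of_circle_ae {P : UnitAddCircle → Prop} (h : ∀ᵐ x, P x) :
    ∀ᵐ u : ℝ ∂(volume.restrict (Ioc (0 : ℝ) 1)), P (u : UnitAddCircle) :=
  measurePreserving_unitMk.quasiMeasurePreserving.ae h

/-- Periodisation of a test function supported in the open unit interval. -/
theorem contDiff_comp_fract {ψ : ℝ → ℝ} (hψ : ContDiff ℝ ∞ ψ) (hs : tsupport ψ ⊆ Ioo 0 1) :
    ContDiff ℝ ∞ fun u => ψ (Int.fract u) := by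
  rw [contDiff_iff_contDiffAt]
  intro u
  by_cases h : Int.fract u = 0
  · have h0 : ∀ᶠ y in 𝓝 (u - ⌊u⌋), ψ y = 0 := by
      rw [show u - ⌊u⌋ = 0 from h]
      exact notMem_tsupport_iff_eventuallyEq.1 fun h => by simpa using (hs h).1
    have h1 : ∀ᶠ y in 𝓝 (u - ⌊u⌋ + 1), ψ y = 0 := by
      rw [show u - ⌊u⌋ = 0 from h, zero_add]
      exact notMem_tsupport_iff_eventuallyEq.1 fun h => by simpa using (hs h).2
    have hu : u = ⌊u⌋ := sub_eq_zero.1 h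
    have hc0 : Continuous fun y : ℝ => y - ⌊u⌋ := by fun_prop
    have hc1 : Continuous fun y : ℝ => y - ⌊u⌋ + 1 := by fun_prop
    have hev : (fun u => ψ (Int.fract u)) =ᶠ[𝓝 u] fun _ => 0 := by
      filter_upwards [hc0.continuousAt.eventually h0, hc1.continuousAt.eventually h1,
        Ioo_mem_nhds (show (⌊u⌋ : ℝ) - 1 < u by linarith) (show u < (⌊u⌋ : ℝ) + 1 by linarith)]
        with y hy0 hy1 hy
      rcases le_or_gt (⌊u⌋ : ℝ) y with hle | hlt
      · have : ⌊y⌋ = ⌊u⌋ := Int.floor_eq_iff.2 ⟨hle, hy.2⟩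
        rw [Int.fract, this, hy0]
      · have : ⌊y⌋ = ⌊u⌋ - 1 := Int.floor_eq_iff.2
          ⟨by push_cast; exact hy.1.le, by push_cast; linarith⟩
        rw [Int.fract, this]
        push_cast
        rw [← hy1]; ring_nf
    exact contDiffAt_const.congr_of_eventuallyEq hev
  · have hfl : (⌊u⌋ : ℝ) < u := lt_of_le_of_ne (Int.floor_le u) fun h' =>
      h (by rw [Int.fract, h', sub_self])
    have hev : (fun u => ψ (Int.fract u)) =ᶠ[𝓝 u] fun y => ψ (y - ⌊u⌋) := by
      filter_upwards [Ioo_mem_nhds hfl (Int.lt_floor_add_one u)] with y hy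
      have : ⌊y⌋ = ⌊u⌋ := Int.floor_eq_iff.2 ⟨hy.1.le, hy.2⟩
      rw [Int.fract, this]
    refine ContDiffAt.congr_of_eventuallyEq ?_ hev
    exact (hψ.comp (contDiff_id.sub contDiff_const)).contDiffAt

/-- Smooth periodic functions separate integrable functions on the unit interval. -/
theorem ae_eq_zero_of_forall_periodic [NormedSpace ℝ E] [CompleteSpace E] {g : ℝ → E}
    (hg : IntegrableOn g (Ioc 0 1))
    (h : ∀ φ : ℝ → ℝ, ContDiff ℝ ∞ φ → Function.Periodic φ 1 →
      ∫ u in (0 : ℝ)..1, φ u • g u = 0) :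
    ∀ᵐ u : ℝ ∂(volume.restrict (Ioc (0 : ℝ) 1)), g u = 0 := by
  have hloc : LocallyIntegrableOn g (Ioo 0 1) volume :=
    (hg.mono_set Ioo_subset_Ioc_self).locallyIntegrableOn
  have key := isOpen_Ioo.ae_eq_zero_of_integral_contDiff_smul_eq_zero hloc fun ψ hψ _ hs => ?_
  · rw [← restrict_Ioo_eq_restrict_Ioc]
    exact (ae_restrict_iff' measurableSet_Ioo).2 key
  · have h1 := h _ (contDiff_comp_fract hψ hs) fun u => by simp
    rw [← h1, intervalIntegral.integral_of_le zero_le_one, integral_Ioc_eq_integral_Ioo]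
    rw [← setIntegral_eq_integral_of_forall_compl_eq_zero (s := Ioo (0 : ℝ) 1)]
    · refine setIntegral_congr_fun measurableSet_Ioo fun u hu => ?_
      rw [Int.fract_eq_self.2 ⟨hu.1.le, hu.2⟩]
    · intro u hu
      rw [image_eq_zero_of_notMem_tsupport fun h' => hu (hs h'), zero_smul]

theorem contDiff_primitive_of_smooth {ψ : ℝ → ℝ} (hψ : ContDiff ℝ ∞ ψ) :
    ContDiff ℝ ∞ fun u => ∫ r in (0 : ℝ)..u, ψ r := by
  have hd : ∀ u, HasDerivAt (fun u => ∫ r in (0 : ℝ)..u, ψ r) (ψ u) u := fun u =>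
    hψ.continuous.integral_hasStrictDerivAt 0 u |>.hasDerivAt
  rw [contDiff_infty_iff_deriv]
  refine ⟨fun u => (hd u).differentiableAt, ?_⟩
  rwa [show deriv (fun u => ∫ r in (0 : ℝ)..u, ψ r) = ψ from funext fun u => (hd u).deriv]

end Circle

/-! ### Weak derivatives on the circle -/

section WeakDerivative

/-- The indefinite integral of a mean-zero function has that function as weak derivative. -/
theorem isWeakDeriv_of_primitive {f g : UnitAddCircle → Plane} {c : Plane} (hg : Integrable g)
    (hg0 : ∫ x, g x = 0)
    (hfg : ∀ᵐ u : ℝ ∂(volume.restrict (Ioc (0 : ℝ) 1)),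
      f (u : UnitAddCircle) = c + ∫ r in (0 : ℝ)..u, g (r : UnitAddCircle)) :
    IsWeakDeriv f g := by
  intro φ hφ hper
  have hgi : IntervalIntegrable (fun u : ℝ => g u) volume 0 1 :=
    circle_lift_intervalIntegrable hg 0 1
  have hg0' : ∫ u in (0 : ℝ)..1, g (u : UnitAddCircle) = 0 := by rw [circle_integral_eq, hg0]
  have hd : Continuous (deriv φ) := hφ.continuous_deriv (by simp)
  have hφd : ∀ v, ∫ r in (0 : ℝ)..v, deriv φ r = φ v - φ 0 := fun v =>
    intervalIntegral.integral_deriv_eq_sub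
      (fun x _ => (hφ.differentiable (by simp)).differentiableAt) (hd.intervalIntegrable _ _)
  have hφ1 : φ 1 - φ 0 = 0 := by have := hper 0; rw [zero_add] at this; rw [this, sub_self]
  have hparts := integral_smul_primitive_add zero_le_one (hd.intervalIntegrable 0 1) hgi
  have hG : Continuous fun v : ℝ => ∫ r in (0 : ℝ)..v, g (r : UnitAddCircle) :=
    intervalIntegral.continuous_primitive (circle_lift_intervalIntegrable hg) 0
  have h1 : ∫ u in (0 : ℝ)..1, deriv φ u • f (u : UnitAddCircle) =
      ∫ u in (0 : ℝ)..1, (deriv φ u • c + deriv φ u • ∫ r in (0 : ℝ)..u, g (r : UnitAddCircle)) := by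
    rw [intervalIntegral.integral_of_le zero_le_one, intervalIntegral.integral_of_le zero_le_one]
    refine integral_congr_ae ?_
    filter_upwards [hfg] with u hu
    rw [hu, smul_add]
  have h2 : ∫ v in (0 : ℝ)..1, (∫ r in (0 : ℝ)..v, deriv φ r) • g (v : UnitAddCircle) =
      ∫ u in (0 : ℝ)..1, φ u • g (u : UnitAddCircle) := by
    simp_rw [hφd, sub_smul]
    have hA : IntervalIntegrable (fun u : ℝ => φ 0 • g u) volume 0 1 := hgi.smul (φ 0)
    rw [intervalIntegral.integral_sub (hgi.continuousOn_smul hφ.continuous.continuousOn) hA,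
      intervalIntegral.integral_smul, hg0', smul_zero, sub_zero]
  rw [h2, hg0', smul_zero] at hparts
  have hA : IntervalIntegrable (fun u => deriv φ u • c) volume 0 1 :=
    (hd.smul continuous_const).intervalIntegrable _ _
  have hB : IntervalIntegrable (fun u => deriv φ u • ∫ r in (0 : ℝ)..u, g (r : UnitAddCircle))
    volume 0 1 := (hd.smul hG).intervalIntegrable _ _
  rw [h1, intervalIntegral.integral_add hA hB, intervalIntegral.integral_smul_const, hφd, hφ1,
    zero_smul, zero_add, eq_neg_iff_add_eq_zero, hparts]

theorem IsWeakDeriv.integral_eq_zero {f g : UnitAddCircle → Plane} (h : IsWeakDeriv f g) :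
    ∫ x, g x = 0 := by
  have := h (fun _ => 1) contDiff_const fun _ => rfl
  rw [← circle_integral_eq]
  simpa using this.symm

theorem IsWeakDeriv.ae_eq_zero {f g : UnitAddCircle → Plane} (h : IsWeakDeriv f g)
    (hf : f =ᵐ[volume] 0) (hg : Integrable g) : g =ᵐ[volume] 0 := by
  refine circle_ae_eq_of_lift hg.1 aestronglyMeasurable_zero ?_
  refine ae_eq_zero_of_forall_periodic (g := fun u : ℝ => g u)
    (measurePreserving_unitMk.integrable_comp_of_integrable hg) fun φ hφ hper => ?_
  have := h φ hφ hper
  rw [circle_intervalIntegral_congr hf] at this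
  simpa using this.symm

/-- The lemma of du Bois-Reymond: a function with an integrable weak derivative is the indefinite
integral of that derivative. -/
theorem IsWeakDeriv.exists_primitive {f g : UnitAddCircle → Plane} (h : IsWeakDeriv f g)
    (hf : Integrable f) (hg : Integrable g) :
    ∃ c : Plane, ∀ᵐ u : ℝ ∂(volume.restrict (Ioc (0 : ℝ) 1)),
      f (u : UnitAddCircle) = c + ∫ r in (0 : ℝ)..u, g (r : UnitAddCircle) := by
  set G : ℝ → Plane := fun u => ∫ r in (0 : ℝ)..u, g (r : UnitAddCircle) with hG
  have hfi := circle_lift_intervalIntegrable hf 0 1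
  have hgi := circle_lift_intervalIntegrable hg 0 1
  have hg0 : ∫ u in (0 : ℝ)..1, g (u : UnitAddCircle) = 0 := by
    rw [circle_integral_eq, h.integral_eq_zero]
  have hGc : Continuous G :=
    intervalIntegral.continuous_primitive (circle_lift_intervalIntegrable hg) 0
  set k : ℝ → Plane := fun u => f (u : UnitAddCircle) - G u with hk
  have hki : IntervalIntegrable k volume 0 1 := hfi.sub (hGc.intervalIntegrable 0 1)
  set c : Plane := ∫ u in (0 : ℝ)..1, k u with hc
  refine ⟨c, ?_⟩
  have hkc : IntervalIntegrable (fun u => k u - c) volume 0 1 := hki.sub intervalIntegrable_const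
  have key : ∀ᵐ u : ℝ ∂(volume.restrict (Ioc (0 : ℝ) 1)), k u - c = 0 := by
    refine ae_eq_zero_of_forall_periodic
      ((intervalIntegrable_iff_integrableOn_Ioc_of_le zero_le_one).1 hkc) fun ψ hψ hper => ?_
    -- integrate `ψ` minus its mean to a periodic test function `φ`
    set m : ℝ := ∫ u in (0 : ℝ)..1, ψ u with hm
    have hψc := hψ.continuous
    have hη : ContDiff ℝ ∞ fun u => ψ u - m := hψ.sub contDiff_const
    set φ : ℝ → ℝ := fun u => ∫ r in (0 : ℝ)..u, (ψ r - m) with hφ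
    have hφd : deriv φ = fun u => ψ u - m := funext fun u =>
      (hη.continuous.integral_hasStrictDerivAt 0 u).hasDerivAt.deriv
    have hη0 : ∫ r in (0 : ℝ)..1, (ψ r - m) = 0 := by
      rw [intervalIntegral.integral_sub (hψc.intervalIntegrable _ _) intervalIntegrable_const, ← hm]
      simp
    have hφper : Function.Periodic φ 1 := by
      intro u
      have hp : Function.Periodic (fun u => ψ u - m) 1 := fun u => by simp only [hper u]
      have h1 := hp.intervalIntegral_add_eq u 0
      rw [zero_add, hη0] at h1
      simp only [hφ]
      rw [← intervalIntegral.integral_add_adjacent_intervals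
        (hη.continuous.intervalIntegrable 0 u) (hη.continuous.intervalIntegrable u (u + 1)), h1,
        add_zero]
    have hw := h φ (contDiff_primitive_of_smooth hη) hφper
    rw [hφd] at hw
    have hparts := integral_smul_primitive_add zero_le_one (hη.continuous.intervalIntegrable 0 1) hgi
    rw [hη0, zero_smul] at hparts
    have h3 : ∫ u in (0 : ℝ)..1, (ψ u - m) • k u = 0 := by
      have hA : IntervalIntegrable (fun u => (ψ u - m) • G u) volume 0 1 :=
        (hη.continuous.smul hGc).intervalIntegrable _ _
      simp only [hk, smul_sub]
      rw [intervalIntegral.integral_sub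
        (hfi.continuousOn_smul hη.continuous.continuousOn) hA, hw, sub_eq_zero, eq_comm,
        eq_neg_iff_add_eq_zero]
      exact hparts
    have h4 : ∫ u in (0 : ℝ)..1, (ψ u - m) • k u =
        (∫ u in (0 : ℝ)..1, ψ u • k u) - m • c := by
      have hA : IntervalIntegrable (fun u => m • k u) volume 0 1 := hki.smul m
      simp only [sub_smul]
      rw [intervalIntegral.integral_sub (hki.continuousOn_smul hψc.continuousOn) hA,
        intervalIntegral.integral_smul]
    have hA : IntervalIntegrable (fun u => ψ u • c) volume 0 1 :=
      (hψc.smul continuous_const).intervalIntegrable _ _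
    simp only [smul_sub]
    rw [intervalIntegral.integral_sub (hki.continuousOn_smul hψc.continuousOn) hA,
      intervalIntegral.integral_smul_const, ← hm, ← h4, h3]
  filter_upwards [key] with u hu
  have : f (u : UnitAddCircle) - G u - c = 0 := hu
  rw [sub_sub, sub_eq_zero] at this
  rw [this, add_comm]

end WeakDerivative

/-! ### The Sobolev space `W11` -/

namespace W11

theorem integrable_fn (γ : W11) : Integrable γ.fn := L1.integrable_coeFn _

theorem integrable_wderiv (γ : W11) : Integrable γ.wderiv := L1.integrable_coeFn _

theorem isWeakDeriv (γ : W11) : IsWeakDeriv γ.fn γ.wderiv := γ.2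

theorem integral_wderiv (γ : W11) : ∫ x, γ.wderiv x = 0 := γ.isWeakDeriv.integral_eq_zero

/-- The weak derivative as a bounded operator into `L¹`. -/
def derivL : W11 →L[ℝ] CircleL1 :=
  (WithLp.sndL 1 ℝ CircleL1 CircleL1).comp W11Submodule.subtypeL

theorem derivL_apply (γ : W11) : derivL γ = γ.1.snd := rfl

theorem norm_derivL (γ : W11) : ‖derivL γ‖ = γ.length := L1.norm_eq_integral_norm _

theorem length_nonneg (γ : W11) : 0 ≤ γ.length := norm_derivL γ ▸ norm_nonneg _

theorem continuous_length : Continuous length := by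
  have : length = fun γ => ‖derivL γ‖ := funext fun γ => (norm_derivL γ).symm
  rw [this]
  exact derivL.continuous.norm

theorem norm_eq (γ : W11) : ‖γ‖ = ‖γ.1.fst‖ + ‖γ.1.snd‖ := WithLp.prod_norm_eq_of_L1 γ.1

theorem wderiv_sub (γ η : W11) : (γ - η).wderiv =ᵐ[volume] γ.wderiv - η.wderiv :=
  Lp.coeFn_sub γ.1.snd η.1.snd

theorem fn_sub (γ η : W11) : (γ - η).fn =ᵐ[volume] γ.fn - η.fn :=
  Lp.coeFn_sub γ.1.fst η.1.fst

/-- The distance of the weak derivatives of two curves in `L¹`. -/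
theorem norm_derivL_sub (γ η : W11) :
    ‖derivL γ - derivL η‖ = ∫ x, ‖γ.wderiv x - η.wderiv x‖ := by
  rw [← map_sub, norm_derivL, length]
  refine integral_congr_ae ?_
  filter_upwards [wderiv_sub γ η] with x hx
  rw [hx, Pi.sub_apply]

/-- A curve in `W11` is determined by its underlying map. -/
theorem ext_fn {γ η : W11} (h : γ.fn =ᵐ[volume] η.fn) : γ = η := by
  have h0 : (γ - η).fn =ᵐ[volume] 0 := by
    filter_upwards [fn_sub γ η, h] with x hx hx'
    rw [hx, Pi.sub_apply, hx', sub_self, Pi.zero_apply]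
  have h1 := (γ - η).isWeakDeriv.ae_eq_zero h0 (γ - η).integrable_wderiv
  have e0 : (γ - η).1.fst = 0 := (Lp.eq_zero_iff_ae_eq_zero).2 h0
  have e1 : (γ - η).1.snd = 0 := (Lp.eq_zero_iff_ae_eq_zero).2 h1
  rw [← sub_eq_zero, ← norm_eq_zero, norm_eq, e0, e1, norm_zero, add_zero]

/-- The indefinite integral of the weak derivative is periodic, because the derivative has mean
zero, so it descends to a continuous map on the circle. -/
theorem exists_continuousMap (γ : W11) : ∃ x : C(UnitAddCircle, Plane),
    (x : UnitAddCircle → Plane) =ᵐ[volume] γ.fn ∧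
      ∀ u : ℝ, x u = x 0 + ∫ r in (0 : ℝ)..u, γ.wderiv (r : UnitAddCircle) := by
  obtain ⟨c, hc⟩ := γ.isWeakDeriv.exists_primitive γ.integrable_fn γ.integrable_wderiv
  set G : ℝ → Plane := fun u => c + ∫ r in (0 : ℝ)..u, γ.wderiv (r : UnitAddCircle) with hG
  have hgi := circle_lift_intervalIntegrable γ.integrable_wderiv
  have hGc : Continuous G :=
    continuous_const.add (intervalIntegral.continuous_primitive hgi 0)
  have hper : Function.Periodic G 1 := by
    intro u
    have h1 := (periodic_comp_coe γ.wderiv).intervalIntegral_add_eq u 0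
    rw [zero_add, circle_integral_eq, γ.integral_wderiv] at h1
    simp only [hG]
    rw [← intervalIntegral.integral_add_adjacent_intervals (hgi 0 u) (hgi u (u + 1)), h1, add_zero]
  have hlift : ∀ u : ℝ, hper.lift (u : UnitAddCircle) = G u := fun u => hper.lift_coe u
  refine ⟨⟨hper.lift, ?_⟩, ?_, fun u => ?_⟩
  · exact continuous_coinduced_dom.2 hGc
  · refine circle_ae_eq_of_lift ?_ γ.integrable_fn.1 ?_
    · exact (continuous_coinduced_dom.2 hGc : Continuous hper.lift).aestronglyMeasurable
    · filter_upwards [hc] with u hu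
      rw [hu]; exact hlift u
  · have h0 : hper.lift (0 : UnitAddCircle) = c := by
      have := hlift 0
      simpa [hG] using this
    change hper.lift (u : UnitAddCircle) = hper.lift (0 : UnitAddCircle) + _
    rw [hlift, h0]

/-- The continuous representative of a curve. -/
def rep (γ : W11) : C(UnitAddCircle, Plane) := γ.exists_continuousMap.choose

theorem rep_ae_eq (γ : W11) : (γ.rep : UnitAddCircle → Plane) =ᵐ[volume] γ.fn :=
  γ.exists_continuousMap.choose_spec.1

theorem rep_eq (γ : W11) (u : ℝ) :
    γ.rep u = γ.rep 0 + ∫ r in (0 : ℝ)..u, γ.wderiv (r : UnitAddCircle) :=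
  γ.exists_continuousMap.choose_spec.2 u

/-- The representative in `[0, 1)` of a point of the circle. -/
def coord (x : UnitAddCircle) : ℝ := (AddCircle.equivIco 1 0 x : ℝ)

theorem coord_mem (x : UnitAddCircle) : coord x ∈ Ico (0 : ℝ) 1 := by
  simpa [coord] using (AddCircle.equivIco 1 0 x).2

theorem coe_coord (x : UnitAddCircle) : (coord x : UnitAddCircle) = x :=
  (AddCircle.equivIco 1 0).symm_apply_apply x

theorem coord_coe {u : ℝ} (hu : u ∈ Ico (0 : ℝ) 1) : coord (u : UnitAddCircle) = u := by
  rw [coord, AddCircle.equivIco_coe_eq (by simpa using hu)]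

theorem measurable_coord : Measurable coord :=
  measurable_subtype_coe.comp (AddCircle.measurableEquivIco 1 0).measurable

theorem norm_interval_integral_le {f : UnitAddCircle → Plane} (hf : Integrable f) {u v : ℝ}
    (hu : u ∈ Icc (0 : ℝ) 1) (hv : v ∈ Icc (0 : ℝ) 1) :
    ‖∫ r in u..v, f (r : UnitAddCircle)‖ ≤ ∫ x, ‖f x‖ := by
  refine (intervalIntegral.norm_integral_le_integral_norm_uIoc).trans ?_
  rw [← circle_integral_eq, intervalIntegral.integral_of_le zero_le_one]
  refine setIntegral_mono_set ?_ (ae_of_all _ fun _ => norm_nonneg _) ?_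
  · exact ((intervalIntegrable_iff_integrableOn_Ioc_of_le zero_le_one).1
      (circle_lift_intervalIntegrable hf 0 1)).norm
  · refine LE.le.eventuallyLE ?_
    intro x hx
    rw [mem_uIoc] at hx
    rcases hx with h | h
    · exact ⟨hu.1.trans_lt h.1, h.2.trans hv.2⟩
    · exact ⟨hv.1.trans_lt h.1, h.2.trans hu.2⟩

theorem rep_sub_eq (γ : W11) (x y : UnitAddCircle) :
    γ.rep x - γ.rep y = ∫ r in (coord y)..(coord x), γ.wderiv (r : UnitAddCircle) := by
  have hgi := circle_lift_intervalIntegrable γ.integrable_wderiv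
  have hx := γ.rep_eq (coord x)
  have hy := γ.rep_eq (coord y)
  rw [coe_coord] at hx hy
  rw [hx, hy, ← intervalIntegral.integral_interval_sub_left (hgi 0 (coord x)) (hgi 0 (coord y))]
  abel

theorem norm_rep_sub_le (γ : W11) (x y : UnitAddCircle) : ‖γ.rep x - γ.rep y‖ ≤ γ.length := by
  rw [rep_sub_eq]
  exact norm_interval_integral_le γ.integrable_wderiv (Ico_subset_Icc_self (coord_mem y))
    (Ico_subset_Icc_self (coord_mem x))

theorem norm_rep_sub_sub_le (γ η : W11) (x y : UnitAddCircle) :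
    ‖(γ.rep x - γ.rep y) - (η.rep x - η.rep y)‖ ≤ ‖derivL γ - derivL η‖ := by
  rw [rep_sub_eq, rep_sub_eq, ← intervalIntegral.integral_sub
    (circle_lift_intervalIntegrable γ.integrable_wderiv _ _)
    (circle_lift_intervalIntegrable η.integrable_wderiv _ _), norm_derivL_sub]
  exact norm_interval_integral_le (f := fun x => γ.wderiv x - η.wderiv x)
    (γ.integrable_wderiv.sub η.integrable_wderiv) (Ico_subset_Icc_self (coord_mem y))
    (Ico_subset_Icc_self (coord_mem x))

/-- The embedding of `W11` into the continuous functions is contractive. -/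
theorem norm_rep_sub_const_le (γ : W11) (c : Plane) (x : UnitAddCircle) :
    ‖γ.rep x - c‖ ≤ ‖γ - const c‖ := by
  have hl : (γ - const c).length = γ.length := by
    refine integral_congr_ae ?_
    have h0 : (const c).wderiv =ᵐ[volume] 0 := Lp.coeFn_zero _ _ _
    filter_upwards [wderiv_sub γ (const c), h0] with x hx hx0
    rw [hx, Pi.sub_apply, hx0, Pi.zero_apply, sub_zero]
  have hf : ‖(γ - const c).1.fst‖ = ∫ y, ‖γ.rep y - c‖ := by
    rw [L1.norm_eq_integral_norm]
    refine integral_congr_ae ?_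
    have h0 : (const c).fn =ᵐ[volume] fun _ => c := Lp.coeFn_const (p := 1) (μ := volume) (c := c)
    filter_upwards [fn_sub γ (const c), h0, γ.rep_ae_eq] with x hx hx0 hr
    change ‖(γ - const c).fn x‖ = _
    rw [hx, Pi.sub_apply, hx0, hr]
  rw [norm_eq, ← derivL_apply, norm_derivL, hl, hf]
  have h1 : ∀ y, ‖γ.rep x - c‖ ≤ ‖γ.rep y - c‖ + γ.length := fun y => by
    have := norm_add_le (γ.rep y - c) (γ.rep x - γ.rep y)
    rw [show γ.rep y - c + (γ.rep x - γ.rep y) = γ.rep x - c by abel] at this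
    linarith [norm_rep_sub_le γ x y]
  have hc : Continuous fun y => ‖γ.rep y - c‖ := by fun_prop
  have hi : Integrable fun y => ‖γ.rep y - c‖ := hc.integrable_of_hasCompactSupport
    (HasCompactSupport.of_compactSpace _)
  have h2 := integral_mono (integrable_const ‖γ.rep x - c‖) (hi.add (integrable_const γ.length)) h1
  simp only [Pi.add_apply] at h2
  rw [integral_add hi (integrable_const _)] at h2
  simpa [measureReal_def] using h2

theorem eq_const_of_length_eq_zero {γ : W11} (h : γ.length = 0) : ∃ c, γ = const c := by
  refine ⟨γ.rep 0, ext_fn ?_⟩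
  have h0 : (const (γ.rep 0)).fn =ᵐ[volume] fun _ => γ.rep 0 :=
    Lp.coeFn_const (p := 1) (μ := volume) (c := γ.rep 0)
  filter_upwards [γ.rep_ae_eq, h0] with x hx hx0
  rw [← hx, hx0, ← sub_eq_zero, ← norm_le_zero_iff, ← h]
  exact norm_rep_sub_le γ x 0

theorem continuous_integral_test_smul {φ : ℝ → ℝ} (hφ : Continuous φ) :
    Continuous fun f : CircleL1 => ∫ u in (0 : ℝ)..1, φ u • f (u : UnitAddCircle) := by
  obtain ⟨M, hM⟩ := (isCompact_Icc (a := (0 : ℝ)) (b := 1)).exists_bound_of_continuousOn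
    hφ.continuousOn
  have hM0 : 0 ≤ M := (norm_nonneg _).trans (hM 0 (by simp))
  refine (LipschitzWith.of_dist_le_mul (K := M.toNNReal) fun f g => ?_).continuous
  rw [dist_eq_norm, dist_eq_norm, ← intervalIntegral.integral_sub
    (CircleL1.intervalIntegrable_smul f hφ) (CircleL1.intervalIntegrable_smul g hφ),
    L1.norm_eq_integral_norm, ← circle_integral_eq]
  have h1 : ∫ u in (0 : ℝ)..1, ‖(f - g : CircleL1) (u : UnitAddCircle)‖ =
      ∫ u in (0 : ℝ)..1, ‖f (u : UnitAddCircle) - g (u : UnitAddCircle)‖ := by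
    rw [circle_integral_eq (fun x => ‖(f - g : CircleL1) x‖),
      circle_integral_eq (fun x => ‖f x - g x‖)]
    refine integral_congr_ae ?_
    filter_upwards [Lp.coeFn_sub f g] with x hx
    rw [hx, Pi.sub_apply]
  have hi := (circle_lift_intervalIntegrable ((L1.integrable_coeFn f).sub (L1.integrable_coeFn g))
    0 1).norm
  rw [h1, Real.coe_toNNReal M hM0, ← intervalIntegral.integral_const_mul]
  refine intervalIntegral.norm_integral_le_of_norm_le zero_le_one ?_ (hi.const_mul M)
  refine ae_of_all _ fun u hu => ?_
  rw [← smul_sub, norm_smul]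
  exact mul_le_mul_of_nonneg_right (hM u (Ioc_subset_Icc_self hu)) (norm_nonneg _)

/-- `W11` is closed in `L¹ × L¹`, since each test function gives a closed condition. -/
instance : CompleteSpace W11 := by
  have hcl : IsClosed (W11Submodule : Set (WithLp 1 (CircleL1 × CircleL1))) := by
    have : (W11Submodule : Set (WithLp 1 (CircleL1 × CircleL1))) =
        ⋂ (φ : ℝ → ℝ) (_ : ContDiff ℝ ∞ φ) (_ : Function.Periodic φ 1),
          {p | ∫ u in (0 : ℝ)..1, deriv φ u • p.fst (u : UnitAddCircle) =
            -∫ u in (0 : ℝ)..1, φ u • p.snd (u : UnitAddCircle)} := by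
      ext p
      simp only [mem_iInter]
      rfl
    rw [this]
    refine isClosed_iInter fun φ => isClosed_iInter fun hφ => isClosed_iInter fun _ => ?_
    refine isClosed_eq ?_ ?_
    · exact (continuous_integral_test_smul (hφ.continuous_deriv (by simp))).comp
        (WithLp.fstL 1 ℝ CircleL1 CircleL1).continuous
    · exact ((continuous_integral_test_smul hφ.continuous).comp
        (WithLp.sndL 1 ℝ CircleL1 CircleL1).continuous).neg
  exact hcl.completeSpace_coe

end W11

namespace W11

open scoped RealInnerProductSpace

variable {lam : ℝ}

/-! ### Normalised arc length -/

section ArcLength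

theorem integrable_of_continuous {f : UnitAddCircle → Plane} (hf : Continuous f) : Integrable f :=
  hf.integrable_of_hasCompactSupport (HasCompactSupport.of_compactSpace _)

/-- The normalised arc length on the real line, `γ.arc x` being its value at `coord x`. -/
def arcFun (γ : W11) (u : ℝ) : ℝ :=
  (1 / γ.length) * ∫ τ in (0 : ℝ)..u, ‖γ.wderiv (τ : UnitAddCircle)‖

/-- The density of the normalised arc length measure; it is zero on curves of length zero, by the
convention `x / 0 = 0`. -/
def speed (γ : W11) (x : UnitAddCircle) : ℝ := ‖γ.wderiv x‖ / γ.length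

theorem arc_eq (γ : W11) (x : UnitAddCircle) : γ.arc x = γ.arcFun (coord x) := rfl

theorem arc_coe (γ : W11) {u : ℝ} (hu : u ∈ Ico (0 : ℝ) 1) :
    γ.arc (u : UnitAddCircle) = γ.arcFun u := by rw [arc_eq, coord_coe hu]

theorem speed_nonneg (γ : W11) (x : UnitAddCircle) : 0 ≤ γ.speed x :=
  div_nonneg (norm_nonneg _) γ.length_nonneg

theorem norm_wderiv_intervalIntegrable (γ : W11) (a b : ℝ) :
    IntervalIntegrable (fun u : ℝ => ‖γ.wderiv u‖) volume a b :=
  (circle_lift_intervalIntegrable γ.integrable_wderiv a b).norm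

theorem integrable_speed (γ : W11) : Integrable γ.speed :=
  γ.integrable_wderiv.norm.div_const _

theorem integral_norm_wderiv (γ : W11) : ∫ u in (0 : ℝ)..1, ‖γ.wderiv u‖ = γ.length :=
  circle_integral_eq (fun x => ‖γ.wderiv x‖)

theorem integral_speed {γ : W11} (hL : 0 < γ.length) : ∫ x, γ.speed x = 1 := by
  simp only [speed]
  rw [integral_div, ← length, div_self hL.ne']

theorem arcFun_eq (γ : W11) (u : ℝ) : γ.arcFun u = ∫ r in (0 : ℝ)..u, γ.speed r := by
  simp only [arcFun, speed]
  rw [intervalIntegral.integral_div, one_div, div_eq_inv_mul]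

theorem continuous_arcFun (γ : W11) : Continuous γ.arcFun :=
  continuous_const.mul (intervalIntegral.continuous_primitive γ.norm_wderiv_intervalIntegrable 0)

theorem arcFun_zero (γ : W11) : γ.arcFun 0 = 0 := by simp [arcFun]

theorem arcFun_one {γ : W11} (hL : 0 < γ.length) : γ.arcFun 1 = 1 := by
  rw [arcFun, integral_norm_wderiv]; field_simp

theorem measurable_arc (γ : W11) : Measurable γ.arc :=
  γ.continuous_arcFun.measurable.comp measurable_coord

theorem primitive_norm_mem (γ : W11) {u : ℝ} (hu : u ∈ Icc (0 : ℝ) 1) :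
    (∫ r in (0 : ℝ)..u, ‖γ.wderiv r‖) ∈ Icc 0 γ.length := by
  refine ⟨intervalIntegral.integral_nonneg hu.1 fun _ _ => norm_nonneg _, ?_⟩
  rw [← integral_norm_wderiv]
  exact intervalIntegral.integral_mono_interval le_rfl hu.1 hu.2
    (ae_of_all _ fun _ => norm_nonneg _) (γ.norm_wderiv_intervalIntegrable 0 1)

theorem arc_mem (γ : W11) (x : UnitAddCircle) : γ.arc x ∈ Icc (0 : ℝ) 1 := by
  have h := γ.primitive_norm_mem (Ico_subset_Icc_self (coord_mem x))
  have hL := γ.length_nonneg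
  rw [arc_eq, arcFun, one_div, ← div_eq_inv_mul]
  exact ⟨div_nonneg h.1 hL, div_le_one_of_le₀ h.2 hL⟩

/-- Change of variables to the arc length parameter on an initial arc. -/
theorem integral_speed_smul_comp_arcFun {E : Type*} [NormedAddCommGroup E] [NormedSpace ℝ E]
    (γ : W11) {h : ℝ → E} (hh : Continuous h) {u : ℝ} (hu : 0 ≤ u) :
    ∫ s in (0 : ℝ)..u, γ.speed s • h (γ.arcFun s) = ∫ y in (0 : ℝ)..(γ.arcFun u), h y := by
  have hi : ∀ a b, IntervalIntegrable (fun s : ℝ => γ.speed s) volume a b :=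
    circle_lift_intervalIntegrable γ.integrable_speed
  have := integral_comp_primitive (ρ := fun s : ℝ => γ.speed s) (ξ := γ.arcFun) hu
    (fun s => γ.speed_nonneg s) ((intervalIntegrable_iff_integrableOn_Ioc_of_le hu).1 (hi 0 u)).1
    γ.continuous_arcFun.measurable (fun v _ => hi 0 v)
    (fun v _ => by rw [arcFun_zero, zero_add, arcFun_eq]) γ.continuous_arcFun.continuousOn hh
  rw [this, arcFun_zero]

/-- The normalised arc length pushes the arc length measure forward to Lebesgue measure. -/
theorem integral_speed_smul_comp_arc {E : Type*} [NormedAddCommGroup E] [NormedSpace ℝ E]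
    {γ : W11} (hL : 0 < γ.length) {h : ℝ → E} (hh : Continuous h) :
    ∫ x, γ.speed x • h (γ.arc x) = ∫ y in (0 : ℝ)..1, h y := by
  have h1 := γ.integral_speed_smul_comp_arcFun hh zero_le_one
  rw [arcFun_one hL] at h1
  rw [← h1, ← circle_integral_eq, intervalIntegral.integral_of_le zero_le_one,
    intervalIntegral.integral_of_le zero_le_one, integral_Ioc_eq_integral_Ioo,
    integral_Ioc_eq_integral_Ioo]
  refine setIntegral_congr_fun measurableSet_Ioo fun u hu => ?_
  rw [arc_coe γ (Ioo_subset_Ico_self hu)]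

theorem integral_perKernel_sub_left (hlam : 0 < lam) (y : ℝ) :
    ∫ x in (0 : ℝ)..1, perKernel lam (y - x) = 1 := by
  refine Eq.trans (intervalIntegral.integral_congr fun x _ => ?_) (integral_perKernel_sub hlam y)
  rw [← perKernel_neg, neg_sub]

theorem integral_speed_mul_kernel (hlam : 0 < lam) {γ : W11} (hL : 0 < γ.length) (y : ℝ) :
    ∫ x, γ.speed x * perKernel lam (y - γ.arc x) = 1 := by
  have hc : Continuous fun x => perKernel lam (y - x) :=
    (perKernel_continuous lam).comp (continuous_sub_left y)
  exact (integral_speed_smul_comp_arc hL hc).trans (integral_perKernel_sub_left hlam y)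

end ArcLength

/-! ### The vector field with exponent `2` -/

section Field

/-- The convolution `∫ K (y - ξ v) γ' v dv` of the weak derivative along the curve, as a
function of the arc length parameter `y`. -/
def tangentConv (lam : ℝ) (γ : W11) : ℝ → Plane :=
  potential (perKernel lam) volume γ.arc γ.wderiv

/-- The mean of the curve for the probability density `K (y - ξ v) |γ' v| / 𝓛(γ)`, as a function of
the arc length parameter `y`. -/
def curveMean (lam : ℝ) (γ : W11) : ℝ → Plane :=
  potential (perKernel lam) volume γ.arc fun v => γ.speed v • γ.rep v

theorem continuous_potential (hlam : 0 < lam) {X : Type*} [MeasurableSpace X] {μ : Measure X}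
    {p : X → Plane} (hp : Integrable p μ) {ξ : X → ℝ} (hξ : Measurable ξ) :
    Continuous (potential (perKernel lam) μ ξ p) := by
  have hKc := perKernel_continuous lam
  refine continuous_of_dominated (bound := fun v => kernelBound lam * ‖p v‖)
    (fun x => (potential_kernel_integrable hKc.measurable (norm_perKernel_le hlam) hp hξ x).1)
    (fun x => ae_of_all _ fun v => ?_) (hp.norm.const_mul _) (ae_of_all _ fun v => ?_)
  · rw [norm_smul]
    exact mul_le_mul_of_nonneg_right (norm_perKernel_le hlam _) (norm_nonneg _)
  · fun_prop

theorem integrable_speed_smul (γ : W11) {f : UnitAddCircle → Plane} (hf : Continuous f) :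
    Integrable fun v => γ.speed v • f v := by
  obtain ⟨M, hM⟩ := isCompact_univ.exists_bound_of_continuousOn hf.continuousOn
  exact integrable_smul_bdd γ.integrable_speed hf.aestronglyMeasurable fun x => hM x (mem_univ x)

theorem continuous_tangentConv (hlam : 0 < lam) (γ : W11) : Continuous (tangentConv lam γ) :=
  continuous_potential hlam γ.integrable_wderiv γ.measurable_arc

theorem continuous_curveMean (hlam : 0 < lam) (γ : W11) : Continuous (curveMean lam γ) :=
  continuous_potential hlam (γ.integrable_speed_smul γ.rep.continuous) γ.measurable_arc

theorem curveMean_one_eq (γ : W11) : curveMean lam γ 1 = curveMean lam γ 0 := by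
  refine integral_congr_ae (ae_of_all _ fun v => ?_)
  simp only
  rw [show 1 - γ.arc v = 0 - γ.arc v + 1 by ring, perKernel_periodic lam]

/-- Integration by parts moves the derivative of the kernel onto the curve. -/
theorem curveMean_eq (hlam : 0 < lam) {γ : W11} (hL : 0 < γ.length) (y : ℝ) :
    curveMean lam γ y =
      γ.rep 0 - ∫ v, (∫ x in (0 : ℝ)..(γ.arc v), perKernel lam (y - x)) • γ.wderiv v := by
  have hc : Continuous fun x => perKernel lam (y - x) :=
    (perKernel_continuous lam).comp (continuous_sub_left y)
  set f : ℝ → ℝ := fun s => γ.speed s • perKernel lam (y - γ.arcFun s) with hf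
  have hfi : IntervalIntegrable f volume 0 1 :=
    (circle_lift_intervalIntegrable γ.integrable_speed 0 1).smul_continuousOn
      (hc.comp γ.continuous_arcFun).continuousOn
  have hpi := circle_lift_intervalIntegrable γ.integrable_wderiv
  have hparts := integral_smul_primitive_add zero_le_one hfi (hpi 0 1)
  rw [circle_integral_eq γ.wderiv, γ.integral_wderiv, smul_zero] at hparts
  have h1 : curveMean lam γ y = ∫ s in (0 : ℝ)..1, f s • γ.rep s := by
    rw [curveMean, potential, ← circle_integral_eq, intervalIntegral.integral_of_le zero_le_one,
      intervalIntegral.integral_of_le zero_le_one, integral_Ioc_eq_integral_Ioo,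
      integral_Ioc_eq_integral_Ioo]
    refine setIntegral_congr_fun measurableSet_Ioo fun u hu => ?_
    simp only [hf]
    rw [arc_coe γ (Ioo_subset_Ico_self hu), smul_smul, smul_eq_mul, mul_comm]
  have h2 : ∫ s in (0 : ℝ)..1, f s • γ.rep s = (∫ s in (0 : ℝ)..1, f s) • γ.rep 0 +
      ∫ s in (0 : ℝ)..1, f s • ∫ r in (0 : ℝ)..s, γ.wderiv (r : UnitAddCircle) := by
    have hB : IntervalIntegrable
        (fun s => f s • ∫ r in (0 : ℝ)..s, γ.wderiv (r : UnitAddCircle)) volume 0 1 :=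
      hfi.smul_continuousOn (intervalIntegral.continuous_primitive hpi 0).continuousOn
    have hA : IntervalIntegrable (fun s => f s • γ.rep 0) volume 0 1 :=
      hfi.smul_continuousOn continuousOn_const
    rw [← intervalIntegral.integral_smul_const, ← intervalIntegral.integral_add hA hB]
    refine intervalIntegral.integral_congr fun s _ => ?_
    rw [γ.rep_eq s, smul_add]
  have h3 : ∫ s in (0 : ℝ)..1, f s = 1 := by
    rw [hf, γ.integral_speed_smul_comp_arcFun hc zero_le_one, arcFun_one hL,
      integral_perKernel_sub_left hlam]
  have h4 : ∫ s in (0 : ℝ)..1, (∫ r in (0 : ℝ)..s, f r) • γ.wderiv (s : UnitAddCircle) =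
      ∫ v, (∫ x in (0 : ℝ)..(γ.arc v), perKernel lam (y - x)) • γ.wderiv v := by
    rw [← circle_integral_eq, intervalIntegral.integral_of_le zero_le_one,
      intervalIntegral.integral_of_le zero_le_one, integral_Ioc_eq_integral_Ioo,
      integral_Ioc_eq_integral_Ioo]
    refine setIntegral_congr_fun measurableSet_Ioo fun u hu => ?_
    rw [arc_coe γ (Ioo_subset_Ico_self hu), hf, γ.integral_speed_smul_comp_arcFun hc hu.1.le]
  rw [h4] at hparts
  rw [h1, h2, h3, one_smul, eq_neg_of_add_eq_zero_left hparts, sub_eq_add_neg]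

/-- In the arc length parameter, the derivative of the mean of the curve is the mean of the
derivative. -/
theorem curveMean_sub_eq (hlam : 0 < lam) {γ : W11} (hL : 0 < γ.length) {y : ℝ} (hy : 0 ≤ y) :
    curveMean lam γ y - curveMean lam γ 0 = ∫ z in (0 : ℝ)..y, tangentConv lam γ z := by
  have hKc := perKernel_continuous lam
  have hKi : ∀ a b, IntervalIntegrable (perKernel lam) volume a b := hKc.intervalIntegrable
  have hint : ∀ z : ℝ, Integrable fun v =>
      (∫ x in (0 : ℝ)..(γ.arc v), perKernel lam (z - x)) • γ.wderiv v := by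
    intro z
    have hc : Continuous fun x => perKernel lam (z - x) := hKc.comp (continuous_sub_left z)
    refine integrable_bdd_smul (M := kernelBound lam) ?_ (fun v => ?_) γ.integrable_wderiv
    · exact (intervalIntegral.continuous_primitive (fun a b => hc.intervalIntegrable a b)
        0).measurable.comp γ.measurable_arc
    · refine (intervalIntegral.norm_integral_le_of_norm_le_const fun x _ =>
        norm_perKernel_le hlam (z - x)).trans ?_
      rw [sub_zero, abs_of_nonneg (γ.arc_mem v).1]
      exact mul_le_of_le_one_right (kernelBound_nonneg hlam) (γ.arc_mem v).2
  have hbr : ∀ x : ℝ, (∫ t in (0 : ℝ)..x, perKernel lam (0 - t)) -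
      (∫ t in (0 : ℝ)..x, perKernel lam (y - t)) =
      (∫ z in (0 : ℝ)..y, perKernel lam (z - x)) - ∫ z in (0 : ℝ)..y, perKernel lam z := by
    intro x
    rw [intervalIntegral.integral_comp_sub_left (fun t => perKernel lam t),
      intervalIntegral.integral_comp_sub_left (fun t => perKernel lam t),
      intervalIntegral.integral_comp_sub_right (fun t => perKernel lam t)]
    simp only [sub_zero, zero_sub]
    rw [← intervalIntegral.integral_add_adjacent_intervals (hKi (-x) (y - x)) (hKi (y - x) 0),
      ← intervalIntegral.integral_add_adjacent_intervals (hKi (y - x) 0) (hKi 0 y)]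
    ring
  rw [curveMean_eq hlam hL, curveMean_eq hlam hL, sub_sub_sub_cancel_left,
    ← integral_sub (hint 0) (hint y), tangentConv, integral_potential hKc.measurable
      (norm_perKernel_le hlam) γ.integrable_wderiv γ.measurable_arc hy]
  simp_rw [← sub_smul, hbr, sub_smul]
  rw [integral_sub, integral_smul, γ.integral_wderiv, smul_zero, sub_zero]
  · refine integrable_bdd_smul (M := kernelBound lam * |y - 0|) ?_ (fun v => ?_)
      γ.integrable_wderiv
    · have : Continuous fun x => ∫ z in (0 : ℝ)..y, perKernel lam (z - x) := by
        refine intervalIntegral.continuous_parametric_intervalIntegral_of_continuous' ?_ 0 y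
        exact hKc.comp (continuous_snd.sub continuous_fst)
      exact this.measurable.comp γ.measurable_arc
    · exact intervalIntegral.norm_integral_le_of_norm_le_const fun x _ => norm_perKernel_le hlam _
  · exact γ.integrable_wderiv.smul (∫ z in (0 : ℝ)..y, perKernel lam z)

theorem curveConv_eq (γ : W11) (x : UnitAddCircle) :
    curveConv lam γ x = -curveMean lam γ (γ.arc x) := by
  rw [curveConv, curveMean, potential, ← integral_neg]
  refine integral_congr_ae ?_
  filter_upwards [γ.rep_ae_eq] with v hv
  have h1 : |γ.arc v - γ.arc x| ≤ 1 := by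
    have := γ.arc_mem v
    have := γ.arc_mem x
    rw [abs_le]; constructor <;> linarith [this.1, this.2, (γ.arc_mem v).1, (γ.arc_mem v).2]
  rw [greenKernel_eq h1, ← hv, ← perKernel_neg, neg_sub, smul_smul, neg_mul, neg_smul, speed]

/-- The weak derivative of the vector field with exponent `2`. -/
def fieldDeriv (lam : ℝ) (γ : W11) (x : UnitAddCircle) : Plane :=
  -(1 / lam ^ 2) • (γ.wderiv x - γ.speed x • tangentConv lam γ (γ.arc x))

theorem integrable_speed_smul_tangentConv (hlam : 0 < lam) (γ : W11) :
    Integrable fun x => γ.speed x • tangentConv lam γ (γ.arc x) := by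
  refine integrable_smul_bdd γ.integrable_speed (M := kernelBound lam * ∫ v, ‖γ.wderiv v‖) ?_
    (fun x => ?_)
  · exact ((continuous_tangentConv hlam γ).measurable.comp γ.measurable_arc).aestronglyMeasurable
  · exact norm_potential_le (norm_perKernel_le hlam) γ.integrable_wderiv _

theorem integrable_fieldDeriv (hlam : 0 < lam) (γ : W11) : Integrable (fieldDeriv lam γ) :=
  integrable_const_smul_sub _ γ.integrable_wderiv (integrable_speed_smul_tangentConv hlam γ)

theorem flowField_two {γ : W11} (hL : 0 < γ.length) :
    flowField lam 2 γ =ᵐ[volume]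
      fun x => -(1 / lam ^ 2) • (γ.rep x - curveMean lam γ (γ.arc x)) := by
  filter_upwards [γ.rep_ae_eq] with x hx
  rw [flowField, if_pos hL.ne', lengthGradient, curveConv_eq, hx, sub_self, Real.rpow_zero,
    neg_smul, sub_eq_add_neg]

/-- Since the kernel has mass one, the gradient is the curve minus its mean, and its weak derivative
is computed in the arc length parameter. -/
theorem exists_field (hlam : 0 < lam) (γ : W11) :
    ∃ V : W11, V.fn =ᵐ[volume] flowField lam 2 γ ∧ V.wderiv =ᵐ[volume] fieldDeriv lam γ := by
  rcases γ.length_nonneg.eq_or_lt with h0 | hL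
  · refine ⟨0, ?_, ?_⟩
    · have : (0 : W11).fn =ᵐ[volume] 0 := Lp.coeFn_zero _ _ _
      filter_upwards [this] with x hx
      rw [hx, flowField, if_neg (not_not.2 h0.symm), Pi.zero_apply]
    · have h1 : (0 : W11).wderiv =ᵐ[volume] 0 := Lp.coeFn_zero _ _ _
      have h2 : γ.wderiv =ᵐ[volume] 0 := by
        refine (Lp.eq_zero_iff_ae_eq_zero (f := γ.1.snd)).1 ?_
        rw [← derivL_apply, ← norm_eq_zero, norm_derivL, ← h0]
      filter_upwards [h1, h2] with x hx hx'
      rw [hx, fieldDeriv, speed, hx', ← h0]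
      simp
  · have hTc := (continuous_tangentConv hlam γ)
    have hCc := (continuous_curveMean hlam γ)
    have hpi := circle_lift_intervalIntegrable γ.integrable_wderiv
    have hSi := circle_lift_intervalIntegrable (integrable_speed_smul_tangentConv hlam γ)
    have hfi : Integrable (flowField lam 2 γ) := by
      refine Integrable.congr ?_ (flowField_two hL).symm
      refine integrable_const_smul_sub _ ?_ ?_
      · exact integrable_of_continuous γ.rep.continuous
      · refine Integrable.of_bound (hCc.measurable.comp γ.measurable_arc).aestronglyMeasurable
          (kernelBound lam * ∫ v, ‖γ.speed v • γ.rep v‖) (ae_of_all _ fun x => ?_)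
        exact norm_potential_le (norm_perKernel_le hlam)
          (γ.integrable_speed_smul γ.rep.continuous) _
    have hΦi := integrable_fieldDeriv hlam γ
    have hΦ0 : ∫ x, fieldDeriv lam γ x = 0 := by
      simp only [fieldDeriv]
      rw [integral_smul,
        integral_sub γ.integrable_wderiv (integrable_speed_smul_tangentConv hlam γ),
        γ.integral_wderiv, integral_speed_smul_comp_arc hL hTc,
        ← curveMean_sub_eq hlam hL zero_le_one, curveMean_one_eq, sub_self, sub_self, smul_zero]
    have hprim : ∀ᵐ u : ℝ ∂(volume.restrict (Ioc (0 : ℝ) 1)), flowField lam 2 γ u =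
        -(1 / lam ^ 2) • (γ.rep 0 - curveMean lam γ 0) +
          ∫ r in (0 : ℝ)..u, fieldDeriv lam γ (r : UnitAddCircle) := by
      rw [← restrict_Ioo_eq_restrict_Ioc]
      have h1 := ae_lift_of_circle_ae (flowField_two (lam := lam) hL)
      rw [← restrict_Ioo_eq_restrict_Ioc] at h1
      filter_upwards [h1, ae_restrict_mem measurableSet_Ioo] with u hu hmem
      have h2 : ∫ r in (0 : ℝ)..u, γ.speed r • tangentConv lam γ (γ.arc r) =
          curveMean lam γ (γ.arcFun u) - curveMean lam γ 0 := by
        have h3 : 0 ≤ γ.arcFun u := by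
          rw [← arc_coe γ (Ioo_subset_Ico_self hmem)]; exact (γ.arc_mem _).1
        rw [curveMean_sub_eq hlam hL h3, ← γ.integral_speed_smul_comp_arcFun hTc hmem.1.le]
        refine intervalIntegral.integral_congr fun r hr => ?_
        rw [uIcc_of_le hmem.1.le] at hr
        rw [arc_coe γ ⟨hr.1, hr.2.trans_lt hmem.2⟩]
      rw [hu]
      simp only [fieldDeriv]
      rw [intervalIntegral.integral_smul, intervalIntegral.integral_sub (hpi 0 u) (hSi 0 u), h2,
        arc_coe γ (Ioo_subset_Ico_self hmem), γ.rep_eq u, ← smul_add]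
      congr 1
      abel
    have hweak := isWeakDeriv_of_primitive hΦi hΦ0 hprim
    have e1 := hfi.coeFn_toL1
    have e2 := hΦi.coeFn_toL1
    refine ⟨⟨WithLp.toLp 1 (hfi.toL1, hΦi.toL1), ?_⟩, e1, e2⟩
    intro φ hφ hper
    simp only [WithLp.toLp_fst, WithLp.toLp_snd]
    rw [circle_intervalIntegral_congr e1, circle_intervalIntegral_congr e2]
    exact hweak φ hφ hper

/-- The vector field `F_{λ,2}` of the gradient flow with exponent `2`, as a map of `W11`. -/
def field (hlam : 0 < lam) (γ : W11) : W11 := (exists_field hlam γ).choose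

theorem field_fn (hlam : 0 < lam) (γ : W11) :
    (field hlam γ).fn =ᵐ[volume] flowField lam 2 γ := (exists_field hlam γ).choose_spec.1

theorem field_wderiv (hlam : 0 < lam) (γ : W11) :
    (field hlam γ).wderiv =ᵐ[volume] fieldDeriv lam γ := (exists_field hlam γ).choose_spec.2

theorem field_eq_zero (hlam : 0 < lam) {γ : W11} (h : γ.length = 0) : field hlam γ = 0 := by
  refine ext_fn ?_
  have : (0 : W11).fn =ᵐ[volume] 0 := Lp.coeFn_zero _ _ _
  filter_upwards [this, field_fn hlam γ] with x hx hx'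
  rw [hx, hx', flowField, if_neg (not_not.2 h), Pi.zero_apply]

end Field

end W11

namespace W11

open scoped RealInnerProductSpace

variable {lam : ℝ}

/-! ### The Lipschitz estimate -/

section Lipschitz

theorem norm_primitive_norm_sub_le (γ η : W11) {u : ℝ} (hu : u ∈ Icc (0 : ℝ) 1) :
    |(∫ r in (0 : ℝ)..u, ‖γ.wderiv r‖) - ∫ r in (0 : ℝ)..u, ‖η.wderiv r‖| ≤
      ‖derivL γ - derivL η‖ := by
  have hi : ∀ a b, IntervalIntegrable (fun r : ℝ => γ.wderiv r - η.wderiv r) volume a b :=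
    circle_lift_intervalIntegrable (γ.integrable_wderiv.sub η.integrable_wderiv)
  rw [← intervalIntegral.integral_sub (γ.norm_wderiv_intervalIntegrable 0 u)
    (η.norm_wderiv_intervalIntegrable 0 u), norm_derivL_sub, ← circle_integral_eq]
  calc _ ≤ ∫ r in (0 : ℝ)..u, ‖γ.wderiv r - η.wderiv r‖ := by
        exact intervalIntegral.norm_integral_le_of_norm_le
          (f := fun r : ℝ => ‖γ.wderiv r‖ - ‖η.wderiv r‖)
          (g := fun r : ℝ => ‖γ.wderiv r - η.wderiv r‖) hu.1
          (ae_of_all _ fun r _ => abs_norm_sub_norm_le (γ.wderiv r) (η.wderiv r)) (hi 0 u).norm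
    _ ≤ _ := intervalIntegral.integral_mono_interval le_rfl hu.1 hu.2
        (ae_of_all _ fun _ => norm_nonneg _) (hi 0 1).norm

theorem abs_length_sub_le (γ η : W11) : |γ.length - η.length| ≤ ‖derivL γ - derivL η‖ := by
  rw [← norm_derivL, ← norm_derivL]; exact abs_norm_sub_norm_le _ _

theorem abs_div_sub_div_le {A B L L' δ : ℝ} (hL : 0 < L) (hL' : 0 < L') (hB0 : 0 ≤ B)
    (hB : B ≤ L') (hAB : |A - B| ≤ δ) (hLL : |L - L'| ≤ δ) : |A / L - B / L'| ≤ 2 * δ / L := by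
  have hB1 : B / L' ≤ 1 := (div_le_one hL').2 hB
  have hB2 : 0 ≤ B / L' := div_nonneg hB0 hL'.le
  have h : A / L - B / L' = ((A - B) - B / L' * (L - L')) / L := by field_simp; ring
  rw [h, abs_div, abs_of_pos hL]
  gcongr
  refine (abs_sub _ _).trans ?_
  rw [abs_mul, abs_of_nonneg hB2]
  have := mul_le_of_le_one_left (abs_nonneg (L - L')) hB1
  linarith

/-- The normalised arc length depends on the curve in a Lipschitz way. -/
theorem abs_arc_sub_le {γ η : W11} (hγ : 0 < γ.length) (hη : 0 < η.length) (x : UnitAddCircle) :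
    |γ.arc x - η.arc x| ≤ 2 * ‖derivL γ - derivL η‖ / γ.length := by
  have hx := Ico_subset_Icc_self (coord_mem x)
  have hm := η.primitive_norm_mem hx
  rw [arc_eq, arc_eq, arcFun, arcFun, one_div, one_div, ← div_eq_inv_mul, ← div_eq_inv_mul]
  exact abs_div_sub_div_le hγ hη hm.1 hm.2 (norm_primitive_norm_sub_le γ η hx)
    (abs_length_sub_le γ η)

theorem integral_abs_speed_sub_le {γ η : W11} (hγ : 0 < γ.length) (hη : 0 < η.length) :
    ∫ x, |γ.speed x - η.speed x| ≤ 2 * ‖derivL γ - derivL η‖ / γ.length := by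
  set δ := ‖derivL γ - derivL η‖ with hδ
  have hi : Integrable fun x => ‖γ.wderiv x - η.wderiv x‖ :=
    (γ.integrable_wderiv.sub η.integrable_wderiv).norm
  have hpt : ∀ x, |γ.speed x - η.speed x| ≤
      ‖γ.wderiv x - η.wderiv x‖ / γ.length + η.speed x * (δ / γ.length) := by
    intro x
    have h : γ.speed x - η.speed x = (‖γ.wderiv x‖ - ‖η.wderiv x‖) / γ.length -
        η.speed x * ((γ.length - η.length) / γ.length) := by
      rw [speed, speed]; field_simp; ring
    rw [h]
    refine (abs_sub _ _).trans (add_le_add ?_ ?_)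
    · rw [abs_div, abs_of_pos hγ]
      gcongr
      exact abs_norm_sub_norm_le _ _
    · rw [abs_mul, abs_of_nonneg (η.speed_nonneg x), abs_div, abs_of_pos hγ]
      gcongr
      · exact η.speed_nonneg x
      · exact abs_length_sub_le γ η
  calc _ ≤ ∫ x, (‖γ.wderiv x - η.wderiv x‖ / γ.length + η.speed x * (δ / γ.length)) :=
        integral_mono (γ.integrable_speed.sub η.integrable_speed).abs
          ((hi.div_const _).add (η.integrable_speed.mul_const _)) hpt
    _ = _ := by
        rw [integral_add (hi.div_const _) (η.integrable_speed.mul_const _), integral_div,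
          integral_mul_const, integral_speed hη, ← norm_derivL_sub, ← hδ]
        ring

/-- The potentials of two vector measures along two nearby parametrisations. -/
theorem norm_potential_sub_le (hlam : 0 < lam) {a b : UnitAddCircle → ℝ} (ha : Measurable a)
    (hb : Measurable b) {ε : ℝ} (hab : ∀ x, |a x - b x| ≤ ε) {m m' : UnitAddCircle → Plane}
    (hm : Integrable m) (hm' : Integrable m') (x : UnitAddCircle) :
    ‖potential (perKernel lam) volume a m (a x) - potential (perKernel lam) volume b m' (b x)‖ ≤
      1 / (2 * lam ^ 2) * (2 * ε) * (∫ v, ‖m v‖) + kernelBound lam * ∫ v, ‖m v - m' v‖ := by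
  have hKm := (perKernel_continuous lam).measurable
  have hKb := norm_perKernel_le hlam
  have hd : Integrable fun v => ‖m v - m' v‖ := (hm.sub hm').norm
  rw [potential, potential, ← integral_sub (potential_kernel_integrable hKm hKb hm ha _)
    (potential_kernel_integrable hKm hKb hm' hb _), ← integral_const_mul, ← integral_const_mul,
    ← integral_add (hm.norm.const_mul _) (hd.const_mul _)]
  refine norm_integral_le_of_norm_le ((hm.norm.const_mul _).add (hd.const_mul _))
    (ae_of_all _ fun v => ?_)
  have h : perKernel lam (a x - a v) • m v - perKernel lam (b x - b v) • m' v =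
      (perKernel lam (a x - a v) - perKernel lam (b x - b v)) • m v +
        perKernel lam (b x - b v) • (m v - m' v) := by
    rw [sub_smul, smul_sub]; abel
  rw [h]
  refine (norm_add_le _ _).trans (add_le_add ?_ ?_)
  · rw [norm_smul]
    refine mul_le_mul_of_nonneg_right ?_ (norm_nonneg _)
    refine (abs_perKernel_sub_le hlam _ _).trans ?_
    gcongr
    rw [show a x - a v - (b x - b v) = (a x - b x) - (a v - b v) by ring]
    refine (abs_sub _ _).trans ?_
    linarith [hab x, hab v]
  · rw [norm_smul]
    exact mul_le_mul_of_nonneg_right (hKb _) (norm_nonneg _)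

/-- The curve minus its mean, as a potential of differences of the curve. -/
theorem rep_sub_curveMean (hlam : 0 < lam) {γ : W11} (hL : 0 < γ.length) (x : UnitAddCircle) :
    γ.rep x - curveMean lam γ (γ.arc x) =
      potential (perKernel lam) volume γ.arc (fun v => γ.speed v • (γ.rep x - γ.rep v))
        (γ.arc x) := by
  have hKm := (perKernel_continuous lam).measurable
  have hKb := norm_perKernel_le hlam
  have h1 : γ.rep x = ∫ v, perKernel lam (γ.arc x - γ.arc v) • γ.speed v • γ.rep x := by
    simp_rw [smul_smul, mul_comm (perKernel lam _)]
    rw [integral_smul_const, integral_speed_mul_kernel hlam hL, one_smul]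
  have hi1 := potential_kernel_integrable hKm hKb
    (γ.integrable_speed_smul (continuous_const (y := γ.rep x))) γ.measurable_arc (γ.arc x)
  have hi2 := potential_kernel_integrable hKm hKb
    (γ.integrable_speed_smul γ.rep.continuous) γ.measurable_arc (γ.arc x)
  conv_lhs => rw [h1]
  rw [curveMean, potential, potential, ← integral_sub hi1 hi2]
  refine integral_congr_ae (ae_of_all _ fun v => ?_)
  simp only [smul_sub]

theorem integral_norm_speed_smul_le {γ : W11} (hL : 0 < γ.length) (x : UnitAddCircle) :
    ∫ v, ‖γ.speed v • (γ.rep x - γ.rep v)‖ ≤ γ.length := by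
  have hi := γ.integrable_speed_smul (f := fun v => γ.rep x - γ.rep v)
    (continuous_const.sub γ.rep.continuous)
  calc _ ≤ ∫ v, γ.speed v * γ.length := by
        refine integral_mono hi.norm (γ.integrable_speed.mul_const _) fun v => ?_
        simp only
        rw [norm_smul, Real.norm_of_nonneg (γ.speed_nonneg v)]
        exact mul_le_mul_of_nonneg_left (γ.norm_rep_sub_le x v) (γ.speed_nonneg v)
    _ = _ := by rw [integral_mul_const, integral_speed hL, one_mul]

theorem integral_norm_speed_smul_sub_le {γ η : W11} (hγ : 0 < γ.length) (hη : 0 < η.length)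
    (x : UnitAddCircle) :
    ∫ v, ‖γ.speed v • (γ.rep x - γ.rep v) - η.speed v • (η.rep x - η.rep v)‖ ≤
      3 * ‖derivL γ - derivL η‖ := by
  set δ := ‖derivL γ - derivL η‖ with hδ
  have hi1 := γ.integrable_speed_smul (f := fun v => γ.rep x - γ.rep v)
    (continuous_const.sub γ.rep.continuous)
  have hi2 := η.integrable_speed_smul (f := fun v => η.rep x - η.rep v)
    (continuous_const.sub η.rep.continuous)
  have hs : Integrable fun v => |γ.speed v - η.speed v| :=
    (γ.integrable_speed.sub η.integrable_speed).abs
  calc _ ≤ ∫ v, (|γ.speed v - η.speed v| * γ.length + η.speed v * δ) := by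
        refine integral_mono (hi1.sub hi2).norm
          ((hs.mul_const _).add (η.integrable_speed.mul_const _)) fun v => ?_
        have h : γ.speed v • (γ.rep x - γ.rep v) - η.speed v • (η.rep x - η.rep v) =
            (γ.speed v - η.speed v) • (γ.rep x - γ.rep v) +
              η.speed v • ((γ.rep x - γ.rep v) - (η.rep x - η.rep v)) := by
          rw [sub_smul, smul_sub (η.speed v) (γ.rep x - γ.rep v)]; abel
        rw [h]
        refine (norm_add_le _ _).trans (add_le_add ?_ ?_)
        · rw [norm_smul]
          exact mul_le_mul_of_nonneg_left (γ.norm_rep_sub_le x v) (abs_nonneg _)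
        · rw [norm_smul, Real.norm_of_nonneg (η.speed_nonneg v)]
          exact mul_le_mul_of_nonneg_left (norm_rep_sub_sub_le γ η x v) (η.speed_nonneg v)
    _ ≤ 2 * δ / γ.length * γ.length + 1 * δ := by
        rw [integral_add (hs.mul_const _) (η.integrable_speed.mul_const _), integral_mul_const,
          integral_mul_const, integral_speed hη]
        have := integral_abs_speed_sub_le hγ hη
        gcongr
    _ = _ := by field_simp; ring

theorem norm_tangentConv_le (hlam : 0 < lam) (γ : W11) (y : ℝ) :
    ‖tangentConv lam γ y‖ ≤ kernelBound lam * γ.length :=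
  norm_potential_le (norm_perKernel_le hlam) γ.integrable_wderiv y

/-- The Lipschitz constant of the vector field. -/
def fieldLip (lam : ℝ) : ℝ := 1 / lam ^ 2 * (1 + 4 / lam ^ 2 + 6 * kernelBound lam)

theorem fieldLip_nonneg (hlam : 0 < lam) : 0 ≤ fieldLip lam := by
  have := kernelBound_nonneg hlam
  unfold fieldLip
  positivity

theorem norm_eq_integral_add (γ : W11) : ‖γ‖ = (∫ x, ‖γ.fn x‖) + ∫ x, ‖γ.wderiv x‖ := by
  rw [norm_eq, L1.norm_eq_integral_norm, L1.norm_eq_integral_norm]; rfl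

theorem integral_norm_le_of_forall {f : UnitAddCircle → Plane} {C : ℝ}
    (h : ∀ᵐ x, ‖f x‖ ≤ C) : ∫ x, ‖f x‖ ≤ C := by
  have := norm_integral_le_of_norm_le_const (μ := (volume : Measure UnitAddCircle))
    (f := fun x => ‖f x‖) (C := C) (by simpa using h)
  simpa [measureReal_def] using (le_abs_self _).trans this

theorem norm_field_sub_le_of_pos (hlam : 0 < lam) {γ η : W11} (hγ : 0 < γ.length)
    (hη : 0 < η.length) :
    ‖field hlam γ - field hlam η‖ ≤ fieldLip lam * ‖derivL γ - derivL η‖ := by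
  set δ := ‖derivL γ - derivL η‖ with hδ
  set M := kernelBound lam with hM
  have hM0 : 0 ≤ M := kernelBound_nonneg hlam
  have hδ0 : 0 ≤ δ := norm_nonneg _
  have hc0 : 0 ≤ 1 / lam ^ 2 := by positivity
  have hcn : ‖-(1 / lam ^ 2)‖ = 1 / lam ^ 2 := by rw [norm_neg, Real.norm_of_nonneg hc0]
  have habs := abs_arc_sub_le hγ hη
  -- the curve itself
  have h1 : ∫ x, ‖(field hlam γ - field hlam η).fn x‖ ≤
      1 / lam ^ 2 * ((2 / lam ^ 2 + 3 * M) * δ) := by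
    refine integral_norm_le_of_forall ?_
    filter_upwards [fn_sub (field hlam γ) (field hlam η), field_fn hlam γ, field_fn hlam η,
      flowField_two (lam := lam) hγ, flowField_two (lam := lam) hη] with x e1 e2 e3 e4 e5
    rw [e1, Pi.sub_apply, e2, e3, e4, e5, ← smul_sub, norm_smul, hcn, rep_sub_curveMean hlam hγ,
      rep_sub_curveMean hlam hη]
    have hp := norm_potential_sub_le hlam γ.measurable_arc η.measurable_arc habs
      (γ.integrable_speed_smul (f := fun v => γ.rep x - γ.rep v)
        (continuous_const.sub γ.rep.continuous))
      (η.integrable_speed_smul (f := fun v => η.rep x - η.rep v)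
        (continuous_const.sub η.rep.continuous)) x
    refine mul_le_mul_of_nonneg_left (hp.trans ?_) hc0
    have i1 := integral_norm_speed_smul_le hγ x
    have i2 := integral_norm_speed_smul_sub_le hγ hη x
    calc _ ≤ 1 / (2 * lam ^ 2) * (2 * (2 * δ / γ.length)) * γ.length + M * (3 * δ) := by gcongr
      _ = _ := by field_simp
  -- the convolution of the tangent
  have h2 : ∀ x, ‖tangentConv lam γ (γ.arc x) - tangentConv lam η (η.arc x)‖ ≤
      (2 / lam ^ 2 + M) * δ := by
    intro x
    have hp := norm_potential_sub_le hlam γ.measurable_arc η.measurable_arc habs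
      γ.integrable_wderiv η.integrable_wderiv x
    refine hp.trans ?_
    rw [← norm_derivL_sub, ← length, ← hδ, ← hM]
    apply le_of_eq
    field_simp
  have h3 : ∫ x, ‖(field hlam γ - field hlam η).wderiv x‖ ≤
      1 / lam ^ 2 * ((1 + 2 / lam ^ 2 + 3 * M) * δ) := by
    have hd : Integrable fun x => ‖γ.wderiv x - η.wderiv x‖ :=
      (γ.integrable_wderiv.sub η.integrable_wderiv).norm
    have hs : Integrable fun v => |γ.speed v - η.speed v| :=
      (γ.integrable_speed.sub η.integrable_speed).abs
    have hi1 : Integrable fun x => |γ.speed x - η.speed x| * (M * γ.length) := hs.mul_const _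
    have hi2 : Integrable fun x => η.speed x * ((2 / lam ^ 2 + M) * δ) :=
      η.integrable_speed.mul_const _
    have hi : Integrable fun x => 1 / lam ^ 2 * (‖γ.wderiv x - η.wderiv x‖ +
        (|γ.speed x - η.speed x| * (M * γ.length) + η.speed x * ((2 / lam ^ 2 + M) * δ))) :=
      (hd.add (hi1.add hi2)).const_mul _
    calc _ ≤ ∫ x, 1 / lam ^ 2 * (‖γ.wderiv x - η.wderiv x‖ +
        (|γ.speed x - η.speed x| * (M * γ.length) + η.speed x * ((2 / lam ^ 2 + M) * δ))) := by
          refine integral_mono_ae (integrable_wderiv _).norm hi ?_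
          filter_upwards [wderiv_sub (field hlam γ) (field hlam η), field_wderiv hlam γ,
            field_wderiv hlam η] with x e1 e2 e3
          rw [e1, Pi.sub_apply, e2, e3, fieldDeriv, fieldDeriv, ← smul_sub, norm_smul, hcn]
          refine mul_le_mul_of_nonneg_left ?_ hc0
          have h : γ.wderiv x - γ.speed x • tangentConv lam γ (γ.arc x) -
              (η.wderiv x - η.speed x • tangentConv lam η (η.arc x)) =
              (γ.wderiv x - η.wderiv x) - ((γ.speed x - η.speed x) • tangentConv lam γ (γ.arc x) +
                η.speed x • (tangentConv lam γ (γ.arc x) - tangentConv lam η (η.arc x))) := by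
            rw [sub_smul, smul_sub (η.speed x)]; abel
          rw [h]
          refine (norm_sub_le _ _).trans ?_
          gcongr
          refine (norm_add_le _ _).trans (add_le_add ?_ ?_)
          · rw [norm_smul]
            exact mul_le_mul_of_nonneg_left (norm_tangentConv_le hlam γ _) (abs_nonneg _)
          · rw [norm_smul, Real.norm_of_nonneg (η.speed_nonneg x)]
            exact mul_le_mul_of_nonneg_left (h2 x) (η.speed_nonneg x)
      _ = 1 / lam ^ 2 * (δ + ((∫ x, |γ.speed x - η.speed x|) * (M * γ.length) +
            1 * ((2 / lam ^ 2 + M) * δ))) := by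
          have hi3 : Integrable fun x => |γ.speed x - η.speed x| * (M * γ.length) +
            η.speed x * ((2 / lam ^ 2 + M) * δ) := hi1.add hi2
          rw [integral_const_mul, integral_add hd hi3, ← norm_derivL_sub, integral_add hi1 hi2,
            integral_mul_const, integral_mul_const, integral_speed hη]
      _ ≤ 1 / lam ^ 2 * (δ + (2 * δ / γ.length * (M * γ.length) +
            1 * ((2 / lam ^ 2 + M) * δ))) := by
          have := integral_abs_speed_sub_le hγ hη
          gcongr
      _ = _ := by field_simp; ring
  rw [norm_eq_integral_add, fieldLip, ← hM]
  refine (add_le_add h1 h3).trans (le_of_eq ?_)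
  ring

theorem norm_field_le (hlam : 0 < lam) (γ : W11) :
    ‖field hlam γ‖ ≤ fieldLip lam * γ.length := by
  have hK0 := fieldLip_nonneg hlam
  rcases γ.length_nonneg.eq_or_lt with h0 | hL
  · rw [field_eq_zero hlam h0.symm, norm_zero]
    exact mul_nonneg hK0 γ.length_nonneg
  set M := kernelBound lam with hM
  have hM0 : 0 ≤ M := kernelBound_nonneg hlam
  have hc0 : 0 ≤ 1 / lam ^ 2 := by positivity
  have hcn : ‖-(1 / lam ^ 2)‖ = 1 / lam ^ 2 := by rw [norm_neg, Real.norm_of_nonneg hc0]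
  have h1 : ∫ x, ‖(field hlam γ).fn x‖ ≤ 1 / lam ^ 2 * (M * γ.length) := by
    refine integral_norm_le_of_forall ?_
    filter_upwards [field_fn hlam γ, flowField_two (lam := lam) hL] with x e2 e4
    rw [e2, e4, norm_smul, hcn, rep_sub_curveMean hlam hL]
    refine mul_le_mul_of_nonneg_left ((norm_potential_le (norm_perKernel_le hlam)
      (γ.integrable_speed_smul (f := fun v => γ.rep x - γ.rep v)
        (continuous_const.sub γ.rep.continuous)) _).trans ?_) hc0
    exact mul_le_mul_of_nonneg_left (integral_norm_speed_smul_le hL x) hM0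
  have h3 : ∫ x, ‖(field hlam γ).wderiv x‖ ≤ 1 / lam ^ 2 * (γ.length + M * γ.length) := by
    have hi2 : Integrable fun x => γ.speed x * (M * γ.length) := γ.integrable_speed.mul_const _
    calc _ ≤ ∫ x, 1 / lam ^ 2 * (‖γ.wderiv x‖ + γ.speed x * (M * γ.length)) := by
          refine integral_mono_ae (integrable_wderiv _).norm
            ((γ.integrable_wderiv.norm.add hi2).const_mul _) ?_
          filter_upwards [field_wderiv hlam γ] with x e1
          rw [e1, fieldDeriv, norm_smul, hcn]
          refine mul_le_mul_of_nonneg_left ((norm_sub_le _ _).trans ?_) hc0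
          gcongr
          rw [norm_smul, Real.norm_of_nonneg (γ.speed_nonneg x)]
          exact mul_le_mul_of_nonneg_left (norm_tangentConv_le hlam γ _) (γ.speed_nonneg x)
      _ = _ := by
          rw [integral_const_mul, integral_add γ.integrable_wderiv.norm hi2, integral_mul_const,
            integral_speed hL, ← length, one_mul]
  rw [norm_eq_integral_add, fieldLip, ← hM]
  -- `fieldLip` is chosen for differences of curves; here a smaller constant would do
  have h4 : (1 : ℝ) / lam ^ 2 * (1 + 2 * M) ≤ 1 / lam ^ 2 * (1 + 4 / lam ^ 2 + 6 * M) := by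
    have : 0 ≤ 4 / lam ^ 2 := by positivity
    gcongr <;> linarith
  have := mul_le_mul_of_nonneg_right h4 hL.le
  refine (add_le_add h1 h3).trans (le_trans (le_of_eq ?_) this)
  ring

/-- The vector field with exponent `2` is globally Lipschitz, even across curves of length zero. -/
theorem norm_field_sub_le (hlam : 0 < lam) (γ η : W11) :
    ‖field hlam γ - field hlam η‖ ≤ fieldLip lam * ‖derivL γ - derivL η‖ := by
  have key : ∀ γ η : W11, η.length = 0 →
      ‖field hlam γ - field hlam η‖ ≤ fieldLip lam * ‖derivL γ - derivL η‖ := by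
    intro γ η h
    have hη : derivL η = 0 := by rw [← norm_eq_zero, norm_derivL, h]
    rw [field_eq_zero hlam h, hη, sub_zero, sub_zero, norm_derivL]
    exact norm_field_le hlam γ
  rcases η.length_nonneg.eq_or_lt with hη | hη
  · exact key γ η hη.symm
  rcases γ.length_nonneg.eq_or_lt with hγ | hγ
  · rw [norm_sub_rev, norm_sub_rev (derivL γ)]
    exact key η γ hγ.symm
  · exact norm_field_sub_le_of_pos hlam hγ hη

theorem norm_derivL_le (γ : W11) : ‖derivL γ‖ ≤ ‖γ‖ := by
  rw [norm_eq, ← derivL_apply]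
  exact le_add_of_nonneg_left (norm_nonneg _)

theorem lipschitzWith_field (hlam : 0 < lam) :
    LipschitzWith (fieldLip lam).toNNReal (field hlam) := by
  refine LipschitzWith.of_dist_le_mul fun γ η => ?_
  rw [dist_eq_norm, dist_eq_norm, Real.coe_toNNReal _ (fieldLip_nonneg hlam)]
  refine (norm_field_sub_le hlam γ η).trans (mul_le_mul_of_nonneg_left ?_ (fieldLip_nonneg hlam))
  rw [← map_sub]
  exact norm_derivL_le _

end Lipschitz

/-! ### Dissipation of length -/

section Dissipation

/-- The exponential rate at which the flow with exponent `2` shortens curves. -/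
def decayRate (lam : ℝ) : ℝ := 4 / (1 + 8 * lam ^ 2)

theorem decayRate_pos (lam : ℝ) : 0 < decayRate lam := by unfold decayRate; positivity

/-- A backward Euler step never ends on a curve that is longer than its starting curve: the vector
field dissipates length at rate `decayRate lam`. -/
theorem length_dissipation (hlam : 0 < lam) (γ : W11) {h : ℝ} (hh : 0 ≤ h) :
    (1 + decayRate lam * h) * ‖derivL γ‖ ≤ ‖derivL γ - h • derivL (field hlam γ)‖ := by
  rcases γ.length_nonneg.eq_or_lt with h0 | hL
  · rw [norm_derivL, ← h0, mul_zero]; exact norm_nonneg _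
  set L := γ.length with hLdef
  set κ := h / lam ^ 2 with hκ
  have hκ0 : 0 ≤ κ := by positivity
  set T : UnitAddCircle → Plane := fun x => tangentConv lam γ (γ.arc x) with hT
  have hTm : AEStronglyMeasurable T :=
    ((continuous_tangentConv hlam γ).measurable.comp γ.measurable_arc).aestronglyMeasurable
  set Q := ∫ x, ⟪T x, γ.wderiv x⟫ with hQ
  have hQle : (1 + 4 * lam ^ 2) * Q ≤ L ^ 2 := by
    refine energy_perKernel_le hlam γ.integrable_wderiv γ.measurable_arc γ.integral_wderiv
      fun f hf => ?_
    have h1 := integral_speed_smul_comp_arc hL hf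
    rw [← h1, ← integral_const_mul]
    refine integral_congr_ae (ae_of_all _ fun x => ?_)
    simp only [speed, smul_eq_mul, ← hLdef]
    field_simp
  have hTi : Integrable fun x => ⟪T x, γ.wderiv x⟫ := by
    refine (γ.integrable_wderiv.norm.const_mul (kernelBound lam * L)).mono'
      (hTm.inner γ.integrable_wderiv.1) (ae_of_all _ fun x => ?_)
    exact (norm_inner_le_norm _ _).trans
      (mul_le_mul_of_nonneg_right (norm_tangentConv_le hlam γ _) (norm_nonneg _))
  have hstep : ∫ x, ((1 + κ) * ‖γ.wderiv x‖ - κ / L * ⟪T x, γ.wderiv x⟫) ≤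
      ‖derivL γ - h • derivL (field hlam γ)‖ := by
    rw [L1.norm_eq_integral_norm]
    refine integral_mono_ae ((γ.integrable_wderiv.norm.const_mul _).sub (hTi.const_mul _))
      (L1.integrable_coeFn _).norm ?_
    have e1 := Lp.coeFn_sub (derivL γ) (h • derivL (field hlam γ))
    have e2 := Lp.coeFn_smul h (derivL (field hlam γ))
    filter_upwards [e1, e2, field_wderiv hlam γ] with x e1 e2 e3
    rw [e1, Pi.sub_apply, e2, Pi.smul_apply]
    change _ ≤ ‖γ.wderiv x - h • (field hlam γ).wderiv x‖
    have hq : γ.wderiv x - h • (field hlam γ).wderiv x =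
        (1 + κ) • γ.wderiv x - (κ * (‖γ.wderiv x‖ / L)) • T x := by
      rw [e3, fieldDeriv, speed, smul_smul, smul_sub, smul_smul, add_smul, one_smul,
        show h * -(1 / lam ^ 2) = -κ by rw [hκ]; ring, neg_smul, neg_mul, neg_smul]
      abel
    rw [hq]
    rcases eq_or_ne (γ.wderiv x) 0 with hp | hp
    · simp [hp]
    · -- pair with the unit tangent vector
      have hpos : 0 < ‖γ.wderiv x‖ := norm_pos_iff.2 hp
      refine le_of_mul_le_mul_right ?_ hpos
      refine le_trans (le_of_eq ?_) (real_inner_le_norm _ (γ.wderiv x))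
      rw [inner_sub_left, real_inner_smul_left, real_inner_smul_left, real_inner_self_eq_norm_sq]
      ring
  rw [integral_sub (γ.integrable_wderiv.norm.const_mul _) (hTi.const_mul _), integral_const_mul,
    integral_const_mul, ← length, ← hLdef, ← hQ] at hstep
  refine le_trans ?_ hstep
  rw [norm_derivL, ← hLdef]
  have hQ2 : Q ≤ L ^ 2 / (1 + 4 * lam ^ 2) := by
    rw [le_div_iff₀ (by positivity)]; linarith
  have h4 : κ / L * Q ≤ κ / L * (L ^ 2 / (1 + 4 * lam ^ 2)) :=
    mul_le_mul_of_nonneg_left hQ2 (by positivity)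
  have h5 : κ * L - κ / L * (L ^ 2 / (1 + 4 * lam ^ 2)) = h * (4 / (1 + 4 * lam ^ 2)) * L := by
    rw [hκ]; field_simp; ring
  have h6 : decayRate lam ≤ 4 / (1 + 4 * lam ^ 2) := by
    unfold decayRate
    gcongr
    nlinarith [sq_nonneg lam]
  have h7 : decayRate lam * h * L ≤ h * (4 / (1 + 4 * lam ^ 2)) * L := by
    rw [mul_comm (decayRate lam) h]
    gcongr
  linarith

end Dissipation

end W11

/-! ### Globally Lipschitz differential equations -/

section LipschitzODE

open scoped NNReal BoundedContinuousFunction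

variable {E : Type*} [NormedAddCommGroup E] [NormedSpace ℝ E]

theorem integral_exp_weight_le {c : ℝ} (hc : 0 < c) (t : ℝ) :
    |∫ s in (0 : ℝ)..t, Real.exp (c * |s|)| ≤ Real.exp (c * |t|) / c := by
  have hcont : Continuous fun s : ℝ => Real.exp (c * |s|) := by fun_prop
  have hpos : ∀ t : ℝ, 0 ≤ t →
      |∫ s in (0 : ℝ)..t, Real.exp (c * |s|)| ≤ Real.exp (c * |t|) / c := by
    intro t ht
    have h1 : ∫ s in (0 : ℝ)..t, Real.exp (c * |s|) = ∫ s in (0 : ℝ)..t, Real.exp (c * s) := by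
      refine intervalIntegral.integral_congr fun s hs => ?_
      rw [uIcc_of_le ht] at hs
      simp only [abs_of_nonneg hs.1]
    have h2 : ∫ s in (0 : ℝ)..t, Real.exp (c * s) =
        Real.exp (c * t) / c - Real.exp (c * 0) / c := by
      refine intervalIntegral.integral_eq_sub_of_hasDerivAt (f := fun s => Real.exp (c * s) / c)
        (fun s _ => ?_) (Continuous.intervalIntegrable (by fun_prop) _ _)
      have := (((hasDerivAt_id' s).const_mul c).exp).div_const c
      exact this.congr_deriv (by field_simp)
    rw [h1, abs_of_nonneg (intervalIntegral.integral_nonneg ht fun _ _ => (Real.exp_pos _).le), h2,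
      abs_of_nonneg ht]
    have : 0 ≤ Real.exp (c * 0) / c := by positivity
    linarith
  rcases le_total 0 t with ht | ht
  · exact hpos t ht
  · have h := hpos (-t) (by linarith)
    have h3 := intervalIntegral.integral_comp_neg (a := (0 : ℝ)) (b := t)
      (fun s => Real.exp (c * |s|))
    simp only [abs_neg, neg_zero] at h3
    rw [h3, intervalIntegral.integral_symm, abs_neg, ← abs_neg t]
    exact h

/-- A globally Lipschitz autonomous vector field vanishing at the origin has a global solution for
every initial value, as the fixed point of the Picard iteration in the space of continuous
curves of growth at most `exp (c |t|)` with `c` twice the Lipschitz constant. -/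
theorem exists_hasDerivAt_of_lipschitzWith [CompleteSpace E] {F : E → E} {K : ℝ≥0}
    (hF : LipschitzWith K F) (hF0 : F 0 = 0) (x₀ : E) :
    ∃ X : ℝ → E, X 0 = x₀ ∧ ∀ t, HasDerivAt X (F (X t)) t := by
  set c : ℝ := 2 * (K + 1) with hc
  have hK0 : (0 : ℝ) ≤ K := K.2
  have hc0 : 0 < c := by positivity
  have hFc := hF.continuous
  have hFn : ∀ x, ‖F x‖ ≤ K * ‖x‖ := fun x => by
    have := hF.dist_le_mul x 0
    rwa [hF0, dist_zero_right, dist_zero_right] at this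
  set w : ℝ → ℝ := fun t => Real.exp (c * |t|) with hw
  have hwc : Continuous w := by rw [hw]; fun_prop
  have hwpos : ∀ t, 0 < w t := fun t => Real.exp_pos _
  have hw1 : ∀ t, 1 ≤ w t := fun t => Real.one_le_exp (by positivity)
  -- the unweighted curve and its Picard iterate
  let I : (ℝ →ᵇ E) → ℝ → E := fun y t => x₀ + ∫ s in (0 : ℝ)..t, F (w s • y s)
  have hic : ∀ y : ℝ →ᵇ E, Continuous fun s => F (w s • y s) := fun y =>
    hFc.comp (hwc.smul y.continuous)
  have hId : ∀ (y : ℝ →ᵇ E) (t : ℝ), HasDerivAt (I y) (F (w t • y t)) t := fun y t =>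
    ((hic y).integral_hasStrictDerivAt 0 t).hasDerivAt.const_add x₀
  have hIc : ∀ y, Continuous (I y) := fun y =>
    continuous_iff_continuousAt.2 fun t => (hId y t).continuousAt
  have hint : ∀ (g : ℝ → E) (C : ℝ), (∀ s, ‖g s‖ ≤ C * w s) → ∀ t,
      ‖∫ s in (0 : ℝ)..t, g s‖ ≤ C * (w t / c) := by
    intro g C hg t
    have hC0 : 0 ≤ C := by
      have := (norm_nonneg _).trans (hg 0)
      exact nonneg_of_mul_nonneg_left this (hwpos 0)
    have h1 := intervalIntegral.norm_integral_le_abs_of_norm_le (a := (0 : ℝ)) (b := t) (μ := volume)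
      (f := g) (g := fun s => C * w s) (ae_of_all _ hg) ((hwc.const_mul C).intervalIntegrable _ _)
    rw [intervalIntegral.integral_const_mul, abs_mul, abs_of_nonneg hC0] at h1
    exact h1.trans (mul_le_mul_of_nonneg_left (integral_exp_weight_le hc0 t) hC0)
  let T : (ℝ →ᵇ E) → (ℝ →ᵇ E) := fun y =>
    BoundedContinuousFunction.ofNormedAddCommGroup (fun t => (w t)⁻¹ • I y t)
      ((hwc.inv₀ fun t => (hwpos t).ne').smul (hIc y)) (‖x₀‖ + K * ‖y‖ / c) (by
        intro t
        have h1 := hint (fun s => F (w s • y s)) (K * ‖y‖) (fun s => by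
          refine (hFn _).trans ?_
          rw [norm_smul, Real.norm_of_nonneg (hwpos s).le, mul_assoc, mul_comm ‖y‖]
          have := (hwpos s).le
          gcongr
          exact y.norm_coe_le_norm s) t
        have h2 : ‖I y t‖ ≤ w t * (‖x₀‖ + K * ‖y‖ / c) := by
          refine (norm_add_le _ _).trans ?_
          have h3 := mul_le_mul_of_nonneg_right (hw1 t) (norm_nonneg x₀)
          calc _ ≤ w t * ‖x₀‖ + K * ‖y‖ * (w t / c) := by linarith
            _ = _ := by ring
        rw [norm_smul, norm_inv, Real.norm_of_nonneg (hwpos t).le, inv_mul_le_iff₀ (hwpos t)]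
        exact h2)
  have hT : ContractingWith (1 / 2) T := by
    refine ⟨by norm_num, LipschitzWith.of_dist_le_mul fun y z => ?_⟩
    rw [BoundedContinuousFunction.dist_le (by positivity)]
    intro t
    change dist ((w t)⁻¹ • I y t) ((w t)⁻¹ • I z t) ≤ _
    have h1 := hint (fun s => F (w s • y s) - F (w s • z s)) (K * dist y z) (fun s => by
      rw [← dist_eq_norm]
      refine (hF.dist_le_mul _ _).trans ?_
      rw [dist_eq_norm, ← smul_sub, norm_smul, Real.norm_of_nonneg (hwpos s).le, mul_assoc,
        mul_comm (dist y z), ← dist_eq_norm]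
      have := (hwpos s).le
      gcongr
      exact BoundedContinuousFunction.dist_coe_le_dist s) t
    have h2 : I y t - I z t = ∫ s in (0 : ℝ)..t, (F (w s • y s) - F (w s • z s)) := by
      rw [intervalIntegral.integral_sub ((hic y).intervalIntegrable _ _)
        ((hic z).intervalIntegrable _ _)]
      simp only [I]
      abel
    rw [dist_eq_norm, ← smul_sub, norm_smul, norm_inv, Real.norm_of_nonneg (hwpos t).le,
      inv_mul_le_iff₀ (hwpos t), h2]
    refine h1.trans ?_
    have h3 : (K : ℝ) / c ≤ 1 / 2 := by
      rw [hc, div_le_div_iff₀ (by positivity) (by positivity)]; linarith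
    calc K * dist y z * (w t / c) = w t * (K / c * dist y z) := by ring
      _ ≤ w t * (1 / 2 * dist y z) := by
          have := (hwpos t).le
          gcongr
      _ = _ := by norm_num
  obtain ⟨y, hy⟩ : ∃ y, T y = y := ⟨_, hT.fixedPoint_isFixedPt⟩
  have hyI : ∀ t, w t • y t = I y t := by
    intro t
    have h : (w t)⁻¹ • I y t = y t := congrArg (fun z : ℝ →ᵇ E => z t) hy
    rw [← h, smul_smul, mul_inv_cancel₀ (hwpos t).ne', one_smul]
  refine ⟨I y, ?_, fun t => ?_⟩
  · simp only [I, intervalIntegral.integral_same, add_zero]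
  · rw [← hyI]; exact hId y t

/-- Uniqueness for a globally Lipschitz autonomous vector field, on an arbitrary interval. -/
theorem eqOn_of_lipschitzWith {F : E → E} {K : ℝ≥0} (hF : LipschitzWith K F) {J : Set ℝ}
    (hJ : J.OrdConnected) {X Y : ℝ → E} (hX : ∀ t ∈ J, HasDerivWithinAt X (F (X t)) J t)
    (hY : ∀ t ∈ J, HasDerivWithinAt Y (F (Y t)) J t) {t₀ : ℝ} (ht₀ : t₀ ∈ J) (h0 : X t₀ = Y t₀) :
    EqOn X Y J := by
  have hcont : ∀ {Z : ℝ → E}, (∀ t ∈ J, HasDerivWithinAt Z (F (Z t)) J t) → ContinuousOn Z J :=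
    fun hZ t ht => (hZ t ht).continuousWithinAt
  intro t ht
  rcases le_total t₀ t with h | h
  · have hsub : Icc t₀ t ⊆ J := hJ.out ht₀ ht
    have hd : ∀ {Z : ℝ → E}, (∀ t ∈ J, HasDerivWithinAt Z (F (Z t)) J t) →
        ∀ s ∈ Ico t₀ t, HasDerivWithinAt Z (F (Z s)) (Ici s) s := fun hZ s hs =>
      (hZ s (hsub (Ico_subset_Icc_self hs))).mono_of_mem_nhdsWithin <| by
        refine mem_of_superset (Icc_mem_nhdsGE hs.2) fun r hr => hsub ⟨hs.1.trans hr.1, hr.2⟩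
    exact ODE_solution_unique_of_mem_Icc_right (v := fun _ => F) (s := fun _ => univ)
      (fun _ _ => hF.lipschitzOnWith) ((hcont hX).mono hsub) (hd hX) (fun _ _ => mem_univ _)
      ((hcont hY).mono hsub) (hd hY) (fun _ _ => mem_univ _) h0 (right_mem_Icc.2 h)
  · have hsub : Icc t t₀ ⊆ J := hJ.out ht ht₀
    have hd : ∀ {Z : ℝ → E}, (∀ t ∈ J, HasDerivWithinAt Z (F (Z t)) J t) →
        ∀ s ∈ Ioc t t₀, HasDerivWithinAt Z (F (Z s)) (Iic s) s := fun hZ s hs =>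
      (hZ s (hsub (Ioc_subset_Icc_self hs))).mono_of_mem_nhdsWithin <| by
        refine mem_of_superset (Icc_mem_nhdsLE hs.1) fun r hr => hsub ⟨hr.1, hr.2.trans hs.2⟩
    exact ODE_solution_unique_of_mem_Icc_left (v := fun _ => F) (s := fun _ => univ)
      (fun _ _ => hF.lipschitzOnWith) ((hcont hX).mono hsub) (hd hX) (fun _ _ => mem_univ _)
      ((hcont hY).mono hsub) (hd hY) (fun _ _ => mem_univ _) h0 (left_mem_Icc.2 h)

end LipschitzODE

/-! ### Norm decay along dissipative velocities -/

section Dissipative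

variable {E : Type*} [NormedAddCommGroup E] [NormedSpace ℝ E]

/-- Exponential decay along a dissipative velocity field: backward Euler steps of the velocity
control the right Dini derivative of the norm. -/
theorem norm_le_exp_of_dissipative {p v : ℝ → E} {a b c : ℝ}
    (hd : ∀ t ∈ Icc a b, HasDerivWithinAt p (v t) (Icc a b) t) (hv : ContinuousOn v (Icc a b))
    (hdis : ∀ t ∈ Icc a b, ∀ h : ℝ, 0 ≤ h → (1 + c * h) * ‖p t‖ ≤ ‖p t - h • v t‖) :
    ∀ t ∈ Icc a b, ‖p t‖ ≤ ‖p a‖ * Real.exp (-c * (t - a)) := by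
  have hpc : ContinuousOn p (Icc a b) := fun t ht => (hd t ht).continuousWithinAt
  have key := le_gronwallBound_of_liminf_deriv_right_le (f := fun t => ‖p t‖)
    (f' := fun t => -c * ‖p t‖) (δ := ‖p a‖) (K := -c) (ε := 0) (a := a) (b := b) hpc.norm ?_ le_rfl
    (fun t _ => by simp)
  · intro t ht
    have := key t ht
    rwa [gronwallBound_ε0] at this
  · intro x hx r hr
    refine Eventually.frequently ?_
    have hsub : 𝓝[>] x ≤ 𝓝[Icc a b] x := by
      rw [← nhdsWithin_Ioo_eq_nhdsGT hx.2]
      exact nhdsWithin_mono _ fun z hz => ⟨hx.1.trans hz.1.le, hz.2.le⟩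
    have hmem := Ico_subset_Icc_self hx
    -- the quotient is at most this function of `z`, whose limit is `-c ‖p x‖`
    have hlim : Tendsto (fun z => -c * ‖p z‖ + ‖(z - x)⁻¹ • (p z - p x) - v z‖) (𝓝[>] x)
        (𝓝 (-c * ‖p x‖ + ‖v x - v x‖)) := by
      have h1 : Tendsto (fun z => (z - x)⁻¹ • (p z - p x)) (𝓝[>] x) (𝓝 (v x)) := by
        have h2 := hasDerivWithinAt_iff_tendsto_slope.1 (hd x hmem)
        have h3 : 𝓝[>] x ≤ 𝓝[Icc a b \ {x}] x := by
          rw [← nhdsWithin_Ioo_eq_nhdsGT hx.2]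
          exact nhdsWithin_mono _ fun z hz => ⟨⟨hx.1.trans hz.1.le, hz.2.le⟩, hz.1.ne'⟩
        exact h2.mono_left h3
      have h4 : Tendsto v (𝓝[>] x) (𝓝 (v x)) := (hv x hmem).mono_left hsub
      have h5 : Tendsto p (𝓝[>] x) (𝓝 (p x)) := (hpc x hmem).mono_left hsub
      exact (h5.norm.const_mul _).add (h1.sub h4).norm
    rw [sub_self, norm_zero, add_zero] at hlim
    filter_upwards [hlim.eventually (gt_mem_nhds hr), Ioo_mem_nhdsGT hx.2] with z hz hzm
    refine lt_of_le_of_lt ?_ hz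
    have hzx : 0 < z - x := sub_pos.2 hzm.1
    have h6 := hdis z ⟨hx.1.trans hzm.1.le, hzm.2.le⟩ (z - x) hzx.le
    have h7 : p z - (z - x) • v z = p x + (z - x) • ((z - x)⁻¹ • (p z - p x) - v z) := by
      rw [smul_sub, smul_smul, mul_inv_cancel₀ hzx.ne', one_smul]; abel
    have h8 : ‖p z - (z - x) • v z‖ ≤ ‖p x‖ + (z - x) * ‖(z - x)⁻¹ • (p z - p x) - v z‖ := by
      rw [h7]
      refine (norm_add_le _ _).trans ?_
      rw [norm_smul, Real.norm_of_nonneg hzx.le]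
    rw [inv_mul_le_iff₀ hzx]
    linarith

end Dissipative

/-! ### Changes of time -/

section Reparametrisation

/-- The fundamental theorem of calculus within an arbitrary interval. -/
theorem hasDerivWithinAt_integral_of_ordConnected {J : Set ℝ} (hJ : J.OrdConnected) {f : ℝ → ℝ}
    (hf : ContinuousOn f J) {t₀ t : ℝ} (ht₀ : t₀ ∈ J) (ht : t ∈ J) :
    HasDerivWithinAt (fun u => ∫ r in t₀..u, f r) (f t) J t := by
  have hi : ∀ a ∈ J, ∀ b ∈ J, IntervalIntegrable f volume a b := fun a ha b hb =>
    (hf.mono (hJ.uIcc_subset ha hb)).intervalIntegrable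
  rw [hasDerivWithinAt_iff_isLittleO, Asymptotics.isLittleO_iff]
  intro ε hε
  have h1 := Metric.continuousWithinAt_iff.1 (hf t ht) ε hε
  obtain ⟨δ, hδ, h1⟩ := h1
  filter_upwards [inter_mem_nhdsWithin J (Metric.ball_mem_nhds t hδ)] with u hu
  have h2 : (∫ r in t₀..u, f r) - (∫ r in t₀..t, f r) - (u - t) • f t =
      ∫ r in t..u, (f r - f t) := by
    rw [intervalIntegral.integral_sub (hi t ht u hu.1) intervalIntegrable_const,
      intervalIntegral.integral_interval_sub_left (hi _ ht₀ _ hu.1) (hi _ ht₀ _ ht),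
      intervalIntegral.integral_const]
  rw [h2]
  refine intervalIntegral.norm_integral_le_of_norm_le_const fun r hr => ?_
  have hr' := uIoc_subset_uIcc hr
  have h3 := h1 (hJ.uIcc_subset ht hu.1 hr') ?_
  · rw [← dist_eq_norm]; exact h3.le
  · refine lt_of_le_of_lt ?_ (Metric.mem_ball.1 hu.2)
    rw [Real.dist_eq, Real.dist_eq, abs_sub_comm, abs_sub_comm u]
    simpa [abs_sub_comm] using abs_sub_left_of_mem_uIcc hr'

/-- The time change `θ` solving `θ' = 1 / f (θ)`, `θ 0 = 0`, as the inverse of `t ↦ ∫₀ᵗ f`. -/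
theorem exists_time_change {J : Set ℝ} (hJ : J.OrdConnected) (h0 : (0 : ℝ) ∈ J) {f : ℝ → ℝ}
    (hf : ContinuousOn f J) (hpos : ∀ t ∈ J, 0 < f t) :
    ∃ (I : Set ℝ) (θ : ℝ → ℝ), I.OrdConnected ∧ (0 : ℝ) ∈ I ∧ θ 0 = 0 ∧ StrictMonoOn θ I ∧
      BijOn θ I J ∧ (∀ τ ∈ I, HasDerivWithinAt θ (f (θ τ))⁻¹ I τ) ∧
      (∀ τ ∈ I, ∫ r in (0 : ℝ)..(θ τ), f r = τ) ∧
      I = (fun t => ∫ r in (0 : ℝ)..t, f r) '' J := by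
  set σ : ℝ → ℝ := fun t => ∫ r in (0 : ℝ)..t, f r with hσ
  have hd : ∀ t ∈ J, HasDerivWithinAt σ (f t) J t := fun t ht =>
    hasDerivWithinAt_integral_of_ordConnected hJ hf h0 ht
  have hσc : ContinuousOn σ J := fun t ht => (hd t ht).continuousWithinAt
  have hmono : StrictMonoOn σ J := by
    intro s hs t ht hst
    have hi : ∀ a ∈ J, ∀ b ∈ J, IntervalIntegrable f volume a b := fun a ha b hb =>
      (hf.mono (hJ.uIcc_subset ha hb)).intervalIntegrable
    have h1 := intervalIntegral.integral_interval_sub_left (hi 0 h0 t ht) (hi 0 h0 s hs)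
    have h2 : 0 < ∫ r in s..t, f r := intervalIntegral.intervalIntegral_pos_of_pos_on (hi s hs t ht)
      (fun x hx => hpos x (hJ.out hs ht (Ioo_subset_Icc_self hx))) hst
    simp only [hσ]
    linarith
  have hbij : BijOn σ J (σ '' J) := hmono.injOn.bijOn_image
  set θ := Function.invFunOn σ J with hθ
  have hinv : InvOn θ σ J (σ '' J) := hbij.invOn_invFunOn
  have hbij' : BijOn θ (σ '' J) J := hbij.symm hinv.symm
  have hI : (σ '' J).OrdConnected :=
    (hJ.isPreconnected.image σ hσc).ordConnected
  have hσ0 : σ 0 = 0 := by simp [hσ]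
  have hmono' : StrictMonoOn θ (σ '' J) := by
    intro a ha b hb hab
    by_contra hcon
    have := hmono.monotoneOn (hbij'.mapsTo hb) (hbij'.mapsTo ha) (not_lt.1 hcon)
    rw [hinv.2 ha, hinv.2 hb] at this
    linarith
  have hθc : ContinuousOn θ (σ '' J) := by
    have : OrdConnected J := hJ
    have : OrdConnected (σ '' J) := hI
    set e : (σ '' J) ≃o J := (hmono.orderIso σ J).symm with he
    rw [continuousOn_iff_continuous_domRestrict]
    have h2 : (σ '' J).domRestrict θ = fun x => ((e x : J) : ℝ) := by
      ext x
      have hx : σ (e x) = x := congrArg Subtype.val ((hmono.orderIso σ J).apply_symm_apply x)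
      have hmem := (e x).2
      change θ x = _
      rw [← hx, hinv.1 hmem]
    rw [h2]
    exact continuous_subtype_val.comp e.continuous
  refine ⟨σ '' J, θ, hI, ⟨0, h0, hσ0⟩, ?_, hmono', hbij', fun τ hτ => ?_,
    fun τ hτ => hinv.2 hτ, rfl⟩
  · have := hinv.1 h0
    rwa [hσ0] at this
  · have hmem := hbij'.mapsTo hτ
    have hne := (hpos _ hmem).ne'
    have h1 : HasFDerivWithinAt σ
        ((ContinuousLinearEquiv.unitsEquivAut ℝ (Units.mk0 _ hne) : ℝ ≃L[ℝ] ℝ) : ℝ →L[ℝ] ℝ)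
        J (θ τ) := by
      refine (hd _ hmem).hasFDerivWithinAt.congr_fderiv ?_
      ext; simp
    have h2 : Tendsto θ (𝓝[σ '' J] τ) (𝓝[J] (θ τ)) :=
      tendsto_nhdsWithin_iff.2 ⟨hθc τ hτ,
        eventually_mem_nhdsWithin.mono fun x hx => hbij'.mapsTo hx⟩
    have h3 := h1.of_local_left_inverse h2 hτ
      (eventually_mem_nhdsWithin.mono fun x hx => hinv.2 hx)
    refine h3.hasDerivWithinAt.congr_deriv ?_
    simp

end Reparametrisation

/-! ### The vector field with general exponent -/

namespace W11

variable {lam a : ℝ}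

theorem fn_smul (c : ℝ) (γ : W11) : (c • γ).fn =ᵐ[volume] c • γ.fn := Lp.coeFn_smul c γ.1.fst

theorem length_const (c : Plane) : (const c).length = 0 := by
  rw [← norm_derivL]
  exact norm_zero

/-- The vector field `F_{λ,a}` as a map of `W11`: a positive multiple of `field`. -/
def velocity (hlam : 0 < lam) (a : ℝ) (γ : W11) : W11 := γ.length ^ (a - 2) • field hlam γ

theorem velocity_two (hlam : 0 < lam) (γ : W11) : velocity hlam 2 γ = field hlam γ := by
  rw [velocity, sub_self, Real.rpow_zero, one_smul]

theorem velocity_eq_zero (hlam : 0 < lam) {γ : W11} (h : γ.length = 0) : velocity hlam a γ = 0 := by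
  rw [velocity, field_eq_zero hlam h, smul_zero]

theorem velocity_fn (hlam : 0 < lam) (a : ℝ) (γ : W11) :
    (velocity hlam a γ).fn =ᵐ[volume] flowField lam a γ := by
  by_cases h : γ.length = 0
  · rw [velocity_eq_zero hlam h]
    have h0 : (0 : W11).fn =ᵐ[volume] 0 := Lp.coeFn_zero _ _ _
    filter_upwards [h0] with x hx
    rw [hx, flowField, if_neg (not_not.2 h), Pi.zero_apply]
  · filter_upwards [fn_smul (γ.length ^ (a - 2)) (field hlam γ), field_fn hlam γ] with x h1 h2
    rw [velocity, h1, Pi.smul_apply, h2, flowField, flowField, if_pos h, if_pos h, lengthGradient,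
      lengthGradient, sub_self, Real.rpow_zero, smul_neg, smul_smul]
    congr 2
    ring

end W11

open W11

/-! ### Gradient flows and their uniqueness -/

section Flow

variable {lam a : ℝ} {I J : Set ℝ} {X Y : ℝ → W11}

theorem isGradientFlow_iff (hlam : 0 < lam) :
    IsGradientFlow lam a I X ↔ ContinuousOn (fun t => velocity hlam a (X t)) I ∧
      ∀ t ∈ I, HasDerivWithinAt X (velocity hlam a (X t)) I t := by
  constructor
  · rintro ⟨V, hV, h⟩
    have hVX : ∀ t ∈ I, velocity hlam a (X t) = V t := fun t ht =>
      ext_fn ((velocity_fn hlam a (X t)).trans (h t ht).2.symm)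
    exact ⟨hV.congr hVX, fun t ht => hVX t ht ▸ (h t ht).1⟩
  · rintro ⟨hV, h⟩
    exact ⟨_, hV, fun t ht => ⟨h t ht, velocity_fn hlam a (X t)⟩⟩

theorem IsGradientFlow.continuousOn (h : IsGradientFlow lam a I X) : ContinuousOn X I :=
  fun t ht => (h.choose_spec.2 t ht).1.continuousWithinAt

theorem IsGradientFlow.mono (h : IsGradientFlow lam a I X) (hJ : J ⊆ I) :
    IsGradientFlow lam a J X := by
  obtain ⟨V, hV, h⟩ := h
  exact ⟨V, hV.mono hJ, fun t ht => ⟨(h t (hJ ht)).1.mono hJ, (h t (hJ ht)).2⟩⟩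

theorem isGradientFlow_two_iff (hlam : 0 < lam) :
    IsGradientFlow lam 2 I X ↔ ∀ t ∈ I, HasDerivWithinAt X (field hlam (X t)) I t := by
  rw [isGradientFlow_iff hlam]
  simp only [velocity_two]
  refine ⟨fun h => h.2, fun h => ⟨?_, h⟩⟩
  exact (lipschitzWith_field hlam).continuous.comp_continuousOn
    fun t ht => (h t ht).continuousWithinAt

theorem continuousOn_length_rpow (hX : ContinuousOn X I) (hpos : ∀ t ∈ I, 0 < (X t).length)
    (b : ℝ) :
    ContinuousOn (fun t => (X t).length ^ b) I :=
  (continuous_length.comp_continuousOn hX).rpow_const fun t ht => Or.inl (hpos t ht).ne'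

/-- Along a flow of positive length the time change `θ' = 𝓛 ^ (b - a)` turns the exponent `a` into
the exponent `b`. -/
theorem IsGradientFlow.comp_time_change (hlam : 0 < lam) {b : ℝ} (h : IsGradientFlow lam a J X)
    (hpos : ∀ t ∈ J, 0 < (X t).length) {θ : ℝ → ℝ} (hmaps : MapsTo θ I J)
    (hθ : ∀ τ ∈ I, HasDerivWithinAt θ ((X (θ τ)).length ^ (b - a)) I τ) :
    IsGradientFlow lam b I (X ∘ θ) := by
  have hX := ((isGradientFlow_iff hlam).1 h).2
  have hd : ∀ τ ∈ I, HasDerivWithinAt (X ∘ θ) (velocity hlam b (X (θ τ))) I τ := by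
    intro τ hτ
    have h1 := (hX _ (hmaps hτ)).scomp τ (hθ τ hτ) hmaps
    refine h1.congr_deriv ?_
    rw [velocity, velocity, smul_smul, ← Real.rpow_add (hpos _ (hmaps hτ))]
    congr 2
    ring
  refine (isGradientFlow_iff hlam).2 ⟨?_, hd⟩
  have hc : ContinuousOn (X ∘ θ) I := fun τ hτ => (hd τ hτ).continuousWithinAt
  exact (continuousOn_length_rpow hc (fun τ hτ => hpos _ (hmaps hτ)) _).smul
    ((lipschitzWith_field hlam).continuous.comp_continuousOn hc)

/-- Every flow of positive length with exponent `a` is reparametrised to exponent `b` by the inverse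
`θ` of the clock `t ↦ ∫₀ᵗ 𝓛(X)^(a-b)`. -/
theorem IsGradientFlow.exists_time_change (hlam : 0 < lam) (h : IsGradientFlow lam a J X)
    (hJ : J.OrdConnected) (h0 : (0 : ℝ) ∈ J) (hpos : ∀ t ∈ J, 0 < (X t).length) (b : ℝ) :
    ∃ (I : Set ℝ) (θ : ℝ → ℝ), I.OrdConnected ∧ (0 : ℝ) ∈ I ∧ θ 0 = 0 ∧ StrictMonoOn θ I ∧
      BijOn θ I J ∧ (∀ τ ∈ I, HasDerivWithinAt θ ((X (θ τ)).length ^ (b - a)) I τ) ∧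
      IsGradientFlow lam b I (X ∘ θ) ∧
      (∀ τ ∈ I, ∫ r in (0 : ℝ)..θ τ, (X r).length ^ (a - b) = τ) ∧
      I = (fun t => ∫ r in (0 : ℝ)..t, (X r).length ^ (a - b)) '' J := by
  obtain ⟨I, θ, hI, h0I, hθ0, hmono, hbij, hθ, hinv, himage⟩ := _root_.exists_time_change hJ h0
    (continuousOn_length_rpow h.continuousOn hpos (a - b)) fun t ht =>
      Real.rpow_pos_of_pos (hpos t ht) _
  have hθ' : ∀ τ ∈ I, HasDerivWithinAt θ ((X (θ τ)).length ^ (b - a)) I τ := fun τ hτ => by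
    refine (hθ τ hτ).congr_deriv ?_
    rw [← Real.rpow_neg (length_nonneg _), neg_sub]
  exact ⟨I, θ, hI, h0I, hθ0, hmono, hbij, hθ', h.comp_time_change hlam hpos hbij.mapsTo hθ', hinv,
    himage⟩

theorem derivL_velocity (hlam : 0 < lam) (γ : W11) :
    derivL (velocity hlam a γ) = γ.length ^ (a - 2) • derivL (field hlam γ) := by
  rw [velocity, map_smul]

/-- The length is nonincreasing for every exponent: a backward Euler step of length `k` along
`F_{λ,a}` is one of length `k 𝓛^(a-2)` along `F_{λ,2}`. -/
theorem IsGradientFlow.length_le (hlam : 0 < lam) (hJ : J.OrdConnected)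
    (h : IsGradientFlow lam a J X) {s t : ℝ} (hs : s ∈ J) (ht : t ∈ J) (hst : s ≤ t) :
    (X t).length ≤ (X s).length := by
  obtain ⟨hV, hX⟩ := (isGradientFlow_iff hlam).1 (h.mono (hJ.out hs ht))
  have := norm_le_exp_of_dissipative (p := fun t => derivL (X t))
    (v := fun t => derivL (velocity hlam a (X t))) (a := s) (b := t) (c := 0)
    (fun r hr => derivL.hasFDerivAt.comp_hasDerivWithinAt r (hX r hr))
    (derivL.continuous.comp_continuousOn hV) (fun r _ k hk => by
      have hL : 0 ≤ (X r).length ^ (a - 2) := Real.rpow_nonneg (length_nonneg _) _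
      have h1 := length_dissipation hlam (X r) (mul_nonneg hk hL)
      rw [derivL_velocity, smul_smul]
      refine le_trans ?_ h1
      have := mul_nonneg (mul_nonneg (decayRate_pos lam).le (mul_nonneg hk hL))
        (norm_nonneg (derivL (X r)))
      linarith) t (right_mem_Icc.2 hst)
  simpa only [norm_derivL, neg_zero, zero_mul, Real.exp_zero, mul_one] using this

theorem IsGradientFlow.length_le_exp (hlam : 0 < lam) (hJ : J.OrdConnected)
    (h : IsGradientFlow lam 2 J X) {s t : ℝ} (hs : s ∈ J) (ht : t ∈ J) (hst : s ≤ t) :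
    (X t).length ≤ (X s).length * Real.exp (-decayRate lam * (t - s)) := by
  have hX := (isGradientFlow_two_iff hlam).1 (h.mono (hJ.out hs ht))
  have hc := (h.mono (hJ.out hs ht)).continuousOn
  have := norm_le_exp_of_dissipative (p := fun t => derivL (X t))
    (v := fun t => derivL (field hlam (X t))) (a := s) (b := t) (c := decayRate lam)
    (fun r hr => derivL.hasFDerivAt.comp_hasDerivWithinAt r (hX r hr))
    (derivL.continuous.comp_continuousOn
      ((lipschitzWith_field hlam).continuous.comp_continuousOn hc))
    (fun r _ k hk => length_dissipation hlam (X r) hk) t (right_mem_Icc.2 hst)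
  simpa only [norm_derivL] using this

theorem IsGradientFlow.eqOn (hlam : 0 < lam) (hJ : J.OrdConnected) (hX : IsGradientFlow lam 2 J X)
    (hY : IsGradientFlow lam 2 J Y) {t : ℝ} (ht : t ∈ J) (h : X t = Y t) : EqOn X Y J :=
  eqOn_of_lipschitzWith (lipschitzWith_field hlam) hJ ((isGradientFlow_two_iff hlam).1 hX)
    ((isGradientFlow_two_iff hlam).1 hY) ht h

/-- The flow with exponent `2` exists for all positive and negative times. Its length cannot vanish,
since constant curves are equilibria of a Lipschitz field. -/
theorem exists_isGradientFlow_univ (hlam : 0 < lam) {X₀ : W11} (hX₀ : 0 < X₀.length) :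
    ∃ Y : ℝ → W11, Y 0 = X₀ ∧ IsGradientFlow lam 2 univ Y ∧ ∀ t, 0 < (Y t).length := by
  have h0 : (0 : W11).length = 0 := by rw [← norm_derivL, map_zero, norm_zero]
  obtain ⟨Y, hY0, hY⟩ := exists_hasDerivAt_of_lipschitzWith (lipschitzWith_field hlam)
    (field_eq_zero hlam h0) X₀
  have hflow : IsGradientFlow lam 2 univ Y :=
    (isGradientFlow_two_iff hlam).2 fun t _ => (hY t).hasDerivWithinAt
  refine ⟨Y, hY0, hflow, fun t => (length_nonneg _).lt_of_ne fun hz => ?_⟩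
  have hconst : IsGradientFlow lam 2 univ fun _ => Y t :=
    (isGradientFlow_two_iff hlam).2 fun s _ => by
      rw [field_eq_zero hlam hz.symm]
      exact hasDerivWithinAt_const _ _ _
  have := hflow.eqOn hlam ordConnected_univ hconst (mem_univ t) rfl (mem_univ 0)
  rw [← hY0, this, ← hz] at hX₀
  exact lt_irrefl _ hX₀

theorem eqOn_of_hasDerivWithinAt_eq {f g f' : ℝ → ℝ} (hI : I.OrdConnected)
    (hf : ∀ t ∈ I, HasDerivWithinAt f (f' t) I t) (hg : ∀ t ∈ I, HasDerivWithinAt g (f' t) I t)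
    {s : ℝ} (hs : s ∈ I) (h : f s = g s) : EqOn f g I := by
  intro t ht
  have h1 := hI.convex.norm_image_sub_le_of_norm_hasDerivWithin_le (f := f - g)
    (f' := fun t => f' t - f' t) (C := 0) (fun x hx => (hf x hx).sub (hg x hx)) (fun x _ => by simp)
    hs ht
  simp only [Pi.sub_apply, h, sub_self, sub_zero, zero_mul, norm_le_zero_iff] at h1
  exact sub_eq_zero.1 h1

/-- Every flow of positive length is a time change of the global flow `Y` with exponent `2`. -/
theorem IsGradientFlow.exists_eq_of_pos (hlam : 0 < lam) (hX : IsGradientFlow lam a J X)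
    (hJ : J.OrdConnected) (h0 : (0 : ℝ) ∈ J) (hY : IsGradientFlow lam 2 univ Y) (hXY : X 0 = Y 0)
    (hpos : ∀ t ∈ J, 0 < (X t).length) (hYpos : ∀ t, 0 < (Y t).length) {t : ℝ} (ht : t ∈ J) :
    ∃ τ, ∫ r in (0 : ℝ)..τ, (Y r).length ^ (2 - a) = t ∧ X t = Y τ := by
  obtain ⟨I, θ, hI, h0I, hθ0, -, hbij, hθ', hflow, -, -⟩ := hX.exists_time_change hlam hJ h0 hpos 2
  have heq : EqOn (X ∘ θ) Y I := hflow.eqOn hlam hI (hY.mono (subset_univ _)) h0I (by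
    rw [Function.comp_apply, hθ0, hXY])
  obtain ⟨τ, hτ, rfl⟩ := hbij.surjOn ht
  have hc := continuousOn_length_rpow hY.continuousOn (fun t _ => hYpos t) (2 - a)
  refine ⟨τ, ?_, heq hτ⟩
  refine eqOn_of_hasDerivWithinAt_eq (f' := fun τ => (Y τ).length ^ (2 - a)) hI (fun s _ =>
    (hasDerivWithinAt_integral_of_ordConnected ordConnected_univ hc (mem_univ 0)
      (mem_univ s)).mono (subset_univ _)) (fun s hs => ?_) h0I ?_ hτ
  · rw [← heq hs]; exact hθ' s hs
  · rw [intervalIntegral.integral_same, hθ0]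

/-- Flows with exponent `a` are unique as long as the time change `θ` of the global flow `Y` with
exponent `2` is defined; in particular their length cannot vanish earlier. -/
theorem IsGradientFlow.eqOn_comp (hlam : 0 < lam) (hX : IsGradientFlow lam a J X)
    (hJ : J.OrdConnected) (h0 : (0 : ℝ) ∈ J) (hY : IsGradientFlow lam 2 univ Y) (hXY : X 0 = Y 0)
    (hYpos : ∀ t, 0 < (Y t).length) {θ : ℝ → ℝ} (hI : I.OrdConnected) (h0I : (0 : ℝ) ∈ I)
    (hθc : ContinuousOn θ I) (hbij : BijOn θ I univ)
    (hθ : ∀ t ∈ I, ∫ r in (0 : ℝ)..θ t, (Y r).length ^ (2 - a) = t) :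
    EqOn X (Y ∘ θ) (J ∩ I) := by
  have key : ∀ {K : Set ℝ}, K.OrdConnected → (0 : ℝ) ∈ K → K ⊆ J → (∀ t ∈ K, 0 < (X t).length) →
      ∀ t ∈ K, X t = Y (θ t) := by
    intro K hK h0K hKJ hpos t ht
    obtain ⟨τ, h1, h2⟩ := (hX.mono hKJ).exists_eq_of_pos hlam hK h0K hY hXY hpos hYpos ht
    obtain ⟨r, hr, rfl⟩ := hbij.surjOn (mem_univ τ)
    rw [hθ r hr] at h1
    rw [h2, h1]
  rintro t ⟨htJ, htI⟩
  rcases le_total t 0 with htn | htn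
  · refine key (K := Icc t 0) ordConnected_Icc (right_mem_Icc.2 htn) (hJ.out htJ h0)
      (fun s hs => ?_) t (left_mem_Icc.2 htn)
    have := hX.length_le hlam hJ (hJ.out htJ h0 hs) h0 hs.2
    rw [hXY] at this
    exact (hYpos 0).trans_le this
  have hsubJ : Icc 0 t ⊆ J := hJ.out h0 htJ
  have hsubI : Icc 0 t ⊆ I := hI.out h0I htI
  refine key (K := Icc 0 t) ordConnected_Icc (left_mem_Icc.2 htn) hsubJ ?_ t (right_mem_Icc.2 htn)
  by_contra! hcon
  -- the first zero of the length
  have hcont : ContinuousOn (fun s => (X s).length) (Icc 0 t) :=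
    continuous_length.comp_continuousOn (hX.continuousOn.mono hsubJ)
  have hcomp : IsCompact (Icc 0 t ∩ (fun s => (X s).length) ⁻¹' Iic 0) :=
    isCompact_Icc.of_isClosed_subset (hcont.preimage_isClosed_of_isClosed isClosed_Icc isClosed_Iic)
      inter_subset_left
  obtain ⟨s, ⟨hs, hs0⟩, hmin⟩ := hcomp.exists_isLeast hcon
  have hpos : ∀ r ∈ Ico 0 s, 0 < (X r).length := fun r hr => by
    by_contra hr0
    exact absurd (hmin ⟨⟨hr.1, hr.2.le.trans hs.2⟩, not_lt.1 hr0⟩) (not_le.2 hr.2)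
  have hs_pos : 0 < s := hs.1.lt_of_ne fun h => by
    rw [← h, mem_preimage, hXY] at hs0
    exact absurd (hYpos 0) (not_lt.2 hs0)
  have hico : Ico 0 s ⊆ Icc 0 t := fun r hr => ⟨hr.1, hr.2.le.trans hs.2⟩
  have heq := key ordConnected_Ico ⟨le_rfl, hs_pos⟩ (hico.trans hsubJ) hpos
  have hne : (𝓝[Ico 0 s] s).NeBot := by
    rw [← mem_closure_iff_nhdsWithin_neBot, closure_Ico hs_pos.ne]
    exact right_mem_Icc.2 hs_pos.le
  have h1 : Tendsto X (𝓝[Ico 0 s] s) (𝓝 (X s)) :=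
    (hX.continuousOn s (hsubJ hs)).mono_left (nhdsWithin_mono _ (hico.trans hsubJ))
  have h2 : Tendsto (Y ∘ θ) (𝓝[Ico 0 s] s) (𝓝 (Y (θ s))) :=
    ((hY.continuousOn.comp hθc (mapsTo_univ _ _)) s (hsubI hs)).mono_left
      (nhdsWithin_mono _ (hico.trans hsubI))
  have h3 := tendsto_nhds_unique h1 (h2.congr'
    (eventually_mem_nhdsWithin.mono fun r hr => (heq r hr).symm))
  rw [mem_preimage, h3] at hs0
  exact absurd (hYpos _) (not_lt.2 hs0)

/-- The speed of the flow with exponent `2` decays exponentially, so the flow converges; the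
limit has length zero. -/
theorem IsGradientFlow.exists_tendsto_const (hlam : 0 < lam) (hY : IsGradientFlow lam 2 univ Y) :
    ∃ c : Plane, Tendsto Y atTop (𝓝 (const c)) := by
  have hd : ∀ t, HasDerivAt Y (field hlam (Y t)) t := fun t =>
    ((isGradientFlow_two_iff hlam).1 hY t (mem_univ t)).hasDerivAt univ_mem
  have hlen : ∀ t, 0 ≤ t → (Y t).length ≤ (Y 0).length * Real.exp (-decayRate lam * t) := by
    intro t ht
    have := hY.length_le_exp hlam ordConnected_univ (mem_univ 0) (mem_univ t) ht
    rwa [sub_zero] at this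
  have hYc : Continuous Y := continuous_iff_continuousAt.2 fun t => (hd t).continuousAt
  have : SecondCountableTopologyEither ℝ W11 := secondCountableTopologyEither_of_left ℝ W11
  have hint : IntegrableOn (fun t => field hlam (Y t)) (Ioi 0) := by
    refine Integrable.mono' (((integrableOn_exp_mul_Ioi (neg_neg_of_pos (decayRate_pos lam))
      0).const_mul (Y 0).length).const_mul (fieldLip lam))
      ((lipschitzWith_field hlam).continuous.comp hYc).aestronglyMeasurable ?_
    refine (ae_restrict_iff' measurableSet_Ioi).2 (ae_of_all _ fun t ht => ?_)
    exact (norm_field_le hlam (Y t)).trans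
      (mul_le_mul_of_nonneg_left (hlen t (le_of_lt ht)) (fieldLip_nonneg hlam))
  have hlim := tendsto_limUnder_of_hasDerivAt_of_integrableOn_Ioi (a := 0) (fun t _ => hd t) hint
  have hzero : (limUnder atTop Y).length = 0 := by
    have h1 : Tendsto (fun t => (Y t).length) atTop (𝓝 (limUnder atTop Y).length) :=
      (continuous_length.tendsto _).comp hlim
    have h2 : Tendsto (fun t => (Y 0).length * Real.exp (-decayRate lam * t)) atTop (𝓝 0) := by
      have h3 : Tendsto (fun t => -decayRate lam * t) atTop atBot :=
        tendsto_id.const_mul_atTop_of_neg (neg_neg_of_pos (decayRate_pos lam))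
      simpa using (Real.tendsto_exp_atBot.comp h3).const_mul (Y 0).length
    refine tendsto_nhds_unique h1 (squeeze_zero'
      (Eventually.of_forall fun _ => length_nonneg _) ?_ h2)
    filter_upwards [eventually_ge_atTop 0] with t ht using hlen t ht
  obtain ⟨c, hc⟩ := eq_const_of_length_eq_zero hzero
  exact ⟨c, hc ▸ hlim⟩

theorem convergesToPoint_of_tendsto {l : Filter ℝ} {c : Plane} (h : Tendsto X l (𝓝 (const c))) :
    ConvergesToPoint X l c := by
  refine ⟨h, fun t => (X t).rep, fun t => (X t).rep_ae_eq, ?_⟩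
  rw [Metric.tendstoUniformly_iff]
  intro ε hε
  filter_upwards [Metric.tendsto_nhds.1 h ε hε] with t ht x
  rw [dist_comm, dist_eq_norm]
  rw [dist_eq_norm] at ht
  exact (norm_rep_sub_const_le _ c x).trans_lt ht

/-- Once the length vanishes it stays zero, and so does the velocity. -/
theorem IsGradientFlow.eq_of_length_eq_zero (hlam : 0 < lam) (hJ : J.OrdConnected)
    (hX : IsGradientFlow lam a J X) {s t : ℝ} (hs : s ∈ J) (ht : t ∈ J) (hst : s ≤ t)
    (h : (X s).length = 0) : X t = X s := by
  have hsub := hJ.out hs ht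
  have hd := ((isGradientFlow_iff hlam).1 (hX.mono hsub)).2
  have h0 : ∀ r ∈ Icc s t, velocity hlam a (X r) = 0 := fun r hr =>
    velocity_eq_zero hlam (le_antisymm ((hX.length_le hlam hJ hs (hsub hr) hr.1).trans h.le)
      (length_nonneg _))
  have := (convex_Icc s t).norm_image_sub_le_of_norm_hasDerivWithin_le (C := 0) hd
    (fun r hr => by rw [h0 r hr, norm_zero]) (left_mem_Icc.2 hst) (right_mem_Icc.2 hst)
  rw [zero_mul, norm_le_zero_iff] at this
  exact sub_eq_zero.1 this

end Flow

/-! ### Maximal flows and collapse to a point -/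

section TimeChange

variable {lam a : ℝ} {Y : ℝ → W11}

/-- The maximal flow with exponent `a`, as a time change `θ` of the global flow with exponent `2`:
`θ` is the inverse of the clock `τ ↦ ∫₀^τ 𝓛(Y)^(2-a)`, whose range `I` is the maximal interval. -/
theorem exists_maximal_time_change (hlam : 0 < lam) (a : ℝ) (hY : IsGradientFlow lam 2 univ Y)
    (hYpos : ∀ t, 0 < (Y t).length) :
    ∃ (I : Set ℝ) (θ : ℝ → ℝ), I.OrdConnected ∧ (0 : ℝ) ∈ I ∧ θ 0 = 0 ∧ StrictMonoOn θ I ∧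
      BijOn θ I univ ∧ ContinuousOn θ I ∧
      (∀ t ∈ I, ∫ r in (0 : ℝ)..θ t, (Y r).length ^ (2 - a) = t) ∧
      I = range (fun τ => ∫ r in (0 : ℝ)..τ, (Y r).length ^ (2 - a)) ∧
      IsGradientFlow lam a I (Y ∘ θ) := by
  obtain ⟨I, θ, hI, h0I, hθ0, hmono, hbij, hθ, hflow, hinv, himage⟩ :=
    hY.exists_time_change hlam ordConnected_univ (mem_univ 0) (fun t _ => hYpos t) a
  exact ⟨I, θ, hI, h0I, hθ0, hmono, hbij, fun t ht => (hθ t ht).continuousWithinAt, hinv,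
    himage.trans image_univ, hflow⟩

/-- An interval mapped increasingly onto the whole line contains none of its end points. -/
theorem exists_lt_mem_of_bijOn {I : Set ℝ} {θ : ℝ → ℝ} (hmono : StrictMonoOn θ I)
    (hbij : BijOn θ I univ) {t : ℝ} (ht : t ∈ I) : (∃ s ∈ I, s < t) ∧ ∃ s ∈ I, t < s := by
  constructor
  · obtain ⟨s, hs, h⟩ := hbij.surjOn (mem_univ (θ t - 1))
    exact ⟨s, hs, (hmono.lt_iff_lt hs ht).1 (by linarith)⟩
  · obtain ⟨s, hs, h⟩ := hbij.surjOn (mem_univ (θ t + 1))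
    exact ⟨s, hs, (hmono.lt_iff_lt ht hs).1 (by linarith)⟩

/-- For `a < 2` the clock stays bounded, by the exponential decay of the length. -/
theorem integral_length_rpow_le (hlam : 0 < lam) (hY : IsGradientFlow lam 2 univ Y)
    (hYpos : ∀ t, 0 < (Y t).length) (ha : a < 2) {s : ℝ} (hs : 0 ≤ s) :
    ∫ r in (0 : ℝ)..s, (Y r).length ^ (2 - a) ≤
      (Y 0).length ^ (2 - a) / (decayRate lam * (2 - a)) := by
  set k := decayRate lam * (2 - a) with hk
  have hk0 : 0 < k := mul_pos (decayRate_pos lam) (sub_pos.2 ha)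
  have hle : ∀ r ∈ Icc 0 s, (Y r).length ^ (2 - a) ≤
      (Y 0).length ^ (2 - a) * Real.exp (-k * r) := by
    intro r hr
    have h1 := hY.length_le_exp hlam ordConnected_univ (mem_univ 0) (mem_univ r) hr.1
    have h2 := Real.rpow_le_rpow (length_nonneg _) h1 (sub_pos.2 ha).le
    refine h2.trans_eq ?_
    rw [Real.mul_rpow (length_nonneg _) (Real.exp_pos _).le, ← Real.exp_mul, hk]
    congr 2
    ring
  have hc : Continuous fun r => (Y r).length ^ (2 - a) := continuousOn_univ.1
    (continuousOn_length_rpow hY.continuousOn (fun t _ => hYpos t) (2 - a))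
  have hce : Continuous fun r => (Y 0).length ^ (2 - a) * Real.exp (-k * r) := by fun_prop
  refine (intervalIntegral.integral_mono_on hs (hc.intervalIntegrable _ _)
    (hce.intervalIntegrable _ _) hle).trans ?_
  have h3 : ∫ r in (0 : ℝ)..s, (Y 0).length ^ (2 - a) * Real.exp (-k * r) =
      -((Y 0).length ^ (2 - a) / k * Real.exp (-k * s)) -
        -((Y 0).length ^ (2 - a) / k * Real.exp (-k * 0)) := by
    refine intervalIntegral.integral_eq_sub_of_hasDerivAt
      (f := fun r => -((Y 0).length ^ (2 - a) / k * Real.exp (-k * r))) (fun r _ => ?_)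
      (hce.intervalIntegrable _ _)
    have := ((((hasDerivAt_id' r).const_mul (-k)).exp).const_mul
      ((Y 0).length ^ (2 - a) / k)).fun_neg
    exact this.congr_deriv (by field_simp)
  rw [h3, mul_zero, Real.exp_zero, mul_one]
  have : 0 ≤ (Y 0).length ^ (2 - a) / k * Real.exp (-k * s) :=
    mul_nonneg (div_nonneg (Real.rpow_nonneg (length_nonneg _) _) hk0.le) (Real.exp_pos _).le
  linarith

/-- For `2 ≤ a` the clock runs at least linearly, since the length decreases. -/
theorem le_integral_length_rpow (hlam : 0 < lam) (hY : IsGradientFlow lam 2 univ Y)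
    (hYpos : ∀ t, 0 < (Y t).length) (ha : 2 ≤ a) {s : ℝ} (hs : 0 ≤ s) :
    s * (Y 0).length ^ (2 - a) ≤ ∫ r in (0 : ℝ)..s, (Y r).length ^ (2 - a) := by
  have hc : Continuous fun r => (Y r).length ^ (2 - a) := continuousOn_univ.1
    (continuousOn_length_rpow hY.continuousOn (fun t _ => hYpos t) (2 - a))
  have h := intervalIntegral.integral_mono_on (f := fun _ => (Y 0).length ^ (2 - a)) hs
    (intervalIntegrable_const (μ := volume)) (hc.intervalIntegrable _ _) fun r hr =>
      Real.rpow_le_rpow_of_nonpos (hYpos r)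
        (hY.length_le hlam ordConnected_univ (mem_univ 0) (mem_univ r) hr.1) (sub_nonpos.2 ha)
  rwa [intervalIntegral.integral_const, sub_zero, smul_eq_mul] at h

/-- Collapse in finite time for `a < 2`: the clock of the flow with exponent `2` has a finite limit
`T`, so that the time change traverses the whole global flow before `T`. -/
theorem exists_collapse_of_lt_two (hlam : 0 < lam) (hY : IsGradientFlow lam 2 univ Y)
    (hYpos : ∀ t, 0 < (Y t).length) {c : Plane} (hc : Tendsto Y atTop (𝓝 (const c))) (ha : a < 2) :
    ∃ (T : ℝ) (X : ℝ → W11), 0 < T ∧ IsGradientFlow lam a (Ico 0 T) X ∧ X 0 = Y 0 ∧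
      (∀ t ∈ Ico 0 T, 0 < (X t).length) ∧ ConvergesToPoint X (𝓝[<] T) c ∧
      ∀ (J : Set ℝ) (X' : ℝ → W11), J.OrdConnected → (0 : ℝ) ∈ J →
        IsGradientFlow lam a J X' → X' 0 = Y 0 →
        EqOn X' X (J ∩ Ico 0 T) ∧ ∀ t ∈ J, T ≤ t → X' t = const c := by
  obtain ⟨I, θ, hI, h0I, hθ0, hmono, hbij, hθc, hinv, -, hflow⟩ :=
    exists_maximal_time_change hlam a hY hYpos
  have hbdd : BddAbove I := by
    refine ⟨max 0 ((Y 0).length ^ (2 - a) / (decayRate lam * (2 - a))), fun t ht => ?_⟩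
    rcases le_total t 0 with h | h
    · exact h.trans (le_max_left _ _)
    · refine le_max_of_le_right ?_
      have h1 : 0 ≤ θ t := hθ0 ▸ hmono.monotoneOn h0I ht h
      simpa only [hinv t ht] using integral_length_rpow_le hlam hY hYpos ha h1
  set T := sSup I with hT
  have hlt : ∀ t ∈ I, t < T := fun t ht => by
    obtain ⟨s, hs, hts⟩ := (exists_lt_mem_of_bijOn hmono hbij ht).2
    exact hts.trans_le (le_csSup hbdd hs)
  have hT0 : 0 < T := hlt 0 h0I
  have hsub : Ico 0 T ⊆ I := fun t ht => by
    obtain ⟨s, hs, hts⟩ := exists_lt_of_lt_csSup ⟨0, h0I⟩ ht.2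
    exact hI.out h0I hs ⟨ht.1, hts.le⟩
  have hθlim : Tendsto θ (𝓝[<] T) atTop := by
    refine tendsto_atTop.2 fun N => ?_
    obtain ⟨s, hs, h⟩ := hbij.surjOn (mem_univ N)
    have hmem : Ioo (max s 0) T ∈ 𝓝[<] T := Ioo_mem_nhdsLT (max_lt (hlt s hs) hT0)
    filter_upwards [hmem] with t ht
    rw [← h]
    exact hmono.monotoneOn hs (hsub ⟨(le_max_right _ _).trans ht.1.le, ht.2⟩)
      ((le_max_left _ _).trans ht.1.le)
  have hXlim : Tendsto (Y ∘ θ) (𝓝[<] T) (𝓝 (const c)) := hc.comp hθlim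
  refine ⟨T, Y ∘ θ, hT0, hflow.mono hsub, by rw [Function.comp_apply, hθ0], fun t _ => hYpos _,
    convergesToPoint_of_tendsto hXlim, fun J X' hJ h0 hX' h => ?_⟩
  have heq : EqOn X' (Y ∘ θ) (J ∩ I) :=
    hX'.eqOn_comp hlam hJ h0 hY h hYpos hI h0I hθc hbij hinv
  refine ⟨heq.mono (inter_subset_inter_right _ hsub), fun t ht hTt => ?_⟩
  have hTJ : T ∈ J := hJ.out h0 ht ⟨hT0.le, hTt⟩
  have hXT : X' T = const c := by
    have hle : 𝓝[<] T ≤ 𝓝[J] T := by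
      rw [← nhdsWithin_Ioo_eq_nhdsLT hT0]
      exact nhdsWithin_mono _ fun s hs => hJ.out h0 hTJ (Ioo_subset_Icc_self hs)
    refine tendsto_nhds_unique (((hX'.continuousOn T hTJ).tendsto).mono_left hle) (hXlim.congr' ?_)
    filter_upwards [Ioo_mem_nhdsLT hT0] with s hs
    exact (heq ⟨hJ.out h0 hTJ (Ioo_subset_Icc_self hs), hsub (Ioo_subset_Ico_self hs)⟩).symm
  rw [hX'.eq_of_length_eq_zero hlam hJ hTJ ht hTt (by rw [hXT, length_const]), hXT]

/-- Collapse in infinite time for `2 ≤ a`. -/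
theorem exists_collapse_of_two_le (hlam : 0 < lam) (hY : IsGradientFlow lam 2 univ Y)
    (hYpos : ∀ t, 0 < (Y t).length) {c : Plane} (hc : Tendsto Y atTop (𝓝 (const c))) (ha : 2 ≤ a) :
    ∃ X : ℝ → W11, IsGradientFlow lam a (Ici 0) X ∧ X 0 = Y 0 ∧
      (∀ t : ℝ, 0 ≤ t → 0 < (X t).length) ∧ ConvergesToPoint X atTop c ∧
      ∀ (J : Set ℝ) (X' : ℝ → W11), J.OrdConnected → (0 : ℝ) ∈ J →
        IsGradientFlow lam a J X' → X' 0 = Y 0 → EqOn X' X (J ∩ Ici 0) := by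
  obtain ⟨I, θ, hI, h0I, hθ0, hmono, hbij, hθc, hinv, hrange, hflow⟩ :=
    exists_maximal_time_change hlam a hY hYpos
  have hsub : Ici 0 ⊆ I := fun t (ht : 0 ≤ t) => by
    have hL : 0 < (Y 0).length ^ (2 - a) := Real.rpow_pos_of_pos (hYpos 0) _
    have h1 := le_integral_length_rpow hlam hY hYpos ha (div_nonneg ht hL.le)
    rw [div_mul_cancel₀ _ hL.ne'] at h1
    exact hI.out h0I (hrange ▸ mem_range_self (t / (Y 0).length ^ (2 - a))) ⟨ht, h1⟩
  have hθlim : Tendsto θ atTop atTop := by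
    refine tendsto_atTop.2 fun N => ?_
    obtain ⟨s, hs, h⟩ := hbij.surjOn (mem_univ N)
    filter_upwards [eventually_ge_atTop (max s 0)] with t ht
    rw [← h]
    exact hmono.monotoneOn hs (hsub ((le_max_right _ _).trans ht)) ((le_max_left _ _).trans ht)
  refine ⟨Y ∘ θ, hflow.mono hsub, by rw [Function.comp_apply, hθ0], fun t _ => hYpos _,
    convergesToPoint_of_tendsto (hc.comp hθlim), fun J X' hJ h0 hX' h => ?_⟩
  exact (hX'.eqOn_comp hlam hJ h0 hY h hYpos hI h0I hθc hbij hinv).mono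
    (inter_subset_inter_right _ hsub)

theorem exists_local_flow (hlam : 0 < lam) (a : ℝ) (hY : IsGradientFlow lam 2 univ Y)
    (hYpos : ∀ t, 0 < (Y t).length) :
    ∃ T₀ : ℝ, 0 < T₀ ∧ ∃ X : ℝ → W11, IsGradientFlow lam a (Icc (-T₀) T₀) X ∧ X 0 = Y 0 ∧
      ∀ X' : ℝ → W11, IsGradientFlow lam a (Icc (-T₀) T₀) X' → X' 0 = Y 0 →
        EqOn X' X (Icc (-T₀) T₀) := by
  obtain ⟨I, θ, hI, h0I, hθ0, hmono, hbij, hθc, hinv, -, hflow⟩ :=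
    exists_maximal_time_change hlam a hY hYpos
  obtain ⟨⟨s, hs, hs0⟩, r, hr, hr0⟩ := exists_lt_mem_of_bijOn hmono hbij h0I
  have hT : 0 < min (-s) r := lt_min (neg_pos.2 hs0) hr0
  have hsub : Icc (-min (-s) r) (min (-s) r) ⊆ I := fun t ht =>
    hI.out hs hr ⟨by linarith [min_le_left (-s) r, ht.1], ht.2.trans (min_le_right _ _)⟩
  refine ⟨_, hT, Y ∘ θ, hflow.mono hsub, by rw [Function.comp_apply, hθ0], fun X' hX' h t ht => ?_⟩
  have h0 : (0 : ℝ) ∈ Icc (-min (-s) r) (min (-s) r) := ⟨by linarith, hT.le⟩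
  exact hX'.eqOn_comp hlam ordConnected_Icc h0 hY h hYpos hI h0I hθc hbij hinv ⟨ht, hsub ht⟩

end TimeChange

end

theorem theorem1p1 (lam a : ℝ) (hlam : 0 < lam) (X₀ : W11) (hX₀ : 0 < X₀.length) :
    -- (i) local well-posedness
    (∃ T₀ : ℝ, 0 < T₀ ∧ ∃ X : ℝ → W11,
      IsGradientFlow lam a (Icc (-T₀) T₀) X ∧ X 0 = X₀ ∧
      ∀ X' : ℝ → W11, IsGradientFlow lam a (Icc (-T₀) T₀) X' → X' 0 = X₀ →
        EqOn X' X (Icc (-T₀) T₀)) ∧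
    -- (ii) a solution of the flow with exponent `a` reparametrises to a solution of the flow with
    -- exponent `2`, which extends to all later times
    (∀ (J : Set ℝ) (X : ℝ → W11), J.OrdConnected → (0 : ℝ) ∈ J →
      IsGradientFlow lam a J X → X 0 = X₀ → (∀ t ∈ J, 0 < (X t).length) →
      ∃ (I : Set ℝ) (θ : ℝ → ℝ) (Y : ℝ → W11), I.OrdConnected ∧ (0 : ℝ) ∈ I ∧ θ 0 = 0 ∧
        StrictMonoOn θ I ∧ BijOn θ I J ∧
        (∀ τ ∈ I, HasDerivWithinAt θ ((X (θ τ)).length ^ (2 - a)) I τ) ∧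
        EqOn Y (X ∘ θ) I ∧ IsGradientFlow lam 2 (I ∪ Ici 0) Y) ∧
    -- (ii) conversely, solutions with exponent `2` reparametrise to solutions with exponent `a`
    (∀ (I : Set ℝ) (Y : ℝ → W11), I.OrdConnected → (0 : ℝ) ∈ I →
      IsGradientFlow lam 2 I Y → Y 0 = X₀ →
      ∃ (J : Set ℝ) (φ : ℝ → ℝ), J.OrdConnected ∧ (0 : ℝ) ∈ J ∧ φ 0 = 0 ∧
        StrictMonoOn φ J ∧ BijOn φ J I ∧
        (∀ t ∈ J, HasDerivWithinAt φ ((Y (φ t)).length ^ (a - 2)) J t) ∧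
        IsGradientFlow lam a J (Y ∘ φ)) ∧
    -- (ii) global existence and uniqueness for the exponent `2`
    (∃ Y : ℝ → W11, IsGradientFlow lam 2 (Ici 0) Y ∧ Y 0 = X₀ ∧
      ∀ Y' : ℝ → W11, IsGradientFlow lam 2 (Ici 0) Y' → Y' 0 = X₀ → EqOn Y' Y (Ici 0)) ∧
    -- (iii) exponential decay of the length
    (∀ (I : Set ℝ) (Y : ℝ → W11), I.OrdConnected → (0 : ℝ) ∈ I →
      IsGradientFlow lam 2 I Y → Y 0 = X₀ →
      ∀ t ∈ I, 0 ≤ t → (Y t).length ≤ X₀.length * Real.exp (-4 * t / (1 + 8 * lam ^ 2))) ∧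
    -- (iv) convergence for the exponent `2`
    (∀ Y : ℝ → W11, IsGradientFlow lam 2 (Ici 0) Y → Y 0 = X₀ →
      ∃ c : Plane, ConvergesToPoint Y atTop c) ∧
    -- (iv) collapse to a point in finite time if `a < 2`
    (a < 2 → ∃ (T : ℝ) (X : ℝ → W11) (c : Plane), 0 < T ∧
      IsGradientFlow lam a (Ico 0 T) X ∧ X 0 = X₀ ∧ (∀ t ∈ Ico 0 T, 0 < (X t).length) ∧
      ConvergesToPoint X (𝓝[<] T) c ∧
      ∀ (J : Set ℝ) (X' : ℝ → W11), J.OrdConnected → (0 : ℝ) ∈ J →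
        IsGradientFlow lam a J X' → X' 0 = X₀ →
        EqOn X' X (J ∩ Ico 0 T) ∧ ∀ t ∈ J, T ≤ t → X' t = W11.const c) ∧
    -- (iv) collapse to a point in infinite time if `2 ≤ a`
    (2 ≤ a → ∃ (X : ℝ → W11) (c : Plane),
      IsGradientFlow lam a (Ici 0) X ∧ X 0 = X₀ ∧ (∀ t : ℝ, 0 ≤ t → 0 < (X t).length) ∧
      ConvergesToPoint X atTop c ∧
      ∀ (J : Set ℝ) (X' : ℝ → W11), J.OrdConnected → (0 : ℝ) ∈ J →
        IsGradientFlow lam a J X' → X' 0 = X₀ → EqOn X' X (J ∩ Ici 0)) := by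
  obtain ⟨Y, rfl, hY, hYpos⟩ := exists_isGradientFlow_univ hlam hX₀
  obtain ⟨c, hc⟩ := hY.exists_tendsto_const hlam
  refine ⟨exists_local_flow hlam a hY hYpos, ?_, ?_, ⟨Y, hY.mono (subset_univ _), rfl, ?_⟩, ?_, ?_,
    fun ha => ?_, fun ha => ?_⟩
  · intro J X hJ h0 hX hX0 hpos
    obtain ⟨I, θ, hI, h0I, hθ0, hmono, hbij, hθ, hflow, -, -⟩ :=
      hX.exists_time_change hlam hJ h0 hpos 2
    exact ⟨I, θ, Y, hI, h0I, hθ0, hmono, hbij, hθ, (hY.mono (subset_univ _)).eqOn hlam hI hflow h0I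
      (by rw [Function.comp_apply, hθ0, hX0]), hY.mono (subset_univ _)⟩
  · intro I Z hI h0 hZ hZ0
    have hZY : EqOn Z Y I := hZ.eqOn hlam hI (hY.mono (subset_univ _)) h0 hZ0
    obtain ⟨J, φ, hJ, h0J, hφ0, hmono, hbij, hφ, hflow, -, -⟩ :=
      hZ.exists_time_change hlam hI h0 (fun t ht => hZY ht ▸ hYpos t) a
    exact ⟨J, φ, hJ, h0J, hφ0, hmono, hbij, hφ, hflow⟩
  · intro Y' hY' h
    exact hY'.eqOn hlam ordConnected_Ici (hY.mono (subset_univ _)) self_mem_Ici h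
  · intro I Z hI h0 hZ hZ0 t ht ht0
    have h := hZ.length_le_exp hlam hI h0 ht ht0
    rw [hZ0, sub_zero, W11.decayRate] at h
    refine h.trans_eq ?_
    congr 2
    ring
  · intro Z hZ hZ0
    have heq : EqOn Z Y (Ici 0) :=
      hZ.eqOn hlam ordConnected_Ici (hY.mono (subset_univ _)) self_mem_Ici hZ0
    exact ⟨c, convergesToPoint_of_tendsto <| hc.congr' <|
      (eventually_ge_atTop 0).mono fun t ht => (heq ht).symm⟩
  · obtain ⟨T, X, h⟩ := exists_collapse_of_lt_two hlam hY hYpos hc ha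
    exact ⟨T, X, c, h⟩
  · obtain ⟨X, h⟩ := exists_collapse_of_two_le hlam hY hYpos hc ha
    exact ⟨X, c, h⟩
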